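/- Fix a countably saturated nonstandard universe, with hyperintegers ${}^*\mathbb N\supseteq\mathbb N$. *Borel* subsets of ${}^*\mathbb N$ and of ${}^*\mathbb N\times{}^*\mathbb N$ are the members of the least $\sigma$-algebra containing all internal sets; *countably determined* (CD) sets are those of the form $\bigcup_{b\in B}\bigl(\bigcap_{m\in b}X_m\cap\bigcap_{m\notin b}(\bigcup_nX_n\setminus X_m)\bigr)$ with $X_m$ $(m\in\mathbb N)$ internal and $B\subseteq\mathcal P(\mathbb N)$. For equivalence relations $E,F$ on ${}^*\mathbb N$, write $E\le_B F$ (resp. $E\le_{CD}F$) if there is a map $\vartheta:{}^*\mathbb N\to{}^*\mathbb N$ with Borel (resp. CD) graph such that $x\mathrel Ex'\iff\vartheta(x)\mathrel F\vartheta(x')$ for all $x,x'$; $E<_BF$ means $E\le_BF$ and $F\not\le_BE$. Let $D({}^*\mathbb N)$ be equality on ${}^*\mathbb N$; $E$ is *B-smooth* if $E\le_BD({}^*\mathbb N)$ and *CD-smooth* if $E\le_{CD}D({}^*\mathbb N)$. A *cut* is an initial segment $U$ of ${}^*\mathbb N$; it is *additive* if $x+y\in U$ for all $x,y\in U$; then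 $x\mathrel{E_U}y$ means $|x-y|\in U$. A cut is *countably cofinal* if it is $\bigcup_n[0,a_n)$ for a strictly increasing sequence $(a_n)_{n\in\mathbb N}$ in ${}^*\mathbb N$, and *countably coinitial* if it is $\bigcap_n[0,a_n)$ for a strictly decreasing one. An additive cut is *slow* if it is countably cofinal and of the form $c\mathbb N=\{y:\exists n\in\mathbb N\ \exists x<c\ (y\le xn)\}$ with $c\in{}^*\mathbb N$, or countably coinitial and of the form $c/\mathbb N=\{y:\forall n\in\mathbb N\ (yn<c)\}$ with $c\in{}^*\mathbb N\setminus\mathbb N$; the other additive countably cofinal or countably coinitial cuts are *fast*. For countably cofinal additive cuts, $U\preccurlyeq V$ means that there are strictly increasing sequences $(a_n),(b_k)$ in ${}^*\mathbb N$ with $U=\bigcup_n[0,2^{a_n})$, $V=\bigcup_k[0,2^{b_k})$ and $\forall k\,\exists n\,\forall n'>n\,\exists k'>k\ (a_{n'}-a_n\le b_{k'}-b_k)$. For countably coinitial additive cuts, $U\preccurlyeq V$ means that there are strictly decreasing sequences $(a_n),(b_k)$ in ${}^*\mathbb N$ with $U=\bigcap_n[0,2^{a_n})$, $V=\bigcap_k[0,2^{b_k})$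 and $\forall k\,\exists n\,\forall n'>n\,\exists k'>k\ (a_n-a_{n'}\le b_k-b_{k'})$. **Theorem.** Let $U,V$ be additive CD cuts other than $\emptyset$ and ${}^*\mathbb N$. Then $D({}^*\mathbb N)\le_BE_U$. In addition: (i) if $U,V$ are both countably cofinal or both countably coinitial, then $E_U\le_BE_V$ or $E_V\le_BE_U$, and $E_U\le_BE_V\iff E_U\le_{CD}E_V\iff U\preccurlyeq V$; in particular, if $U$ is slow then $E_U\le_{CD}E_V$; (ii) if $U$ is countably cofinal and $V$ is countably coinitial, then $E_V\not\le_{CD}E_U$ and $E_U\not\le_BE_V$, while $E_U\le_{CD}E_V$ holds iff $U$ is slow; (iii) if $U\ne\{0\}$, then $E_U$ is not B-smooth, and $E_U$ is CD-smooth iff $U$ is countably cofinal and slow; (iv) for any sequence $(U_n)_{n\in\mathbb N}$ of countably cofinal fast cuts there are countably cofinal fast cuts $U,V$ with $E_U<_BE_{U_n}<_BE_V$ for all $n$; and the same holds with "countably coinitial" in place of "countably cofinal". -/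

import Mathlib

universe u

/-- A nonstandard universe: every standard type `X` has a nonstandard extension `Star X`, every
standard function extends to the nonstandard domains, every standard object `x` has its
nonstandard copy `std x`, and transfer holds.  The laws say that the extension commutes with the
constituents of first-order formulas: composition of functions (`map_id`, `map_comp`), constants
(`map_std`), tuples (`existsUnique_pair`), equality (`mem_of_map_eq`) and negation (`mem_compl_iff`);
the extension of a set `A` of elements of `X` is the range of `Star A → Star X`.  Commutation with
conjunctions and with existential quantifiers (via Skolem functions) follows. -/
structure NonstandardUniverse where
  Star : Type → Type u
  map : ∀ {X Y : Type}, (X → Y) → Star X → Star Y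
  std : ∀ {X : Type}, X → Star X
  map_id : ∀ {X : Type} (ξ : Star X), map (fun x : X => x) ξ = ξ
  map_comp : ∀ {X Y Z : Type} (g : Y → Z) (f : X → Y) (ξ : Star X),
    map (fun x => g (f x)) ξ = map g (map f ξ)
  map_std : ∀ {X Y : Type} (f : X → Y) (x : X), map f (std x) = std (f x)
  existsUnique_pair : ∀ {X Y : Type} (ξ : Star X) (η : Star Y),
    ∃! ζ : Star (X × Y), map Prod.fst ζ = ξ ∧ map Prod.snd ζ = η
  mem_of_map_eq : ∀ {X Y : Type} (f g : X → Y) (ξ : Star X), map f ξ = map g ξ →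
    ξ ∈ Set.range (map (Subtype.val : {x : X // f x = g x} → X))
  mem_compl_iff : ∀ {X : Type} (A : Set X) (ξ : Star X),
    ξ ∈ Set.range (map (Subtype.val : {x : X // x ∉ A} → X)) ↔
      ξ ∉ Set.range (map (Subtype.val : {x : X // x ∈ A} → X))

namespace NonstandardUniverse

variable (𝔘 : NonstandardUniverse.{u})

/-- The nonstandard extension `*A ⊆ *X` of a standard set `A ⊆ X`. -/
def starSet {X : Type} (A : Set X) : Set (𝔘.Star X) :=
  Set.range (𝔘.map (Subtype.val : {x : X // x ∈ A} → X))

/-- The pair `(ξ, η)`, as an element of `*(X × Y)`. -/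
noncomputable def pair {X Y : Type} (ξ : 𝔘.Star X) (η : 𝔘.Star Y) : 𝔘.Star (X × Y) :=
  (𝔘.existsUnique_pair ξ η).choose

/-- The nonstandard extension of a function of two variables. -/
noncomputable def map₂ {X Y Z : Type} (f : X → Y → Z) (ξ : 𝔘.Star X) (η : 𝔘.Star Y) : 𝔘.Star Z :=
  𝔘.map (fun p : X × Y => f p.1 p.2) (𝔘.pair ξ η)

/-- The nonstandard extension of a binary relation. -/
def rel {X Y : Type} (r : X → Y → Prop) (ξ : 𝔘.Star X) (η : 𝔘.Star Y) : Prop :=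
  𝔘.pair ξ η ∈ 𝔘.starSet {p : X × Y | r p.1 p.2}

/-! ### Internal, Borel and countably determined sets -/

/-- Internal subsets of `*X` are those coded by an element `a` of `*(𝒫 X)`. -/
def IsInternal {X : Type} (A : Set (𝔘.Star X)) : Prop :=
  ∃ a : 𝔘.Star (Set X), A = {ξ | 𝔘.rel (fun (x : X) (s : Set X) => x ∈ s) ξ a}

/-- Countable saturation: a countable family of internal sets with the finite intersection
property has non-empty intersection. -/
def CountablySaturated : Prop :=
  ∀ (X : Type) (A : ℕ → Set (𝔘.Star X)), (∀ n, 𝔘.IsInternal (A n)) →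
    (∀ s : Finset ℕ, (⋂ n ∈ s, A n).Nonempty) → (⋂ n, A n).Nonempty

/-- Borel sets: the least σ-algebra containing all internal sets. -/
def IsBorel {X : Type} (A : Set (𝔘.Star X)) : Prop :=
  (MeasurableSpace.generateFrom {C : Set (𝔘.Star X) | 𝔘.IsInternal C}).MeasurableSet' A

/-- Countably determined (CD) sets. -/
def IsCD {X : Type} (A : Set (𝔘.Star X)) : Prop :=
  ∃ (C : ℕ → Set (𝔘.Star X)) (B : Set (Set ℕ)), (∀ m, 𝔘.IsInternal (C m)) ∧
    A = ⋃ b ∈ B, (⋂ m ∈ b, C m) ∩ ⋂ m ∈ bᶜ, ((⋃ n, C n) \ C m)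

/-- The graph of a map `*X → *Y`, as a subset of `*(X × Y)` (that is, of `*X × *Y`). -/
def graph {X Y : Type} (ϑ : 𝔘.Star X → 𝔘.Star Y) : Set (𝔘.Star (X × Y)) :=
  {ζ | ϑ (𝔘.map Prod.fst ζ) = 𝔘.map Prod.snd ζ}

/-! ### Hyperintegers -/

/-- The hyperintegers `*ℕ`. -/
abbrev HN : Type u := 𝔘.Star ℕ

noncomputable instance : Add 𝔘.HN := ⟨𝔘.map₂ (fun m n : ℕ => m + n)⟩
noncomputable instance : Mul 𝔘.HN := ⟨𝔘.map₂ (fun m n : ℕ => m * n)⟩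
/-- Truncated subtraction. -/
noncomputable instance : Sub 𝔘.HN := ⟨𝔘.map₂ (fun m n : ℕ => m - n)⟩
instance : LE 𝔘.HN := ⟨𝔘.rel (fun m n : ℕ => m ≤ n)⟩
instance : LT 𝔘.HN := ⟨𝔘.rel (fun m n : ℕ => m < n)⟩

variable {𝔘}

/-- The distance `|x - y|` in `*ℕ`. -/
noncomputable def hdist (x y : 𝔘.HN) : 𝔘.HN := 𝔘.map₂ Nat.dist x y

/-- The power `2 ^ a` for `a` in `*ℕ`. -/
def twoPow (a : 𝔘.HN) : 𝔘.HN := 𝔘.map (fun n : ℕ => 2 ^ n) a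

/-- `c ∈ *ℕ \ ℕ`. -/
def IsInfinite (c : 𝔘.HN) : Prop := ∀ n : ℕ, c ≠ 𝔘.std n

/-! ### Reducibility of equivalence relations on `*ℕ` -/

/-- Borel reducibility `E ≤_B F`. -/
def BorelRed (E F : 𝔘.HN → 𝔘.HN → Prop) : Prop :=
  ∃ ϑ : 𝔘.HN → 𝔘.HN, 𝔘.IsBorel (𝔘.graph ϑ) ∧ ∀ x x', E x x' ↔ F (ϑ x) (ϑ x')

/-- Countably determined reducibility `E ≤_CD F`. -/
def CDRed (E F : 𝔘.HN → 𝔘.HN → Prop) : Prop :=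
  ∃ ϑ : 𝔘.HN → 𝔘.HN, 𝔘.IsCD (𝔘.graph ϑ) ∧ ∀ x x', E x x' ↔ F (ϑ x) (ϑ x')

/-- Strict Borel reducibility `E <_B F`. -/
def StrictBorelRed (E F : 𝔘.HN → 𝔘.HN → Prop) : Prop :=
  BorelRed E F ∧ ¬ BorelRed F E

variable (𝔘) in
/-- The equality relation `D(*ℕ)`. -/
def diag (x y : 𝔘.HN) : Prop := x = y

def BSmooth (E : 𝔘.HN → 𝔘.HN → Prop) : Prop := BorelRed E 𝔘.diag

def CDSmooth (E : 𝔘.HN → 𝔘.HN → Prop) : Prop := CDRed E 𝔘.diag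

/-! ### Cuts -/

/-- Cuts: initial segments of `*ℕ`. -/
def IsCut (U : Set 𝔘.HN) : Prop := ∀ x y : 𝔘.HN, x ≤ y → y ∈ U → x ∈ U

def IsAdditiveCut (U : Set 𝔘.HN) : Prop :=
  IsCut U ∧ ∀ x y : 𝔘.HN, x ∈ U → y ∈ U → x + y ∈ U

/-- The initial segment `[0, c)`. -/
def below (c : 𝔘.HN) : Set 𝔘.HN := {x | x < c}

def IsIncreasing (a : ℕ → 𝔘.HN) : Prop := ∀ m n, m < n → a m < a n

def IsDecreasing (a : ℕ → 𝔘.HN) : Prop := ∀ m n, m < n → a n < a m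

def IsCountablyCofinal (U : Set 𝔘.HN) : Prop :=
  ∃ a : ℕ → 𝔘.HN, IsIncreasing a ∧ U = ⋃ n, below (a n)

def IsCountablyCoinitial (U : Set 𝔘.HN) : Prop :=
  ∃ a : ℕ → 𝔘.HN, IsDecreasing a ∧ U = ⋂ n, below (a n)

/-- `Uℕ`, the least additive cut including the cut `U`. -/
def cutMul (U : Set 𝔘.HN) : Set 𝔘.HN := {y | ∃ n : ℕ, ∃ x ∈ U, y ≤ x * 𝔘.std n}

/-- `U/ℕ`, the largest additive cut included in the cut `U`. -/
def cutDiv (U : Set 𝔘.HN) : Set 𝔘.HN := {y | ∀ n : ℕ, y * 𝔘.std n ∈ U}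

/-- Slow cuts: countably cofinal cuts `cℕ` and countably coinitial cuts `c/ℕ` (`c` infinite). -/
def IsSlow (U : Set 𝔘.HN) : Prop :=
  IsAdditiveCut U ∧
    ((IsCountablyCofinal U ∧ ∃ c : 𝔘.HN, U = cutMul (below c)) ∨
      (IsCountablyCoinitial U ∧ ∃ c : 𝔘.HN, IsInfinite c ∧ U = cutDiv (below c)))

/-- Fast cuts: the other additive countably cofinal or countably coinitial cuts. -/
def IsFast (U : Set 𝔘.HN) : Prop :=
  IsAdditiveCut U ∧ (IsCountablyCofinal U ∨ IsCountablyCoinitial U) ∧ ¬ IsSlow U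

/-- The growth-rate order `U ≼ V` for countably cofinal additive cuts. -/
def CofinalLE (U V : Set 𝔘.HN) : Prop :=
  ∃ a b : ℕ → 𝔘.HN, IsIncreasing a ∧ IsIncreasing b ∧
    U = (⋃ n, below (twoPow (a n))) ∧ V = (⋃ k, below (twoPow (b k))) ∧
    ∀ k, ∃ n, ∀ n' > n, ∃ k' > k, a n' - a n ≤ b k' - b k

/-- The growth-rate order `U ≼ V` for countably coinitial additive cuts. -/
def CoinitialLE (U V : Set 𝔘.HN) : Prop :=
  ∃ a b : ℕ → 𝔘.HN, IsDecreasing a ∧ IsDecreasing b ∧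
    U = (⋂ n, below (twoPow (a n))) ∧ V = (⋂ k, below (twoPow (b k))) ∧
    ∀ k, ∃ n, ∀ n' > n, ∃ k' > k, a n - a n' ≤ b k - b k'

/-- The monadic relation `E_U`: `x E_U y` iff `|x - y| ∈ U`. -/
def monadic (U : Set 𝔘.HN) (x y : 𝔘.HN) : Prop := hdist x y ∈ U

/-- Additive CD cuts other than `∅` and `*ℕ`. -/
def IsProperAdditiveCDCut (U : Set 𝔘.HN) : Prop :=
  IsAdditiveCut U ∧ 𝔘.IsCD U ∧ U ≠ ∅ ∧ U ≠ Set.univ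

end NonstandardUniverse

open NonstandardUniverse (BorelRed CDRed StrictBorelRed BSmooth CDSmooth monadic
  IsProperAdditiveCDCut IsCountablyCofinal IsCountablyCoinitial IsSlow IsFast CofinalLE CoinitialLE)

namespace NonstandardUniverse

open Filter

variable {𝔘 : NonstandardUniverse.{u}} {X Y Z Ω : Type}

/-! ### Transfer -/

/-! Finitely many nonstandard elements are images of a single `ω : Star Ω`, and the standard sets
whose extension contains `ω` form an ultrafilter `filt ω`. A first-order assertion about these
elements thus becomes an assertion about natural numbers that holds eventually along `filt ω`.
Countable saturation supplies whatever needs countably many conditions at once.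

An additive cut is closed under doubling, so its bounds can be taken to be powers `2 ^ a n`. An
interval of length `2 ^ a n'` contains `2 ^ (a n' - a n)` blocks of length `2 ^ a n`; a reduction of
`E_U` to `E_V` has to fit these blocks into those of the target, and this is what the growth
condition `U ≼ V` measures.

Necessity is a counting argument. A CD graph contains, with each point, the intersection of a
decreasing sequence of internal sets, and only countably many internal sets occur in these
sequences. On such an intersection both directions of the reduction hold, and `exists_dist_imp`
makes them uniform on one internal member of the sequence. If the growth condition fails,
`countBelow_image_mul_le` shows that this member projects onto a set of infinitesimal density in
some `[0, 2 ^ c)`. Countably many such sets do not cover the domain (`exists_notMem`). The same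
count excludes CD reductions of fast cofinal relations to coinitial ones and to equality.

Sufficiency is a construction. `Nat.exists_spread` moves the block of binary digits between two
consecutive exponents of the source to a sufficiently wide place in the target, with a zero digit in
front to stop interference. Distance and equality of quotients differ only through carries, and a
Borel map first moves every point to an equivalent one at which carries do no harm.

For cuts of different kinds two further arguments are needed. A coinitial relation is not CD
reducible to a cofinal one or to equality by a Baire category argument with nested balls. A cofinal
relation, even a slow one, is not Borel reducible to a coinitial one or to equality because Borel
sets are approximated in counting measure by internal sets (`IsBorel.approx`), and on an internal
part of the graph the count succeeds with finite gaps. A slow cofinal relation is CD-smooth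
nevertheless: up to division by a power of two it is the relation of finite distance, and a
representative of each class is determined by the standard residues modulo all `2 ^ n`.

Every proper additive CD cut other than `{0}` is countably cofinal or coinitial
(`cofinal_or_coinitial`), which makes (iii) exhaustive. For (iv), saturation gives an infinite `g`
whose finite multiples lie below countably many given infinite gaps, and a `G` above all the given
exponents; cuts with gaps `g` and `G` are the two bounds. -/

theorem mem_starSet_compl {A : Set X} {ξ : 𝔘.Star X} : ξ ∈ 𝔘.starSet Aᶜ ↔ ξ ∉ 𝔘.starSet A :=
  𝔘.mem_compl_iff A ξ

theorem map_mem_starSet_of_mem {f : X → Y} {A : Set X} {B : Set Y} (h : ∀ x ∈ A, f x ∈ B)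
    {ξ : 𝔘.Star X} (hξ : ξ ∈ 𝔘.starSet A) : 𝔘.map f ξ ∈ 𝔘.starSet B := by
  obtain ⟨α, rfl⟩ := hξ
  refine ⟨𝔘.map (fun x : {x // x ∈ A} => (⟨f x.1, h x.1 x.2⟩ : {y // y ∈ B})) α, ?_⟩
  rw [← 𝔘.map_comp, ← 𝔘.map_comp]

theorem starSet_mono {A B : Set X} (h : A ⊆ B) : 𝔘.starSet A ⊆ 𝔘.starSet B := by
  intro ξ hξ
  have := map_mem_starSet_of_mem (f := fun x => x) (B := B) (fun x hx => h hx) hξ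
  rwa [𝔘.map_id] at this

/-- Pushing forward along `f` gives one direction; the other is the same fact for the complement of
`B`, since the extension commutes with negation. -/
theorem map_mem_starSet {f : X → Y} {B : Set Y} {ξ : 𝔘.Star X} :
    𝔘.map f ξ ∈ 𝔘.starSet B ↔ ξ ∈ 𝔘.starSet {x | f x ∈ B} := by
  refine ⟨fun h => ?_, fun h =>
    map_mem_starSet_of_mem (f := f) (A := {x | f x ∈ B}) (B := B) (fun x hx => hx) h⟩
  by_contra hn
  rw [← mem_starSet_compl] at hn
  have := map_mem_starSet_of_mem (f := f) (B := Bᶜ) (fun x hx => hx) hn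
  exact mem_starSet_compl.1 this h

theorem starSet_inter {A B : Set X} {ξ : 𝔘.Star X} (hA : ξ ∈ 𝔘.starSet A)
    (hB : ξ ∈ 𝔘.starSet B) : ξ ∈ 𝔘.starSet (A ∩ B) := by
  obtain ⟨α, rfl⟩ := hA
  rw [map_mem_starSet] at hB ⊢
  refine starSet_mono ?_ hB
  exact fun x hx => ⟨x.2, hx⟩

theorem starSet_univ (ξ : 𝔘.Star X) : ξ ∈ 𝔘.starSet (Set.univ : Set X) := by
  by_contra h
  rw [← mem_starSet_compl] at h
  exact mem_starSet_compl.1 h (starSet_mono (by simp) h)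

/-- The ultrafilter of standard sets whose extension contains `ω`. -/
noncomputable def filt (ω : 𝔘.Star Ω) : Ultrafilter Ω :=
  Ultrafilter.ofComplNotMemIff
    { sets := {A | ω ∈ 𝔘.starSet A}
      univ_sets := starSet_univ ω
      sets_of_superset := fun h hs => starSet_mono hs h
      inter_sets := fun h h' => starSet_inter h h' }
    (fun s => by
      change ω ∉ 𝔘.starSet sᶜ ↔ ω ∈ 𝔘.starSet s
      rw [mem_starSet_compl, not_not])

theorem eventually_filt {ω : 𝔘.Star Ω} {p : Ω → Prop} :
    (∀ᶠ w in (filt ω : Filter Ω), p w) ↔ ω ∈ 𝔘.starSet {w | p w} := Iff.rfl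

@[simp] theorem eventually_filt_map {ω : 𝔘.Star Ω} {f : Ω → X} {p : X → Prop} :
    (∀ᶠ x in (filt (𝔘.map f ω) : Filter X), p x) ↔ ∀ᶠ w in (filt ω : Filter Ω), p (f w) := by
  rw [eventually_filt, eventually_filt, map_mem_starSet]; rfl

theorem eventually_filt_not {ω : 𝔘.Star Ω} {p : Ω → Prop} :
    (∀ᶠ w in (filt ω : Filter Ω), ¬ p w) ↔ ¬ ∀ᶠ w in (filt ω : Filter Ω), p w :=
  Ultrafilter.eventually_not

@[simp] theorem map_map (g : X → Y) (f : Ω → X) (ω : 𝔘.Star Ω) :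
    𝔘.map g (𝔘.map f ω) = 𝔘.map (fun w => g (f w)) ω := (𝔘.map_comp g f ω).symm

@[simp] theorem map_eq_map_iff {f g : Ω → X} {ω : 𝔘.Star Ω} :
    𝔘.map f ω = 𝔘.map g ω ↔ ∀ᶠ w in (filt ω : Filter Ω), f w = g w := by
  constructor
  · exact fun h => 𝔘.mem_of_map_eq f g ω h
  · rintro ⟨α, rfl⟩
    rw [map_map, map_map]
    congr 1
    funext x
    exact x.2

theorem pair_spec (ξ : 𝔘.Star X) (η : 𝔘.Star Y) :
    𝔘.map Prod.fst (𝔘.pair ξ η) = ξ ∧ 𝔘.map Prod.snd (𝔘.pair ξ η) = η :=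
  (𝔘.existsUnique_pair ξ η).choose_spec.1

@[simp] theorem map_fst_pair (ξ : 𝔘.Star X) (η : 𝔘.Star Y) :
    𝔘.map Prod.fst (𝔘.pair ξ η) = ξ := (pair_spec ξ η).1

@[simp] theorem map_snd_pair (ξ : 𝔘.Star X) (η : 𝔘.Star Y) :
    𝔘.map Prod.snd (𝔘.pair ξ η) = η := (pair_spec ξ η).2

@[simp] theorem pair_map (f : Ω → X) (g : Ω → Y) (ω : 𝔘.Star Ω) :
    𝔘.pair (𝔘.map f ω) (𝔘.map g ω) = 𝔘.map (fun w => (f w, g w)) ω :=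
  (𝔘.existsUnique_pair _ _).unique (pair_spec _ _) (by simp)

@[simp] theorem map₂_map (F : X → Y → Z) (f : Ω → X) (g : Ω → Y) (ω : 𝔘.Star Ω) :
    𝔘.map₂ F (𝔘.map f ω) (𝔘.map g ω) = 𝔘.map (fun w => F (f w) (g w)) ω := by
  simp [map₂]

@[simp] theorem rel_map (r : X → Y → Prop) (f : Ω → X) (g : Ω → Y) (ω : 𝔘.Star Ω) :
    𝔘.rel r (𝔘.map f ω) (𝔘.map g ω) ↔ ∀ᶠ w in (filt ω : Filter Ω), r (f w) (g w) := by
  rw [rel, pair_map, map_mem_starSet]; rfl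

theorem star_unit_subsingleton (ξ η : 𝔘.Star Unit) : ξ = η := by
  obtain ⟨h1, h2⟩ := pair_spec ξ η
  have h : (Prod.fst : Unit × Unit → Unit) = Prod.snd := rfl
  rw [h, h2] at h1
  exact h1.symm

/-- Allows a standard constant to be written over whichever `ω` represents the remaining parameters.
-/
theorem std_eq (ω : 𝔘.Star Ω) (x : X) : 𝔘.std x = 𝔘.map (fun _ : Ω => x) ω := by
  have h := star_unit_subsingleton (𝔘.std ()) (𝔘.map (fun _ : Ω => ()) ω)
  have h1 := 𝔘.map_std (fun _ : Unit => x) ()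
  rw [← h1, h, map_map]

@[simp] theorem eventually_filt_std {x : X} {p : X → Prop} :
    (∀ᶠ y in (filt (𝔘.std x) : Filter X), p y) ↔ p x := by
  rw [std_eq (𝔘.std ()) x, eventually_filt_map]
  simp

theorem rep₁ (ξ : 𝔘.Star X) : 𝔘.map (fun x => x) ξ = ξ := 𝔘.map_id ξ

/-- The entry to transfer: once the parameters are images of one `ω`, relations between them are
`∀ᶠ` statements along `filt ω`. -/
theorem rep₂ (ξ : 𝔘.Star X) (η : 𝔘.Star Y) :
    ∃ (Ω : Type) (ω : 𝔘.Star Ω) (f : Ω → X) (g : Ω → Y), 𝔘.map f ω = ξ ∧ 𝔘.map g ω = η :=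
  ⟨_, 𝔘.pair ξ η, Prod.fst, Prod.snd, pair_spec ξ η⟩

theorem rep₃ {X₁ X₂ X₃ : Type} (ξ₁ : 𝔘.Star X₁) (ξ₂ : 𝔘.Star X₂) (ξ₃ : 𝔘.Star X₃) :
    ∃ (Ω : Type) (ω : 𝔘.Star Ω) (f₁ : Ω → X₁) (f₂ : Ω → X₂) (f₃ : Ω → X₃),
      𝔘.map f₁ ω = ξ₁ ∧ 𝔘.map f₂ ω = ξ₂ ∧ 𝔘.map f₃ ω = ξ₃ := by
  obtain ⟨Ω, ω, f, g, rfl, rfl⟩ := rep₂ ξ₁ ξ₂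
  refine ⟨_, 𝔘.pair ω ξ₃, fun p => f p.1, fun p => g p.1, Prod.snd, ?_, ?_, by simp⟩
  · rw [𝔘.map_comp, map_fst_pair]
  · rw [𝔘.map_comp, map_fst_pair]

theorem rep₄ {X₁ X₂ X₃ X₄ : Type} (ξ₁ : 𝔘.Star X₁) (ξ₂ : 𝔘.Star X₂) (ξ₃ : 𝔘.Star X₃)
    (ξ₄ : 𝔘.Star X₄) :
    ∃ (Ω : Type) (ω : 𝔘.Star Ω) (f₁ : Ω → X₁) (f₂ : Ω → X₂) (f₃ : Ω → X₃) (f₄ : Ω → X₄),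
      𝔘.map f₁ ω = ξ₁ ∧ 𝔘.map f₂ ω = ξ₂ ∧ 𝔘.map f₃ ω = ξ₃ ∧ 𝔘.map f₄ ω = ξ₄ := by
  obtain ⟨Ω, ω, f, g, h, rfl, rfl, rfl⟩ := rep₃ ξ₁ ξ₂ ξ₃
  refine ⟨_, 𝔘.pair ω ξ₄, fun p => f p.1, fun p => g p.1, fun p => h p.1, Prod.snd,
    ?_, ?_, ?_, by simp⟩
  · rw [𝔘.map_comp, map_fst_pair]
  · rw [𝔘.map_comp, map_fst_pair]
  · rw [𝔘.map_comp, map_fst_pair]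

theorem rep₆ {X₁ X₂ X₃ X₄ X₅ X₆ : Type} (ξ₁ : 𝔘.Star X₁) (ξ₂ : 𝔘.Star X₂) (ξ₃ : 𝔘.Star X₃)
    (ξ₄ : 𝔘.Star X₄) (ξ₅ : 𝔘.Star X₅) (ξ₆ : 𝔘.Star X₆) :
    ∃ (Ω : Type) (ω : 𝔘.Star Ω) (f₁ : Ω → X₁) (f₂ : Ω → X₂) (f₃ : Ω → X₃) (f₄ : Ω → X₄)
      (f₅ : Ω → X₅) (f₆ : Ω → X₆),
      𝔘.map f₁ ω = ξ₁ ∧ 𝔘.map f₂ ω = ξ₂ ∧ 𝔘.map f₃ ω = ξ₃ ∧ 𝔘.map f₄ ω = ξ₄ ∧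
        𝔘.map f₅ ω = ξ₅ ∧ 𝔘.map f₆ ω = ξ₆ := by
  obtain ⟨Ω, ω, f₁, f₂, f₃, f₄, rfl, rfl, rfl, rfl⟩ := rep₄ ξ₁ ξ₂ ξ₃ ξ₄
  obtain ⟨Ω', ω', g, g₅, g₆, rfl, rfl, rfl⟩ := rep₃ ω ξ₅ ξ₆
  exact ⟨Ω', ω', fun w => f₁ (g w), fun w => f₂ (g w), fun w => f₃ (g w), fun w => f₄ (g w),
    g₅, g₆, by simp⟩

/-- Transfer of existential quantifiers. -/
theorem eventually_exists_iff {ω : 𝔘.Star Ω} {P : Ω → X → Prop} :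
    (∀ᶠ w in (filt ω : Filter Ω), ∃ x, P w x) ↔
      ∃ ω' : 𝔘.Star (Ω × X), 𝔘.map Prod.fst ω' = ω ∧
        ∀ᶠ p in (filt ω' : Filter (Ω × X)), P p.1 p.2 := by
  constructor
  · intro h
    obtain ⟨w₀, x₀, -⟩ := h.exists
    classical
    -- A Skolem function, with the arbitrary value `x₀` where no witness exists.
    let g : Ω → X := fun w => if hw : ∃ x, P w x then hw.choose else x₀
    refine ⟨𝔘.map (fun w => (w, g w)) ω, ?_, ?_⟩
    · rw [map_map]; exact 𝔘.map_id ω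
    · rw [eventually_filt_map]
      filter_upwards [h] with w hw
      simp only [g, dif_pos hw]
      exact hw.choose_spec
  · rintro ⟨ω', rfl, h⟩
    rw [eventually_filt_map]
    exact h.mono fun p hp => ⟨p.2, hp⟩

/-- Transfer of universal quantifiers. -/
theorem eventually_forall_iff {ω : 𝔘.Star Ω} {P : Ω → X → Prop} :
    (∀ᶠ w in (filt ω : Filter Ω), ∀ x, P w x) ↔
      ∀ ω' : 𝔘.Star (Ω × X), 𝔘.map Prod.fst ω' = ω →
        ∀ᶠ p in (filt ω' : Filter (Ω × X)), P p.1 p.2 := by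
  rw [← not_iff_not, ← eventually_filt_not]
  simp only [not_forall]
  rw [eventually_exists_iff]
  simp only [eventually_filt_not, exists_prop]

/-! ### Arithmetic of the hyperintegers -/

@[simp] theorem map_add_map (f g : Ω → ℕ) (ω : 𝔘.Star Ω) :
    𝔘.map f ω + 𝔘.map g ω = 𝔘.map (fun w => f w + g w) ω := map₂_map _ f g ω

@[simp] theorem map_mul_map (f g : Ω → ℕ) (ω : 𝔘.Star Ω) :
    𝔘.map f ω * 𝔘.map g ω = 𝔘.map (fun w => f w * g w) ω := map₂_map _ f g ω

@[simp] theorem map_sub_map (f g : Ω → ℕ) (ω : 𝔘.Star Ω) :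
    𝔘.map f ω - 𝔘.map g ω = 𝔘.map (fun w => f w - g w) ω := map₂_map _ f g ω

@[simp] theorem map_le_map (f g : Ω → ℕ) (ω : 𝔘.Star Ω) :
    𝔘.map f ω ≤ 𝔘.map g ω ↔ ∀ᶠ w in (filt ω : Filter Ω), f w ≤ g w := rel_map _ f g ω

@[simp] theorem map_lt_map (f g : Ω → ℕ) (ω : 𝔘.Star Ω) :
    𝔘.map f ω < 𝔘.map g ω ↔ ∀ᶠ w in (filt ω : Filter Ω), f w < g w := rel_map _ f g ω

@[simp] theorem hdist_map (f g : Ω → ℕ) (ω : 𝔘.Star Ω) :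
    hdist (𝔘.map f ω) (𝔘.map g ω) = 𝔘.map (fun w => Nat.dist (f w) (g w)) ω := map₂_map _ f g ω

@[simp] theorem twoPow_map (f : Ω → ℕ) (ω : 𝔘.Star Ω) :
    twoPow (𝔘.map f ω) = 𝔘.map (fun w => 2 ^ f w) ω := map_map _ f ω

noncomputable instance : LinearOrder 𝔘.HN where
  le_refl x := by
    rw [← rep₁ x]; simp
  le_trans x y z h h' := by
    obtain ⟨Ω, ω, f, g, k, rfl, rfl, rfl⟩ := rep₃ x y z
    simp only [map_le_map] at *
    filter_upwards [h, h'] with w h1 h2 using h1.trans h2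
  le_antisymm x y h h' := by
    obtain ⟨Ω, ω, f, g, rfl, rfl⟩ := rep₂ x y
    simp only [map_le_map, map_eq_map_iff] at *
    filter_upwards [h, h'] with w h1 h2 using le_antisymm h1 h2
  le_total x y := by
    obtain ⟨Ω, ω, f, g, rfl, rfl⟩ := rep₂ x y
    simp only [map_le_map, ← Ultrafilter.eventually_or]
    exact Eventually.of_forall fun w => le_total _ _
  lt_iff_le_not_ge x y := by
    obtain ⟨Ω, ω, f, g, rfl, rfl⟩ := rep₂ x y
    simp only [map_le_map, map_lt_map, ← eventually_filt_not, ← eventually_and]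
    simp only [lt_iff_le_not_ge]
  toDecidableLE := Classical.decRel _

@[simp] theorem std_le_std {m n : ℕ} : 𝔘.std m ≤ 𝔘.std n ↔ m ≤ n := by
  rw [std_eq (𝔘.std ()) m, std_eq (𝔘.std ()) n]; simp

@[simp] theorem std_lt_std {m n : ℕ} : 𝔘.std m < 𝔘.std n ↔ m < n := by
  rw [std_eq (𝔘.std ()) m, std_eq (𝔘.std ()) n]; simp

theorem std_injective {m n : ℕ} : 𝔘.std m = 𝔘.std n ↔ m = n := by
  rw [std_eq (𝔘.std ()) m, std_eq (𝔘.std ()) n]; simp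

theorem std_add_std (m n : ℕ) : 𝔘.std m + 𝔘.std n = 𝔘.std (m + n) := by
  rw [std_eq (𝔘.std ()) m, std_eq (𝔘.std ()) n, std_eq (𝔘.std ()) (m + n)]; simp

theorem zero_le_hn (x : 𝔘.HN) : 𝔘.std 0 ≤ x := by
  rw [← rep₁ x, std_eq x]; simp

theorem add_one_le_iff {x y : 𝔘.HN} : x + 𝔘.std 1 ≤ y ↔ x < y := by
  obtain ⟨Ω, ω, f, g, rfl, rfl⟩ := rep₂ x y
  rw [std_eq ω]; simp

theorem lt_add_one_iff {x y : 𝔘.HN} : x < y + 𝔘.std 1 ↔ x ≤ y := by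
  obtain ⟨Ω, ω, f, g, rfl, rfl⟩ := rep₂ x y
  rw [std_eq ω]; simp

theorem add_std_zero (x : 𝔘.HN) : x + 𝔘.std 0 = x := by
  rw [← rep₁ x, std_eq x]; simp

theorem add_std_add_std (x : 𝔘.HN) (m n : ℕ) : x + 𝔘.std m + 𝔘.std n = x + 𝔘.std (m + n) := by
  rw [← rep₁ x, std_eq x, std_eq x, std_eq x]; simp [Nat.add_assoc]

theorem twoPow_le_twoPow {x y : 𝔘.HN} : twoPow x ≤ twoPow y ↔ x ≤ y := by
  obtain ⟨Ω, ω, f, g, rfl, rfl⟩ := rep₂ x y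
  simp [Nat.pow_le_pow_iff_right]

theorem twoPow_lt_twoPow {x y : 𝔘.HN} : twoPow x < twoPow y ↔ x < y := by
  obtain ⟨Ω, ω, f, g, rfl, rfl⟩ := rep₂ x y
  simp [Nat.pow_lt_pow_iff_right]

theorem twoPow_add_one (x : 𝔘.HN) : twoPow (x + 𝔘.std 1) = twoPow x + twoPow x := by
  rw [← rep₁ x, std_eq x]
  simp [pow_succ, mul_two]

theorem IsIncreasing.add_le {a : ℕ → 𝔘.HN} (h : IsIncreasing a) (n m : ℕ) :
    a n + 𝔘.std m ≤ a (n + m) := by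
  induction m with
  | zero => rw [add_std_zero]; rfl
  | succ m ih =>
    rw [← add_std_add_std, add_one_le_iff]
    exact ih.trans_lt (h _ _ (by omega))

theorem IsDecreasing.add_le {a : ℕ → 𝔘.HN} (h : IsDecreasing a) (n m : ℕ) :
    a (n + m) + 𝔘.std m ≤ a n := by
  induction m generalizing n with
  | zero => rw [add_std_zero]; rfl
  | succ m ih =>
    rw [← add_std_add_std, add_one_le_iff]
    have : n + (m + 1) = (n + 1) + m := by omega
    rw [this]
    exact (ih (n + 1)).trans_lt (h _ _ (by omega))

theorem IsIncreasing.monotone {a : ℕ → 𝔘.HN} (h : IsIncreasing a) : Monotone a :=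
  monotone_nat_of_le_succ fun n => (h n (n + 1) (by omega)).le

theorem IsDecreasing.antitone {a : ℕ → 𝔘.HN} (h : IsDecreasing a) : Antitone a :=
  antitone_nat_of_succ_le fun n => (h n (n + 1) (by omega)).le

/-! ### Internal sets -/

/-- The internal set coded by `a`. -/
def ext (a : 𝔘.Star (Set X)) : Set (𝔘.Star X) := {ξ | 𝔘.rel (fun x s => x ∈ s) ξ a}

theorem isInternal_ext (a : 𝔘.Star (Set X)) : 𝔘.IsInternal (ext a) := ⟨a, rfl⟩

@[simp] theorem map_mem_ext (f : Ω → X) (s : Ω → Set X) (ω : 𝔘.Star Ω) :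
    𝔘.map f ω ∈ ext (𝔘.map s ω) ↔ ∀ᶠ w in (filt ω : Filter Ω), f w ∈ s w :=
  rel_map (fun (x : X) (t : Set X) => x ∈ t) f s ω

theorem isInternal_rel (r : X → Y → Prop) (η : 𝔘.Star Y) : 𝔘.IsInternal {ξ | 𝔘.rel r ξ η} := by
  refine ⟨𝔘.map (fun y => {x | r x y}) η, ?_⟩
  ext ξ
  obtain ⟨Ω, ω, f, g, rfl, rfl⟩ := rep₂ ξ η
  simp

theorem isInternal_univ : 𝔘.IsInternal (Set.univ : Set (𝔘.Star X)) := by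
  refine ⟨𝔘.std Set.univ, ?_⟩
  ext ξ
  rw [← rep₁ ξ, std_eq ξ]
  simp

theorem IsInternal.compl {A : Set (𝔘.Star X)} (h : 𝔘.IsInternal A) : 𝔘.IsInternal Aᶜ := by
  obtain ⟨a, rfl⟩ := h
  refine ⟨𝔘.map (fun s => sᶜ) a, ?_⟩
  ext ξ
  obtain ⟨Ω, ω, f, g, rfl, rfl⟩ := rep₂ ξ a
  simp

theorem isInternal_empty : 𝔘.IsInternal (∅ : Set (𝔘.Star X)) := by
  simpa using (isInternal_univ (𝔘 := 𝔘) (X := X)).compl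

theorem IsInternal.inter {A B : Set (𝔘.Star X)} (hA : 𝔘.IsInternal A) (hB : 𝔘.IsInternal B) :
    𝔘.IsInternal (A ∩ B) := by
  obtain ⟨a, rfl⟩ := hA
  obtain ⟨b, rfl⟩ := hB
  refine ⟨𝔘.map₂ (fun s t => s ∩ t) a b, ?_⟩
  ext ξ
  obtain ⟨Ω, ω, f, g, k, rfl, rfl, rfl⟩ := rep₃ ξ a b
  simp

theorem IsInternal.preimage {A : Set (𝔘.Star Y)} (hA : 𝔘.IsInternal A) (f : X → Y) :
    𝔘.IsInternal {ξ | 𝔘.map f ξ ∈ A} := by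
  obtain ⟨a, rfl⟩ := hA
  refine ⟨𝔘.map (fun s => f ⁻¹' s) a, ?_⟩
  ext ξ
  obtain ⟨Ω, ω, g, k, rfl, rfl⟩ := rep₂ ξ a
  simp

theorem isInternal_hdist_lt (p q : X → ℕ) (c : 𝔘.HN) :
    𝔘.IsInternal {ξ : 𝔘.Star X | hdist (𝔘.map p ξ) (𝔘.map q ξ) < c} := by
  convert isInternal_rel (fun x n => Nat.dist (p x) (q x) < n) c using 1
  ext ξ
  obtain ⟨Ω, ω, f, g, rfl, rfl⟩ := rep₂ ξ c
  simp

theorem isInternal_biInter {ι : Type*} (s : Finset ι) {A : ι → Set (𝔘.Star X)}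
    (h : ∀ n ∈ s, 𝔘.IsInternal (A n)) : 𝔘.IsInternal (⋂ n ∈ s, A n) := by
  classical
  induction s using Finset.induction_on with
  | empty => simpa using isInternal_univ
  | insert i s hi ih =>
    rw [Finset.set_biInter_insert]
    exact (h i (by simp)).inter (ih fun n hn => h n (by simp [hn]))

/-! ### Saturation -/

theorem CountablySaturated.exists_forall (hsat : 𝔘.CountablySaturated) (A : ℕ → Set (𝔘.Star X))
    (hA : ∀ n, 𝔘.IsInternal (A n)) (h : ∀ N, ∃ ξ, ∀ n ≤ N, ξ ∈ A n) : ∃ ξ, ∀ n, ξ ∈ A n := by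
  obtain ⟨ξ, hξ⟩ := hsat X A hA (fun s => by
    obtain ⟨ξ, hξ⟩ := h (s.sup id)
    exact ⟨ξ, Set.mem_iInter₂.2 fun n hn => hξ n (Finset.le_sup (f := id) hn)⟩)
  exact ⟨ξ, fun n => Set.mem_iInter.1 hξ n⟩

/-- Countably many elements are coded by a single one. -/
theorem CountablySaturated.exists_seq (hsat : 𝔘.CountablySaturated) (ξ : ℕ → 𝔘.Star X) :
    ∃ ω : 𝔘.Star (ℕ → X), ∀ n, 𝔘.map (fun s => s n) ω = ξ n := by
  refine hsat.exists_forall (fun n => {ω | 𝔘.map (fun s : ℕ → X => s n) ω = ξ n}) (fun n => ?_)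
    fun N => ?_
  · convert isInternal_rel (fun (s : ℕ → X) x => s n = x) (ξ n) using 1
    ext ω
    generalize ξ n = η
    obtain ⟨Ω, ω', f, g, rfl, rfl⟩ := rep₂ ω η
    simp
  · induction N with
    | zero =>
      refine ⟨𝔘.map (fun x _ => x) (ξ 0), fun n hn => ?_⟩
      obtain rfl : n = 0 := by omega
      simpa using rep₁ (ξ 0)
    | succ N ih =>
      obtain ⟨ω, hω⟩ := ih
      -- Finitely many coordinates can be prescribed one after another, because an update at `N + 1`
      -- leaves the earlier ones alone.
      refine ⟨𝔘.map₂ (fun s x => Function.update s (N + 1) x) ω (ξ (N + 1)), fun n hn => ?_⟩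
      rcases eq_or_ne n (N + 1) with rfl | hne
      · generalize ξ (N + 1) = η
        clear hω
        obtain ⟨Ω, ω', f, g, rfl, rfl⟩ := rep₂ ω η
        simp
      · refine Eq.trans ?_ (hω n (by omega))
        clear hω
        generalize ξ (N + 1) = η
        obtain ⟨Ω, ω', f, g, rfl, rfl⟩ := rep₂ ω η
        simp [hne]

/-- Saturation over a coded parameter. -/
theorem CountablySaturated.exists_ext (hsat : 𝔘.CountablySaturated) {ω : 𝔘.Star Ω}
    (P : ℕ → Ω → X → Prop)
    (h : ∀ N, ∀ᶠ w in (filt ω : Filter Ω), ∃ x, ∀ n ≤ N, P n w x) :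
    ∃ ω' : 𝔘.Star (Ω × X), 𝔘.map Prod.fst ω' = ω ∧
      ∀ n, ∀ᶠ p in (filt ω' : Filter (Ω × X)), P n p.1 p.2 := by
  obtain ⟨ξ, hξ⟩ := hsat.exists_forall
    (fun n => {ξ : 𝔘.Star X | 𝔘.rel (fun x w => P n w x) ξ ω}) (fun n => isInternal_rel _ _)
    (fun N => by
      obtain ⟨ω', rfl, h'⟩ := eventually_exists_iff.1 (h N)
      refine ⟨𝔘.map Prod.snd ω', fun n hn => ?_⟩
      simp only [Set.mem_ofPred_eq, rel_map]
      exact h'.mono fun p hp => hp n hn)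
  refine ⟨𝔘.pair ω ξ, by simp, fun n => ?_⟩
  have := hξ n
  clear hξ h
  obtain ⟨Ω', ω', f, g, rfl, rfl⟩ := rep₂ ξ ω
  simpa using this

theorem CountablySaturated.exists_gt (hsat : 𝔘.CountablySaturated) (a : ℕ → 𝔘.HN) :
    ∃ c : 𝔘.HN, ∀ n, a n < c := by
  obtain ⟨ω, hω⟩ := hsat.exists_seq a
  obtain ⟨ω', rfl, h⟩ := hsat.exists_ext (ω := ω) (fun n s c => s n < c) (fun N =>
    Eventually.of_forall fun s => ⟨(∑ i ∈ Finset.range (N + 1), s i) + 1, fun n hn =>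
      Nat.lt_succ_of_le (Finset.single_le_sum (fun _ _ => Nat.zero_le _)
        (Finset.mem_range.2 (Nat.lt_succ_of_le hn)))⟩)
  refine ⟨𝔘.map Prod.snd ω', fun n => ?_⟩
  rw [← hω n]
  simpa using h n

open scoped MeasureTheory

/-! ### Borel and countably determined sets -/

/-- A set is countably determined iff membership in it depends only on membership in countably
many internal sets. -/
theorem isCD_iff {A : Set (𝔘.Star X)} : 𝔘.IsCD A ↔
    ∃ C : ℕ → Set (𝔘.Star X), (∀ m, 𝔘.IsInternal (C m)) ∧
      ∀ ξ η, (∀ m, ξ ∈ C m ↔ η ∈ C m) → ξ ∈ A → η ∈ A := by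
  constructor
  · rintro ⟨C, B, hC, rfl⟩
    refine ⟨C, hC, fun ξ η h hξ => ?_⟩
    simp only [Set.mem_iUnion, Set.mem_inter_iff, Set.mem_iInter, Set.mem_sdiff, exists_prop,
      Set.mem_compl_iff] at hξ ⊢
    simpa only [h] using hξ
  · rintro ⟨C, hC, h⟩
    -- Prepending the whole space makes the union of the sequence the whole space, so the relative
    -- complements in the definition become absolute ones.
    let C' : ℕ → Set (𝔘.Star X) := fun n => if n = 0 then Set.univ else C (n - 1)
    refine ⟨C', {b | ∃ ξ ∈ A, ∀ m, m ∈ b ↔ ξ ∈ C' m}, fun m => ?_, ?_⟩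
    · simp only [C']
      split_ifs
      · exact isInternal_univ
      · exact hC _
    · ext η
      simp only [Set.mem_iUnion, Set.mem_inter_iff, Set.mem_iInter, Set.mem_sdiff, exists_prop,
        Set.mem_compl_iff, Set.mem_ofPred_eq]
      constructor
      · intro hη
        exact ⟨{m : ℕ | η ∈ C' m}, ⟨η, hη, fun m => Iff.rfl⟩,
          fun m hm => hm, fun m hm => ⟨⟨0, by simp [C']⟩, hm⟩⟩
      · rintro ⟨b, ⟨ξ, hξ, hb⟩, h1, h2⟩
        refine h ξ η (fun m => ?_) hξ
        have := hb (m + 1)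
        simp only [C', Nat.add_eq_zero_iff, one_ne_zero, and_false, if_false,
          Nat.add_sub_cancel] at this h1 h2
        rw [← this]
        exact ⟨fun hm => by simpa using h1 _ hm,
          fun hm => by_contra fun hn => (h2 _ hn).2 (by simpa using hm)⟩

theorem IsInternal.isCD {A : Set (𝔘.Star X)} (h : 𝔘.IsInternal A) : 𝔘.IsCD A :=
  isCD_iff.2 ⟨fun _ => A, fun _ => h, fun _ _ h' hξ => (h' 0).1 hξ⟩

variable (𝔘 X) in
/-- The σ-algebra of countably determined sets. -/
@[reducible] def cdSpace : MeasurableSpace (𝔘.Star X) where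
  MeasurableSet' := 𝔘.IsCD
  measurableSet_empty := isInternal_empty.isCD
  measurableSet_compl A hA := by
    obtain ⟨C, hC, h⟩ := isCD_iff.1 hA
    exact isCD_iff.2 ⟨C, hC, fun ξ η hm hξ hη => hξ (h η ξ (fun m => (hm m).symm) hη)⟩
  measurableSet_iUnion A hA := by
    choose C hC h using fun n => isCD_iff.1 (hA n)
    refine isCD_iff.2 ⟨fun k => C k.unpair.1 k.unpair.2, fun k => hC _ _, fun ξ η hm hξ => ?_⟩
    obtain ⟨n, hn⟩ := Set.mem_iUnion.1 hξ
    refine Set.mem_iUnion.2 ⟨n, h n ξ η (fun m => ?_) hn⟩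
    simpa using hm (Nat.pair n m)

variable (𝔘 X) in
/-- The σ-algebra of Borel sets. -/
@[reducible] def borelSpace : MeasurableSpace (𝔘.Star X) :=
  MeasurableSpace.generateFrom {C : Set (𝔘.Star X) | 𝔘.IsInternal C}

theorem IsInternal.isBorel {A : Set (𝔘.Star X)} (h : 𝔘.IsInternal A) : 𝔘.IsBorel A :=
  MeasurableSpace.measurableSet_generateFrom h

theorem IsBorel.isCD {A : Set (𝔘.Star X)} (h : 𝔘.IsBorel A) : 𝔘.IsCD A :=
  MeasurableSpace.generateFrom_le (m := cdSpace 𝔘 X) (fun _ hC => IsInternal.isCD hC) A h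

theorem BorelRed.cdRed {E F : 𝔘.HN → 𝔘.HN → Prop} (h : BorelRed E F) : CDRed E F := by
  obtain ⟨ϑ, h1, h2⟩ := h
  exact ⟨ϑ, h1.isCD, h2⟩

theorem IsBorel.preimage {A : Set (𝔘.Star Y)} (hA : 𝔘.IsBorel A) (f : X → Y) :
    𝔘.IsBorel {ξ | 𝔘.map f ξ ∈ A} :=
  @measurable_generateFrom _ _ (borelSpace 𝔘 X) _ (𝔘.map f)
    (fun _ hC => IsInternal.isBorel (IsInternal.preimage hC f)) A hA

theorem IsCD.preimage {A : Set (𝔘.Star Y)} (hA : 𝔘.IsCD A) (f : X → Y) :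
    𝔘.IsCD {ξ | 𝔘.map f ξ ∈ A} := by
  obtain ⟨C, hC, h⟩ := isCD_iff.1 hA
  exact isCD_iff.2 ⟨fun m => {ξ | 𝔘.map f ξ ∈ C m}, fun m => (hC m).preimage f,
    fun ξ η hm hξ => h _ _ hm hξ⟩

/-- The internal function coded by `t`. -/
noncomputable def app (t : 𝔘.Star (X → Y)) (x : 𝔘.Star X) : 𝔘.Star Y :=
  𝔘.map₂ (fun f x => f x) t x

@[simp] theorem app_map (t : Ω → X → Y) (f : Ω → X) (ω : 𝔘.Star Ω) :
    app (𝔘.map t ω) (𝔘.map f ω) = 𝔘.map (fun w => t w (f w)) ω := map₂_map _ t f ω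

theorem isInternal_graph_app (t : 𝔘.Star (X → Y)) : 𝔘.IsInternal (𝔘.graph (app t)) := by
  convert isInternal_rel (fun (p : X × Y) (f : X → Y) => f p.1 = p.2) t using 1
  ext ζ
  obtain ⟨Ω, ω, f, g, rfl, rfl⟩ := rep₂ ζ t
  simp [graph]

/-- The graph of a map that coincides on countably many measurable sets with internal maps. -/
theorem measurableSet_graph {m : MeasurableSpace (𝔘.Star (X × Y))}
    (hm : ∀ C, 𝔘.IsInternal C → MeasurableSet[m] C) {B : ℕ → Set (𝔘.Star X)}
    (hB : ∀ i, MeasurableSet[m] {ζ : 𝔘.Star (X × Y) | 𝔘.map Prod.fst ζ ∈ B i})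
    (t : ℕ → 𝔘.Star (X → Y)) {ϑ : 𝔘.Star X → 𝔘.Star Y}
    (hϑ : ∀ i, ∀ x ∈ B i, ϑ x = app (t i) x) (hc : ∀ x, ∃ i, x ∈ B i) :
    MeasurableSet[m] (𝔘.graph ϑ) := by
  have : 𝔘.graph ϑ =
      ⋃ i, {ζ : 𝔘.Star (X × Y) | 𝔘.map Prod.fst ζ ∈ B i} ∩ 𝔘.graph (app (t i)) := by
    ext ζ
    simp only [graph, Set.mem_iUnion, Set.mem_inter_iff, Set.mem_ofPred_eq]
    constructor
    · intro h
      obtain ⟨i, hi⟩ := hc (𝔘.map Prod.fst ζ)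
      exact ⟨i, hi, (hϑ i _ hi) ▸ h⟩
    · rintro ⟨i, hi, h⟩
      rw [hϑ i _ hi, h]
  rw [this]
  exact MeasurableSet.iUnion fun i => (hB i).inter (hm _ (isInternal_graph_app (t i)))

theorem isBorel_graph_app (t : 𝔘.Star (X → Y)) : 𝔘.IsBorel (𝔘.graph (app t)) :=
  (isInternal_graph_app t).isBorel

/-- A countably determined set is covered by countably many internal sets with a property `P`, if
`P` holds for a member of each decreasing sequence of internal sets with intersection included in
the given set. -/
theorem IsCD.exists_cover {Γ : Set (𝔘.Star X)} (hΓ : 𝔘.IsCD Γ) (P : Set (𝔘.Star X) → Prop)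
    (hP : ∀ G : ℕ → Set (𝔘.Star X), (∀ n, 𝔘.IsInternal (G n)) → Antitone G →
      (⋂ n, G n) ⊆ Γ → ∃ n, P (G n)) :
    ∃ G : ℕ → Set (𝔘.Star X), (∀ i, 𝔘.IsInternal (G i)) ∧ (∀ i, P (G i)) ∧
      ∀ ζ ∈ Γ, ∃ i, ζ ∈ G i := by
  classical
  obtain ⟨C, hC, h⟩ := isCD_iff.1 hΓ
  -- The constituent that prescribes membership in the first `t.2` generators. There are only
  -- countably many constituents, whereas there may be uncountably many atoms.
  let D : Finset ℕ × ℕ → Set (𝔘.Star X) := fun t =>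
    ⋂ m ∈ Finset.range t.2, if m ∈ t.1 then C m else (C m)ᶜ
  have hD : ∀ t, 𝔘.IsInternal (D t) := fun t => isInternal_biInter _ fun m _ => by
    split_ifs
    · exact hC m
    · exact (hC m).compl
  -- The constant sequence `∅` is admissible, so `∅` can stand in for the constituents that lack
  -- `P`.
  have hempty : P ∅ := by
    obtain ⟨n, hn⟩ := hP (fun _ => ∅) (fun _ => isInternal_empty) (fun _ _ _ => le_rfl)
      (fun ζ hζ => absurd (Set.mem_iInter.1 hζ 0) (Set.notMem_empty ζ))
    exact hn
  obtain ⟨e, he⟩ := exists_surjective_nat (Finset ℕ × ℕ)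
  refine ⟨fun i => if P (D (e i)) then D (e i) else ∅, fun i => ?_, fun i => ?_, fun ζ hζ => ?_⟩
  · dsimp only
    split_ifs
    · exact hD _
    · exact isInternal_empty
  · dsimp only
    split_ifs with hi
    · exact hi
    · exact hempty
  -- The constituents around `ζ` decrease to its atom, which lies in `Γ`; hence one of them has `P`.
  · let s : ℕ → Finset ℕ × ℕ := fun n => ((Finset.range n).filter (fun m => ζ ∈ C m), n)
    have hs : ∀ n η, η ∈ D (s n) ↔ ∀ m < n, (ζ ∈ C m ↔ η ∈ C m) := by
      intro n η
      simp only [D, s, Set.mem_iInter, Finset.mem_range, Finset.mem_filter]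
      refine forall₂_congr fun m hm => ?_
      by_cases hζm : ζ ∈ C m <;> simp [hm, hζm]
    obtain ⟨n, hn⟩ := hP (fun n => D (s n)) (fun n => hD _)
      (fun n k hnk η hη => (hs n η).2 fun m hm => (hs k η).1 hη m (by omega))
      (fun η hη => h ζ η (fun m => (hs (m + 1) η).1 (Set.mem_iInter.1 hη (m + 1)) m (by omega)) hζ)
    obtain ⟨i, hi⟩ := he (s n)
    refine ⟨i, ?_⟩
    dsimp only
    rw [hi, if_pos hn, hs]
    exact fun m _ => Iff.rfl

/-- A form of saturation for implications between distance conditions. -/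
theorem CountablySaturated.exists_dist_imp (hsat : 𝔘.CountablySaturated)
    {G : ℕ → Set (𝔘.Star X)} (hG : ∀ n, 𝔘.IsInternal (G n)) (hGa : Antitone G) (p q : X → ℕ)
    {c d : ℕ → 𝔘.HN} (hc : Antitone c) (hd : Monotone d)
    (h : ∀ ζ ζ' : 𝔘.Star X, (∀ n, ζ ∈ G n) → (∀ n, ζ' ∈ G n) →
      (∀ n, hdist (𝔘.map p ζ) (𝔘.map p ζ') < c n) → ∃ k, hdist (𝔘.map q ζ) (𝔘.map q ζ') < d k) :
    ∃ m, ∀ ζ ∈ G m, ∀ ζ' ∈ G m, hdist (𝔘.map p ζ) (𝔘.map p ζ') < c m →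
      hdist (𝔘.map q ζ) (𝔘.map q ζ') < d m := by
  -- A pair of points that refutes the conclusion at `N` satisfies the corresponding conditions for
  -- every `n ≤ N`, by monotonicity. Saturation then gives one pair for all `n`, contrary to `h`.
  by_contra! hn
  have hGint : ∀ n, 𝔘.IsInternal ((({ω : 𝔘.Star (X × X) | 𝔘.map Prod.fst ω ∈ G n} ∩
      {ω | 𝔘.map Prod.snd ω ∈ G n}) ∩
      {ω | hdist (𝔘.map (fun x : X × X => p x.1) ω) (𝔘.map (fun x => p x.2) ω) < c n}) ∩
      {ω | hdist (𝔘.map (fun x : X × X => q x.1) ω) (𝔘.map (fun x => q x.2) ω) < d n}ᶜ) :=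
    fun n => ((((hG n).preimage _).inter ((hG n).preimage _)).inter
      (isInternal_hdist_lt _ _ _)).inter (isInternal_hdist_lt _ _ _).compl
  obtain ⟨ω, hω⟩ := hsat.exists_forall _ hGint (fun N => by
    obtain ⟨ζ, hζ, ζ', hζ', h1, h2⟩ := hn N
    refine ⟨𝔘.pair ζ ζ', fun n hnN => ⟨⟨⟨?_, ?_⟩, ?_⟩, ?_⟩⟩
    · simpa using hGa hnN hζ
    · simpa using hGa hnN hζ'
    · have := h1.trans_le (hc hnN)
      simpa [𝔘.map_comp p] using this
    · have := (hd hnN).trans h2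
      simpa [𝔘.map_comp q] using this)
  obtain ⟨k, hk⟩ := h (𝔘.map Prod.fst ω) (𝔘.map Prod.snd ω) (fun n => (hω n).1.1.1)
    (fun n => (hω n).1.1.2) (fun n => by simpa using (hω n).1.2)
  have := (hω k).2
  simp only [hdist_map, map_map, Set.mem_compl_iff, Set.mem_ofPred_eq] at hk this
  exact this hk

end NonstandardUniverse

/-! ### Counting -/

open Classical in
/-- The number of elements of `s` below `2 ^ c`. -/
noncomputable def Nat.countBelow (c : ℕ) (s : Set ℕ) : ℕ :=
  ((Finset.range (2 ^ c)).filter (· ∈ s)).card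

theorem Nat.dist_lt_iff {x y n : ℕ} : Nat.dist x y < n ↔ x < y + n ∧ y < x + n := by
  simp only [Nat.dist]; omega

theorem Finset.card_le_of_forall_dist_lt {F : Finset ℕ} {n : ℕ}
    (h : ∀ x ∈ F, ∀ y ∈ F, Nat.dist x y < n) : F.card ≤ n := by
  rcases F.eq_empty_or_nonempty with rfl | hF
  · simp
  · have : F ⊆ Finset.Ico (F.min' hF) (F.min' hF + n) := by
      intro x hx
      have h1 := F.min'_le x hx
      have h2 := Nat.dist_lt_iff.1 (h x hx _ (F.min'_mem hF))
      simp only [Finset.mem_Ico]; omega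
    simpa using Finset.card_le_card this

/-- The interval consists of `2 ^ (c - P)` blocks of length `2 ^ P`. Points over one block have
`q`-values less than `2 ^ R` apart, hence in at most `2 ^ (R - S) + 1` blocks of length `2 ^ S`.
Points sharing such a block have `p`-values less than `2 ^ Q` apart, so there are at most `2 ^ Q` of
these values. The product is at most `2 ^ (c - m)`. -/
theorem Nat.countBelow_image_mul_le {X : Type*} {G : Set X} {p q : X → ℕ} {P R S Q m c : ℕ}
    (h1 : ∀ z ∈ G, ∀ z' ∈ G, Nat.dist (p z) (p z') < 2 ^ P → Nat.dist (q z) (q z') < 2 ^ R)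
    (h2 : ∀ z ∈ G, ∀ z' ∈ G, Nat.dist (q z) (q z') < 2 ^ S → Nat.dist (p z) (p z') < 2 ^ Q)
    (hSR : S ≤ R) (hPc : P ≤ c) (h : R + Q + m + 1 ≤ P + S) :
    Nat.countBelow c (p '' G) * 2 ^ m ≤ 2 ^ c := by
  classical
  rcases isEmpty_or_nonempty X with hX | hX
  · simp [Nat.countBelow, Set.eq_empty_of_isEmpty G]
  rw [Nat.countBelow]
  set T := (Finset.range (2 ^ c)).filter (· ∈ p '' G) with hT
  have hmem : ∀ x ∈ T, ∃ z ∈ G, p z = x := fun x hx => (Finset.mem_filter.1 hx).2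
  choose! z hzG hz using hmem
  have hdiv : ∀ k x y : ℕ, x / 2 ^ k = y / 2 ^ k → Nat.dist x y < 2 ^ k := by
    intro k x y hxy
    have e1 := Nat.div_add_mod x (2 ^ k)
    have e2 := Nat.div_add_mod y (2 ^ k)
    have l1 := Nat.mod_lt x (pow_pos two_pos k : 0 < 2 ^ k)
    have l2 := Nat.mod_lt y (pow_pos two_pos k : 0 < 2 ^ k)
    rw [hxy] at e1
    rw [Nat.dist_lt_iff]; omega
  have hfib : ∀ i ∈ T.image (· / 2 ^ P),
      (T.filter (fun x => x / 2 ^ P = i)).card ≤ 2 ^ Q * 2 ^ (R - S + 1) := by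
    intro i _
    set F := T.filter (fun x => x / 2 ^ P = i) with hF
    have hFT : ∀ x ∈ F, x ∈ T := fun x hx => (Finset.mem_filter.1 hx).1
    refine (Finset.card_le_mul_card_image (f := fun x => q (z x) / 2 ^ S) F (2 ^ Q) ?_).trans ?_
    · intro j _
      refine Finset.card_le_of_forall_dist_lt fun x hx y hy => ?_
      simp only [Finset.mem_filter] at hx hy
      have := h2 _ (hzG x (hFT x hx.1)) _ (hzG y (hFT y hy.1)) (hdiv _ _ _ (hx.2.trans hy.2.symm))
      rwa [hz x (hFT x hx.1), hz y (hFT y hy.1)] at this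
    · refine Nat.mul_le_mul_left _ ?_
      rcases F.eq_empty_or_nonempty with hF0 | hF0
      · rw [hF0]; simp
      · obtain ⟨x₀, hx₀, hmin⟩ := F.exists_min_image (fun x => q (z x)) hF0
        have hsub : F.image (fun x => q (z x) / 2 ^ S) ⊆
            Finset.Icc (q (z x₀) / 2 ^ S) (q (z x₀) / 2 ^ S + 2 ^ (R - S)) := by
          intro j hj
          obtain ⟨x, hx, rfl⟩ := Finset.mem_image.1 hj
          have hx' := Finset.mem_filter.1 hx
          have hx₀' := Finset.mem_filter.1 hx₀
          have := h1 _ (hzG x hx'.1) _ (hzG x₀ hx₀'.1) (by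
            rw [hz x hx'.1, hz x₀ hx₀'.1]
            exact hdiv _ _ _ (hx'.2.trans hx₀'.2.symm))
          rw [Nat.dist_lt_iff] at this
          rw [Finset.mem_Icc]
          refine ⟨Nat.div_le_div_right (hmin x hx), ?_⟩
          have h3 : q (z x) ≤ q (z x₀) + 2 ^ (R - S) * 2 ^ S := by
            rw [← pow_add, Nat.sub_add_cancel hSR]; omega
          calc q (z x) / 2 ^ S ≤ (q (z x₀) + 2 ^ (R - S) * 2 ^ S) / 2 ^ S :=
                Nat.div_le_div_right h3
            _ = _ := Nat.add_mul_div_right _ _ (by positivity)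
        refine (Finset.card_le_card hsub).trans ?_
        have : 1 ≤ 2 ^ (R - S) := Nat.one_le_two_pow
        rw [Nat.card_Icc, pow_succ]; omega
  have himg : (T.image (· / 2 ^ P)).card ≤ 2 ^ (c - P) := by
    have : T.image (· / 2 ^ P) ⊆ Finset.range (2 ^ (c - P)) := by
      intro j hj
      obtain ⟨x, hx, rfl⟩ := Finset.mem_image.1 hj
      have hx' := Finset.mem_range.1 (Finset.mem_filter.1 hx).1
      rw [Finset.mem_range, Nat.div_lt_iff_lt_mul (by positivity), ← pow_add,
        Nat.sub_add_cancel hPc]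
      exact hx'
    simpa using Finset.card_le_card this
  calc T.card * 2 ^ m ≤ (2 ^ Q * 2 ^ (R - S + 1) * 2 ^ (c - P)) * 2 ^ m :=
        Nat.mul_le_mul_right _ ((Finset.card_le_mul_card_image T _ hfib).trans
          (Nat.mul_le_mul_left _ himg))
    _ = 2 ^ (Q + (R - S + 1) + (c - P) + m) := by simp only [pow_add]
    _ ≤ 2 ^ c := Nat.pow_le_pow_right two_pos (by omega)

theorem Nat.exists_notMem_of_countBelow {c N : ℕ} {s : ℕ → Set ℕ}
    (h : ∀ i ≤ N, Nat.countBelow c (s i) * 2 ^ (i + 2) ≤ 2 ^ c) :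
    ∃ x < 2 ^ c, ∀ i ≤ N, x ∉ s i := by
  classical
  -- The densities `2 ^ -(i + 2)` for `i < n` add up to `1 / 2 - 2 ^ -(n + 1)`; denominators are
  -- cleared.
  have hsum : ∀ n ≤ N + 1, (∑ i ∈ Finset.range n, Nat.countBelow c (s i)) * 2 ^ (n + 1) + 2 ^ c ≤
      2 ^ c * 2 ^ n := by
    intro n hn
    induction n with
    | zero => simp
    | succ n ih =>
      have h1 := ih (by omega)
      have h2 := h n (by omega)
      rw [Finset.sum_range_succ]
      simp only [pow_succ] at *
      nlinarith
  by_contra! hcon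
  have hsub : Finset.range (2 ^ c) ⊆ (Finset.range (N + 1)).biUnion
      (fun i => (Finset.range (2 ^ c)).filter (· ∈ s i)) := by
    intro x hx
    obtain ⟨i, hi, hxi⟩ := hcon x (Finset.mem_range.1 hx)
    exact Finset.mem_biUnion.2 ⟨i, Finset.mem_range.2 (by omega), Finset.mem_filter.2 ⟨hx, hxi⟩⟩
  have h1 := (Finset.card_le_card hsub).trans Finset.card_biUnion_le
  rw [Finset.card_range] at h1
  have h2 := hsum (N + 1) le_rfl
  have h3 : (2 : ℕ) ^ c ≤ ∑ i ∈ Finset.range (N + 1), Nat.countBelow c (s i) := h1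
  have h4 := Nat.mul_le_mul_right (2 ^ (N + 1 + 1)) h3
  have h5 : 0 < 2 ^ c * 2 ^ (N + 1) := by positivity
  have h6 : 2 ^ c * 2 ^ (N + 1 + 1) = 2 * (2 ^ c * 2 ^ (N + 1)) := by ring
  have h7 : 0 < 2 ^ c := by positivity
  omega

/-! ### Counting in hyperfinite intervals -/

namespace NonstandardUniverse

open Filter

variable {𝔘 : NonstandardUniverse.{u}} {X Y Z Ω : Type}

/-- The number of elements below `2 ^ c` of the internal set coded by `a`. -/
noncomputable def hcount (c : 𝔘.HN) (a : 𝔘.Star (Set ℕ)) : 𝔘.HN := 𝔘.map₂ Nat.countBelow c a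

@[simp] theorem hcount_map (c : Ω → ℕ) (a : Ω → Set ℕ) (ω : 𝔘.Star Ω) :
    hcount (𝔘.map c ω) (𝔘.map a ω) = 𝔘.map (fun w => Nat.countBelow (c w) (a w)) ω :=
  map₂_map _ _ _ _

theorem eventually_dist_imp {ω : 𝔘.Star Ω} {g : Ω → Set X} {A B : Ω → ℕ} {p q : X → ℕ}
    (h : ∀ ζ ∈ ext (𝔘.map g ω), ∀ ζ' ∈ ext (𝔘.map g ω),
      hdist (𝔘.map p ζ) (𝔘.map p ζ') < 𝔘.map A ω → hdist (𝔘.map q ζ) (𝔘.map q ζ') < 𝔘.map B ω) :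
    ∀ᶠ w in (filt ω : Filter Ω), ∀ z ∈ g w, ∀ z' ∈ g w,
      Nat.dist (p z) (p z') < A w → Nat.dist (q z) (q z') < B w := by
  -- Quantifying over pairs transfers both universal quantifiers at once; a counterexample at the
  -- level of `ω` would be a pair of points of the internal set refuting `h`.
  have key : ∀ᶠ w in (filt ω : Filter Ω), ∀ z : X × X, z.1 ∈ g w → z.2 ∈ g w →
      Nat.dist (p z.1) (p z.2) < A w → Nat.dist (q z.1) (q z.2) < B w := by
    rw [eventually_forall_iff]
    rintro ω' rfl
    by_contra hn
    rw [← eventually_filt_not] at hn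
    have := h (𝔘.map (fun w => w.2.1) ω') (by
        simp only [map_map, map_mem_ext]
        filter_upwards [hn] with w hw
        tauto) (𝔘.map (fun w => w.2.2) ω') (by
        simp only [map_map, map_mem_ext]
        filter_upwards [hn] with w hw
        tauto) (by
        simp only [map_map, hdist_map, map_lt_map]
        filter_upwards [hn] with w hw
        tauto)
    simp only [map_map, hdist_map, map_lt_map] at this
    obtain ⟨w, h1, h2⟩ := (hn.and this).exists
    tauto
  exact key.mono fun w hw z hz z' hz' => hw (z, z') hz hz'

theorem hcount_image_mul_le {g : 𝔘.Star (Set X)} {p q : X → ℕ} {P R S Q c : 𝔘.HN} {m : ℕ}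
    (h1 : ∀ ζ ∈ ext g, ∀ ζ' ∈ ext g, hdist (𝔘.map p ζ) (𝔘.map p ζ') < twoPow P →
      hdist (𝔘.map q ζ) (𝔘.map q ζ') < twoPow R)
    (h2 : ∀ ζ ∈ ext g, ∀ ζ' ∈ ext g, hdist (𝔘.map q ζ) (𝔘.map q ζ') < twoPow S →
      hdist (𝔘.map p ζ) (𝔘.map p ζ') < twoPow Q)
    (hSR : S ≤ R) (hPc : P ≤ c) (h : R + Q + 𝔘.std (m + 1) ≤ P + S) :
    hcount c (𝔘.map (fun s => p '' s) g) * 𝔘.std (2 ^ m) ≤ twoPow c := by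
  obtain ⟨Ω, ω, g, P, R, S, Q, c, rfl, rfl, rfl, rfl, rfl, rfl⟩ := rep₆ g P R S Q c
  simp only [twoPow_map] at h1 h2
  have h1' := eventually_dist_imp h1
  have h2' := eventually_dist_imp h2
  simp only [std_eq ω, map_add_map, map_le_map, map_map, hcount_map, map_mul_map,
    twoPow_map] at *
  filter_upwards [h1', h2', hSR, hPc, h] with w h1 h2 h3 h4 h5
  exact Nat.countBelow_image_mul_le h1 h2 h3 h4 h5

/-- Countably many internal sets of small density do not cover an interval. -/
theorem CountablySaturated.exists_notMem (hsat : 𝔘.CountablySaturated) {c : 𝔘.HN}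
    {a : ℕ → 𝔘.Star (Set ℕ)} (h : ∀ i, hcount c (a i) * 𝔘.std (2 ^ (i + 2)) ≤ twoPow c) :
    ∃ x : 𝔘.HN, x < twoPow c ∧ ∀ i, x ∉ ext (a i) := by
  obtain ⟨α, hα⟩ := hsat.exists_seq a
  obtain ⟨Ω, ω, f, c, rfl, rfl⟩ := rep₂ α c
  simp only [map_map] at hα
  simp only [← hα, std_eq ω, hcount_map, map_mul_map, twoPow_map, map_le_map] at h
  obtain ⟨ω', rfl, h'⟩ := hsat.exists_ext (ω := ω) (X := ℕ)
    (fun n w x => x < 2 ^ c w ∧ x ∉ f w n) (fun N => by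
      have : ∀ᶠ w in (filt ω : Filter Ω), ∀ i ∈ Finset.range (N + 1),
          Nat.countBelow (c w) (f w i) * 2 ^ (i + 2) ≤ 2 ^ (c w) :=
        (Filter.eventually_all_finset _).2 fun i _ => h i
      filter_upwards [this] with w hw
      obtain ⟨x, hx, hx'⟩ := Nat.exists_notMem_of_countBelow (N := N)
        (fun i hi => hw i (Finset.mem_range.2 (by omega)))
      exact ⟨x, fun n hn => ⟨hx, hx' n hn⟩⟩)
  refine ⟨𝔘.map Prod.snd ω', ?_, fun i hi => ?_⟩
  · simp only [map_map, twoPow_map, map_lt_map]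
    exact (h' 0).mono fun w hw => hw.1
  · rw [← hα i] at hi
    simp only [map_map, map_mem_ext] at hi
    obtain ⟨w, h1, h2⟩ := (hi.and (h' i)).exists
    exact h2.2 h1

/-! ### Necessary conditions for countably determined reducibility -/

theorem hdist_comm (x y : 𝔘.HN) : hdist x y = hdist y x := by
  obtain ⟨Ω, ω, f, g, rfl, rfl⟩ := rep₂ x y
  simp [Nat.dist_comm]

theorem pair_mem_graph (ϑ : 𝔘.Star X → 𝔘.Star Y) (x : 𝔘.Star X) :
    𝔘.pair x (ϑ x) ∈ 𝔘.graph ϑ := by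
  simp [graph]

theorem IsInternal.exists_ext {A : Set (𝔘.Star X)} (h : 𝔘.IsInternal A) : ∃ a, A = ext a := h

theorem map_mem_ext_image {ζ : 𝔘.Star X} {g : 𝔘.Star (Set X)} (h : ζ ∈ ext g) (p : X → Y) :
    𝔘.map p ζ ∈ ext (𝔘.map (fun s => p '' s) g) := by
  obtain ⟨Ω, ω, f, g, rfl, rfl⟩ := rep₂ ζ g
  simp only [map_map, map_mem_ext] at *
  exact h.mono fun w hw => Set.mem_image_of_mem _ hw

/-- The projection of `G` has infinitesimal density in `[0, 2 ^ c)`. -/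
def SmallProj (c : 𝔘.HN) (G : Set (𝔘.Star (ℕ × ℕ))) : Prop :=
  ∃ g, G = ext g ∧
    ∀ m, hcount c (𝔘.map (fun s => Prod.fst '' s) g) * 𝔘.std (2 ^ m) ≤ twoPow c

/-- The common end of the counting arguments: otherwise countably many internal sets with
projections of infinitesimal density would cover the graph of a map that is defined everywhere. -/
theorem CountablySaturated.not_forall_smallProj (hsat : 𝔘.CountablySaturated)
    {ϑ : 𝔘.HN → 𝔘.HN} (hϑ : 𝔘.IsCD (𝔘.graph ϑ)) (c : 𝔘.HN) :
    ¬ ∀ G : ℕ → Set (𝔘.Star (ℕ × ℕ)), (∀ n, 𝔘.IsInternal (G n)) → Antitone G →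
      (⋂ n, G n) ⊆ 𝔘.graph ϑ → ∃ n, SmallProj c (G n) := by
  intro h
  obtain ⟨G, -, hG, hcov⟩ := hϑ.exists_cover _ h
  choose g hg hs using hG
  -- Infinitesimal density allows the `i`-th set any standard bound, in particular the summable `2 ^
  -- -(i + 2)`.
  obtain ⟨x, -, hx⟩ := hsat.exists_notMem (fun i => hs i (i + 2))
  obtain ⟨i, hi⟩ := hcov _ (pair_mem_graph ϑ x)
  rw [hg i] at hi
  have := map_mem_ext_image hi Prod.fst
  rw [map_fst_pair] at this
  exact hx i this

/-- Converts a failure of the growth inequality into the exponent inequality needed for counting;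
the step from `r` to `r'` pays for the factor `2 ^ e`. -/
theorem add_le_of_not_sub_le {p q r r' s : 𝔘.HN} {e : ℕ} (h : ¬ p - q ≤ r' - s)
    (hr : r + 𝔘.std e ≤ r') (hs : s ≤ r) : r + q + 𝔘.std e ≤ p + s := by
  obtain ⟨Ω, ω, p, q, r, r', s, -, rfl, rfl, rfl, rfl, rfl, -⟩ := rep₆ p q r r' s p
  rw [map_sub_map, map_sub_map, map_le_map, ← eventually_filt_not] at h
  simp only [std_eq ω, map_add_map, map_le_map] at *
  filter_upwards [h, hr, hs] with w h1 h2 h3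
  omega

theorem add_le_of_not_sub_le' {p q r s s' : 𝔘.HN} {e : ℕ} (h : ¬ p - q ≤ r - s')
    (hr : s' + 𝔘.std e ≤ s) (hs : s ≤ r) : r + q + 𝔘.std e ≤ p + s := by
  obtain ⟨Ω, ω, p, q, r, s', s, -, rfl, rfl, rfl, rfl, rfl, -⟩ := rep₆ p q r s' s p
  rw [map_sub_map, map_sub_map, map_le_map, ← eventually_filt_not] at h
  simp only [std_eq ω, map_add_map, map_le_map] at *
  filter_upwards [h, hr, hs] with w h1 h2 h3
  omega

theorem mem_graph_iff {ϑ : 𝔘.Star X → 𝔘.Star Y} {ζ : 𝔘.Star (X × Y)} :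
    ζ ∈ 𝔘.graph ϑ ↔ ϑ (𝔘.map Prod.fst ζ) = 𝔘.map Prod.snd ζ := Iff.rfl

/-- The order of choices matters. A bad `k` comes first. Pulling back the scale `b k` yields `m₁`;
badness at `m₁` yields `n'`; pushing forward the scale `a n'` yields `m₂`. The count then compares
`a n' - a m₁` with the smaller growth of `b` beyond `k`. -/
theorem CountablySaturated.cofinal_growth (hsat : 𝔘.CountablySaturated) {a b : ℕ → 𝔘.HN}
    (ha : IsIncreasing a) (hb : IsIncreasing b) {ϑ : 𝔘.HN → 𝔘.HN} (hϑ : 𝔘.IsCD (𝔘.graph ϑ))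
    (h : ∀ x x', (∃ n, hdist x x' < twoPow (a n)) ↔ ∃ k, hdist (ϑ x) (ϑ x') < twoPow (b k)) :
    ∀ k, ∃ n, ∀ n' > n, ∃ k' > k, a n' - a n ≤ b k' - b k := by
  by_contra! hn
  obtain ⟨k, hk⟩ := hn
  obtain ⟨c, hc⟩ := hsat.exists_gt a
  refine hsat.not_forall_smallProj hϑ c fun G hG hGa hGϑ => ?_
  have hmem : ∀ ζ, (∀ n, ζ ∈ G n) → ϑ (𝔘.map Prod.fst ζ) = 𝔘.map Prod.snd ζ :=
    fun ζ hζ => hGϑ (Set.mem_iInter.2 hζ)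
  obtain ⟨m₁, h1⟩ := hsat.exists_dist_imp hG hGa Prod.snd Prod.fst (c := fun _ => twoPow (b k))
    (d := fun n => twoPow (a n)) (fun _ _ _ => le_rfl)
    (fun m n hmn => twoPow_le_twoPow.2 (ha.monotone hmn))
    (fun ζ ζ' hζ hζ' hd => (h _ _).2 ⟨k, by rw [hmem ζ hζ, hmem ζ' hζ']; exact hd 0⟩)
  obtain ⟨n', hn', hk'⟩ := hk m₁
  obtain ⟨m₂, h2⟩ := hsat.exists_dist_imp hG hGa Prod.fst Prod.snd
    (c := fun _ => twoPow (a n')) (d := fun n => twoPow (b n)) (fun _ _ _ => le_rfl)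
    (fun m n hmn => twoPow_le_twoPow.2 (hb.monotone hmn))
    (fun ζ ζ' hζ hζ' hd => by
      rw [← hmem ζ hζ, ← hmem ζ' hζ']
      exact (h _ _).1 ⟨n', hd 0⟩)
  obtain ⟨g, hg⟩ := (hG (max m₁ m₂)).exists_ext
  refine ⟨max m₁ m₂, g, hg, fun m => ?_⟩
  refine hcount_image_mul_le (P := a n') (R := b (max m₂ k)) (S := b k) (Q := a m₁) (q := Prod.snd)
    (fun ζ hζ ζ' hζ' hd => ?_) (fun ζ hζ ζ' hζ' hd => ?_) (hb.monotone (le_max_right _ _))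
    (hc n').le ?_
  · rw [← hg] at hζ hζ'
    exact (h2 ζ (hGa (le_max_right _ _) hζ) ζ' (hGa (le_max_right _ _) hζ') hd).trans_le
      (twoPow_le_twoPow.2 (hb.monotone (le_max_left _ _)))
  · rw [← hg] at hζ hζ'
    exact h1 ζ (hGa (le_max_left _ _) hζ) ζ' (hGa (le_max_left _ _) hζ') hd
  -- The index of `b` is taken `m + 1` beyond the one that bounds the images, which gains the factor
  -- `2 ^ (m + 1)`; `m` is arbitrary, so the density is infinitesimal.
  · exact add_le_of_not_sub_le (not_le.2 (hk' (max m₂ k + (m + 1)) (by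
      have := le_max_right m₂ k; omega))) (hb.add_le _ _) (hb.monotone (le_max_right _ _))

/-- The mirror image of `cofinal_growth`: the scale `b k` is now the coarse one in the target, so
the forward direction is made uniform first and the backward one second. -/
theorem CountablySaturated.coinitial_growth (hsat : 𝔘.CountablySaturated) {a b : ℕ → 𝔘.HN}
    (ha : IsDecreasing a) (hb : IsDecreasing b) {ϑ : 𝔘.HN → 𝔘.HN} (hϑ : 𝔘.IsCD (𝔘.graph ϑ))
    (h : ∀ x x', (∀ n, hdist x x' < twoPow (a n)) ↔ ∀ k, hdist (ϑ x) (ϑ x') < twoPow (b k)) :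
    ∀ k, ∃ n, ∀ n' > n, ∃ k' > k, a n - a n' ≤ b k - b k' := by
  by_contra! hn
  obtain ⟨k, hk⟩ := hn
  refine hsat.not_forall_smallProj hϑ (a 0) fun G hG hGa hGϑ => ?_
  have hmem : ∀ ζ, (∀ n, ζ ∈ G n) → ϑ (𝔘.map Prod.fst ζ) = 𝔘.map Prod.snd ζ :=
    fun ζ hζ => hGϑ (Set.mem_iInter.2 hζ)
  obtain ⟨m₁, h1⟩ := hsat.exists_dist_imp hG hGa Prod.fst Prod.snd (c := fun n => twoPow (a n))
    (d := fun _ => twoPow (b k)) (fun m n hmn => twoPow_le_twoPow.2 (ha.antitone hmn))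
    (fun _ _ _ => le_rfl)
    (fun ζ ζ' hζ hζ' hd => by
      rw [← hmem ζ hζ, ← hmem ζ' hζ']
      exact ⟨0, (h _ _).1 hd k⟩)
  obtain ⟨n', hn', hk'⟩ := hk m₁
  obtain ⟨m₂, h2⟩ := hsat.exists_dist_imp hG hGa Prod.snd Prod.fst
    (c := fun n => twoPow (b n)) (d := fun _ => twoPow (a n'))
    (fun m n hmn => twoPow_le_twoPow.2 (hb.antitone hmn)) (fun _ _ _ => le_rfl)
    (fun ζ ζ' hζ hζ' hd => by
      rw [← hmem ζ hζ, ← hmem ζ' hζ'] at hd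
      exact ⟨0, (h _ _).2 hd n'⟩)
  obtain ⟨g, hg⟩ := (hG (max m₁ m₂)).exists_ext
  refine ⟨max m₁ m₂, g, hg, fun m => ?_⟩
  refine hcount_image_mul_le (P := a m₁) (R := b k) (S := b (max m₂ k)) (Q := a n') (q := Prod.snd)
    (fun ζ hζ ζ' hζ' hd => ?_) (fun ζ hζ ζ' hζ' hd => ?_) (hb.antitone (le_max_right _ _))
    (ha.antitone (Nat.zero_le _)) ?_
  · rw [← hg] at hζ hζ'
    exact h1 ζ (hGa (le_max_left _ _) hζ) ζ' (hGa (le_max_left _ _) hζ') hd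
  · rw [← hg] at hζ hζ'
    exact h2 ζ (hGa (le_max_right _ _) hζ) ζ' (hGa (le_max_right _ _) hζ')
      (hd.trans_le (twoPow_le_twoPow.2 (hb.antitone (le_max_left _ _))))
  · exact add_le_of_not_sub_le' (not_le.2 (hk' (max m₂ k + (m + 1)) (by
      have := le_max_right m₂ k; omega))) (hb.add_le _ _) (hb.antitone (le_max_right _ _))

/-- A countably cofinal relation with infinite growth steps is not reducible to an intersection of
internal distance conditions. -/
theorem CountablySaturated.not_cd_of_infinite_gaps (hsat : 𝔘.CountablySaturated) {a c : ℕ → 𝔘.HN}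
    (ha : IsIncreasing a) (hgap : ∀ n, ∃ n', ∀ m : ℕ, a n + 𝔘.std m ≤ a n') (hc : Antitone c)
    {ϑ : 𝔘.HN → 𝔘.HN} (hϑ : 𝔘.IsCD (𝔘.graph ϑ)) :
    ¬ ∀ x x', (∃ n, hdist x x' < twoPow (a n)) ↔ ∀ k, hdist (ϑ x) (ϑ x') < c k := by
  intro h
  obtain ⟨C, hC⟩ := hsat.exists_gt a
  refine hsat.not_forall_smallProj hϑ C fun G hG hGa hGϑ => ?_
  have hmem : ∀ ζ, (∀ n, ζ ∈ G n) → ϑ (𝔘.map Prod.fst ζ) = 𝔘.map Prod.snd ζ :=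
    fun ζ hζ => hGϑ (Set.mem_iInter.2 hζ)
  obtain ⟨m₁, h1⟩ := hsat.exists_dist_imp hG hGa Prod.snd Prod.fst (c := c)
    (d := fun n => twoPow (a n)) hc (fun m n hmn => twoPow_le_twoPow.2 (ha.monotone hmn))
    (fun ζ ζ' hζ hζ' hd => (h _ _).2 fun k => by rw [hmem ζ hζ, hmem ζ' hζ']; exact hd k)
  obtain ⟨n', hn'⟩ := hgap m₁
  -- On the intersection of the `G n`, a distance below `2 ^ a n'` already forces one below `2 ^ a
  -- m₁`, by going through the values of `ϑ`. Since `a n' - a m₁` is infinite, first coordinates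
  -- with this property have infinitesimal density; the count uses the first projection on both
  -- sides.
  obtain ⟨m₂, h2⟩ := hsat.exists_dist_imp hG hGa Prod.fst Prod.fst
    (c := fun _ => twoPow (a n')) (d := fun _ => twoPow (a m₁)) (fun _ _ _ => le_rfl)
    (fun _ _ _ => le_rfl)
    (fun ζ ζ' hζ hζ' hd => by
      refine ⟨0, h1 ζ (hζ _) ζ' (hζ' _) ?_⟩
      rw [← hmem ζ hζ, ← hmem ζ' hζ']
      exact (h _ _).1 ⟨n', hd 0⟩ _)
  obtain ⟨g, hg⟩ := (hG m₂).exists_ext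
  refine ⟨m₂, g, hg, fun m => ?_⟩
  refine hcount_image_mul_le (P := a n') (R := a m₁) (S := a m₁) (Q := a m₁) (q := Prod.fst)
    (fun ζ hζ ζ' hζ' hd => ?_) (fun ζ hζ ζ' hζ' hd => hd) le_rfl (hC n').le ?_
  · rw [← hg] at hζ hζ'
    exact h2 ζ hζ ζ' hζ' hd
  · have := hn' (m + 1)
    clear * - this
    generalize a m₁ = x at *
    generalize a n' = y at *
    obtain ⟨Ω, ω, x, y, rfl, rfl⟩ := rep₂ x y
    simp only [std_eq ω, map_add_map, map_le_map] at *
    filter_upwards [this] with w hw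
    omega

/-- The step of the nested ball construction. -/
theorem exists_ball_avoiding {b : ℕ → 𝔘.HN} (hb : IsDecreasing b) (S : Set 𝔘.HN) (n : ℕ)
    (hS : ∀ x ∈ S, ∀ y ∈ S, hdist x y < twoPow (b n) → ∀ k, hdist x y < twoPow (b k))
    (x : 𝔘.HN) (m : ℕ) :
    ∃ x' m', m ≤ m' ∧ (∀ y, hdist x' y < twoPow (b m') → hdist x y < twoPow (b m)) ∧
      ∀ y ∈ S, ¬ hdist x' y < twoPow (b m') := by
  set M := max m n + 1 with hM
  have hstep : ∀ i, b (i + 1) + 𝔘.std 1 ≤ b i := fun i => hb.add_le i 1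
  by_cases hex : ∃ y ∈ S, hdist x y < twoPow (b M)
  · obtain ⟨y₀, hy₀, hd₀⟩ := hex
    -- By `hS`, the points of `S` in the ball of radius `2 ^ b M` around `x` are indistinguishable
    -- from `y₀` at every scale, so it suffices to avoid one small ball around `y₀`.
    have hall : ∀ y ∈ S, hdist x y < twoPow (b M) → hdist y₀ y < twoPow (b (M + 2 + 1)) := by
      intro y hy hd
      refine hS y₀ hy₀ y hy (lt_of_lt_of_le ?_ (twoPow_le_twoPow.2
        (hb.antitone (le_max_right m n)))) _
      have h3 := hstep (max m n)
      rw [← hM] at h3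
      clear * - hd₀ hd h3
      generalize b M = u at *
      generalize b (max m n) = v at *
      obtain ⟨Ω, ω, x, y, y₀, u, v, -, rfl, rfl, rfl, rfl, rfl, -⟩ := rep₆ x y y₀ u v x
      simp only [std_eq ω, map_add_map, map_le_map, hdist_map, twoPow_map, map_lt_map] at *
      filter_upwards [hd₀, hd, h3] with w h1 h2 h3
      have := Nat.pow_le_pow_right (n := 2) two_pos h3
      rw [pow_succ] at this
      rw [Nat.dist_lt_iff] at *
      omega
    have hpow := (twoPow_le_twoPow (x := b M) (y := b m)).2 (hb.antitone (by
      have := le_max_left m n; omega))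
    have key : ∃ x', (∀ y, hdist x' y < twoPow (b (M + 2 + 1)) → hdist x y < twoPow (b M)) ∧
        ∀ y, hdist x' y < twoPow (b (M + 2 + 1)) → ¬ hdist y₀ y < twoPow (b (M + 2 + 1)) := by
      have s1 := hstep M
      have s2 := hstep (M + 1)
      have s3 := hstep (M + 2)
      clear hall
      -- If `x` is too close to `y₀`, a shift by `2 ^ b (M + 1)` leaves the neighbourhood of `y₀`
      -- without leaving the large ball; otherwise the centre stays and only the radius shrinks.
      by_cases hfar : hdist x y₀ < twoPow (b (M + 2))
      · refine ⟨x + twoPow (b (M + 1)), fun y hy => ?_, fun y hy hy' => ?_⟩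
        · clear * - s1 s2 s3 hy
          generalize b (M + 2 + 1) = u at *
          generalize b (M + 2) = v at *
          generalize b (M + 1) = v' at *
          generalize b M = v'' at *
          obtain ⟨Ω, ω, x, y, u, v, v', v'', rfl, rfl, rfl, rfl, rfl, rfl⟩ := rep₆ x y u v v' v''
          simp only [std_eq ω, map_add_map, map_le_map, hdist_map, twoPow_map, map_lt_map] at *
          filter_upwards [s1, s2, s3, hy] with w h1 h2 h3 h4
          have h1 := Nat.pow_le_pow_right (n := 2) two_pos h1
          have h2 := Nat.pow_le_pow_right (n := 2) two_pos h2
          have h3 := Nat.pow_le_pow_right (n := 2) two_pos h3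
          rw [pow_succ] at h1 h2 h3
          rw [Nat.dist_lt_iff] at *
          omega
        · clear hd₀ hpow
          generalize b (M + 2 + 1) = u at *
          generalize b (M + 2) = v at *
          generalize b (M + 1) = v' at *
          clear s1
          obtain ⟨Ω, ω, x, y, y₀, u, v, v', rfl, rfl, rfl, rfl, rfl, rfl⟩ := rep₆ x y y₀ u v v'
          simp only [std_eq ω, map_add_map, map_le_map, hdist_map, twoPow_map, map_lt_map] at *
          obtain ⟨w, ⟨⟨⟨⟨h2, h3⟩, h4⟩, h5⟩, h6⟩⟩ :=
            ((((s2.and s3).and hy).and hy').and hfar).exists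
          have h2 := Nat.pow_le_pow_right (n := 2) two_pos h2
          have h3 := Nat.pow_le_pow_right (n := 2) two_pos h3
          rw [pow_succ] at h2 h3
          rw [Nat.dist_lt_iff] at *
          omega
      · refine ⟨x, fun y hy => hy.trans_le (twoPow_le_twoPow.2 (hb.antitone (by omega))),
          fun y hy hy' => hfar ?_⟩
        clear hd₀ hpow hfar
        generalize b (M + 2 + 1) = u at *
        generalize b (M + 2) = v at *
        clear s1 s2
        obtain ⟨Ω, ω, x, y, y₀, u, v, -, rfl, rfl, rfl, rfl, rfl, -⟩ := rep₆ x y y₀ u v x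
        simp only [std_eq ω, map_add_map, map_le_map, hdist_map, twoPow_map, map_lt_map] at *
        filter_upwards [s3, hy, hy'] with w h3 h4 h5
        have h3 := Nat.pow_le_pow_right (n := 2) two_pos h3
        rw [pow_succ] at h3
        rw [Nat.dist_lt_iff] at *
        omega
    obtain ⟨x', h1, h2⟩ := key
    refine ⟨x', M + 2 + 1, by have := le_max_left m n; omega,
      fun y hy => (h1 y hy).trans_le hpow, fun y hy hd => h2 y hd (hall y hy (h1 y hd))⟩
  · refine ⟨x, M, by have := le_max_left m n; omega, fun y hy => hy.trans_le
      (twoPow_le_twoPow.2 (hb.antitone (by have := le_max_left m n; omega))), fun y hy hd => ?_⟩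
    exact hex ⟨y, hy, hd⟩

/-- A countably coinitial relation is not reducible to a union of internal distance conditions. -/
theorem CountablySaturated.not_cd_of_coinitial (hsat : 𝔘.CountablySaturated) {b d : ℕ → 𝔘.HN}
    (hb : IsDecreasing b) (hd : Monotone d) {ϑ : 𝔘.HN → 𝔘.HN} (hϑ : 𝔘.IsCD (𝔘.graph ϑ)) :
    ¬ ∀ x x', (∀ n, hdist x x' < twoPow (b n)) ↔ ∃ k, hdist (ϑ x) (ϑ x') < d k := by
  intro h
  obtain ⟨G, hGi, hG, hcov⟩ := hϑ.exists_cover (fun G => ∃ n, ∀ ζ ∈ G, ∀ ζ' ∈ G,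
      hdist (𝔘.map Prod.fst ζ) (𝔘.map Prod.fst ζ') < twoPow (b n) →
      hdist (𝔘.map Prod.snd ζ) (𝔘.map Prod.snd ζ') < d n) (fun G hG hGa hGϑ => by
    obtain ⟨m, hm⟩ := hsat.exists_dist_imp hG hGa Prod.fst Prod.snd (c := fun n => twoPow (b n))
      (d := d) (fun m n hmn => twoPow_le_twoPow.2 (hb.antitone hmn)) hd (fun ζ ζ' hζ hζ' hd => by
        have h1 := hGϑ (Set.mem_iInter.2 hζ)
        have h2 := hGϑ (Set.mem_iInter.2 hζ')
        rw [mem_graph_iff] at h1 h2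
        rw [← h1, ← h2]
        exact (h _ _).1 hd)
    exact ⟨m, m, hm⟩)
  choose n hn using hG
  -- On the `i`-th piece, closeness at the single scale `n i` bounds the distance of the values,
  -- hence entails equivalence, that is, closeness at all scales.
  let S : ℕ → Set 𝔘.HN := fun i => {x | 𝔘.pair x (ϑ x) ∈ G i}
  have hS : ∀ i, ∀ x ∈ S i, ∀ y ∈ S i, hdist x y < twoPow (b (n i)) →
      ∀ k, hdist x y < twoPow (b k) := by
    intro i x hx y hy hxy
    have := hn i _ hx _ hy (by simpa using hxy)
    rw [map_snd_pair, map_snd_pair] at this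
    exact (h x y).2 ⟨_, this⟩
  -- A Baire category argument: the `i`-th ball of a nested sequence misses `S i`, and saturation
  -- gives a common point of the balls, although the `S i` cover everything.
  choose x' m' hm' hball havoid using fun i x m => exists_ball_avoiding hb (S i) (n i) (hS i) x m
  let s : ℕ → 𝔘.HN × ℕ := fun i =>
    Nat.rec (𝔘.std 0, 0) (fun i p => (x' i p.1 p.2, m' i p.1 p.2)) i
  have hs : ∀ i, s (i + 1) = (x' i (s i).1 (s i).2, m' i (s i).1 (s i).2) := fun i => rfl
  let Ball : ℕ → Set 𝔘.HN := fun i => {y | hdist (s i).1 y < twoPow (b (s i).2)}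
  have hanti : Antitone Ball := antitone_nat_of_succ_le fun i y hy => by
    simp only [Ball, Set.mem_ofPred_eq, hs] at hy ⊢
    exact hball i _ _ y hy
  obtain ⟨y, hy⟩ := hsat.exists_forall Ball (fun i => by
      convert isInternal_rel (fun (y : ℕ) (p : ℕ × ℕ) => Nat.dist p.1 y < 2 ^ p.2)
        (𝔘.pair (s i).1 (b (s i).2)) using 1
      ext y
      simp only [Ball, Set.mem_ofPred_eq]
      generalize (s i).1 = u
      generalize b (s i).2 = v
      obtain ⟨Ω, ω, y, u, v, rfl, rfl, rfl⟩ := rep₃ y u v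
      simp) (fun N => ⟨(s N).1, fun n hn => hanti hn (by
        simp only [Ball, Set.mem_ofPred_eq]
        generalize (s N).1 = u
        generalize b (s N).2 = v
        obtain ⟨Ω, ω, u, v, rfl, rfl⟩ := rep₂ u v
        simp [Nat.dist_self])⟩)
  obtain ⟨i, hi⟩ := hcov _ (pair_mem_graph ϑ y)
  have := hy (i + 1)
  simp only [Ball, Set.mem_ofPred_eq, hs] at this
  exact havoid i _ _ y hi this

/-! ### Approximation of Borel sets in measure -/

/-- The hyperfinite set coded by `z`. -/
def fext (z : 𝔘.Star (Finset X)) : Set (𝔘.Star X) := {ξ | 𝔘.rel (fun x s => x ∈ s) ξ z}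

@[simp] theorem map_mem_fext (f : Ω → X) (s : Ω → Finset X) (ω : 𝔘.Star Ω) :
    𝔘.map f ω ∈ fext (𝔘.map s ω) ↔ ∀ᶠ w in (filt ω : Filter Ω), f w ∈ s w :=
  rel_map (fun (x : X) (t : Finset X) => x ∈ t) f s ω

open Classical in
/-- The number of elements of `z` that are neither in `z₁` nor in `z₂`. -/
noncomputable def loss (z z₁ z₂ : 𝔘.Star (Finset X)) : 𝔘.HN :=
  𝔘.map (fun p : Finset X × Finset X × Finset X => (p.1 \ (p.2.1 ∪ p.2.2)).card)
    (𝔘.pair z (𝔘.pair z₁ z₂))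

open Classical in
@[simp] theorem loss_map (z z₁ z₂ : Ω → Finset X) (ω : 𝔘.Star Ω) :
    loss (𝔘.map z ω) (𝔘.map z₁ ω) (𝔘.map z₂ ω) =
      𝔘.map (fun w => (z w \ (z₁ w ∪ z₂ w)).card) ω := by
  simp [loss]

open Classical in
-- The errors `2 ^ -(k + i + 2)` add up to less than `2 ^ -(k + 1)`, leaving the other half of `2 ^
-- -k` for the passage to infinitely many sets.
theorem _root_.Finset.card_sdiff_biUnion_mul_le {z : Finset X} {f : ℕ → Finset X × Finset X}
    {k n h : ℕ} (hf : ∀ i ≤ n, (z \ ((f i).1 ∪ (f i).2)).card * 2 ^ (k + i + 2) ≤ h) :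
    (z \ ((Finset.range (n + 1)).biUnion (fun i => (f i).1) ∪
      z.filter (fun x => ∀ i ≤ n, x ∈ (f i).2))).card * 2 ^ (k + 1) ≤ h := by
  have hsub : z \ ((Finset.range (n + 1)).biUnion (fun i => (f i).1) ∪
      z.filter (fun x => ∀ i ≤ n, x ∈ (f i).2)) ⊆
      (Finset.range (n + 1)).biUnion (fun i => z \ ((f i).1 ∪ (f i).2)) := by
    intro x hx
    simp only [Finset.mem_sdiff, Finset.mem_union, Finset.mem_biUnion, Finset.mem_range,
      Finset.mem_filter, not_or, not_exists, not_and, not_forall] at hx ⊢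
    obtain ⟨hxz, h1, h2⟩ := hx
    obtain ⟨i, hi, hxi⟩ := h2 hxz
    exact ⟨i, by omega, hxz, h1 i (by omega), hxi⟩
  have hsum : ∀ N ≤ n + 1, (∑ i ∈ Finset.range N, (z \ ((f i).1 ∪ (f i).2)).card) *
      2 ^ (k + 1 + N) + h ≤ h * 2 ^ N := by
    intro N hN
    induction N with
    | zero => simp
    | succ N ih =>
      have h1 := ih (by omega)
      have h2 := hf N (by omega)
      rw [Finset.sum_range_succ]
      have e1 : 2 ^ (k + 1 + (N + 1)) = 2 * 2 ^ (k + 1 + N) := by ring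
      have e2 : 2 ^ (k + N + 2) = 2 * 2 ^ (k + 1 + N) := by ring
      rw [e2] at h2
      rw [e1, pow_succ]
      nlinarith
  have h1 := hsum (n + 1) le_rfl
  have h2 := (Finset.card_le_card hsub).trans Finset.card_biUnion_le
  refine Nat.le_of_mul_le_mul_right (c := 2 ^ (n + 1)) ?_ (by positivity)
  rw [mul_assoc, ← pow_add]
  exact (Nat.mul_le_mul_right _ h2).trans (by omega)

open Classical in
-- Loeb measurability in counting form: up to a small part, `z` is exhausted by a hyperfinite set
-- inside `D` and one outside `D`. The property is symmetric under complements. For a union,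
-- finitely many inner sets suffice, since the intersections of the outer sets lose only a small
-- part from some index on.
theorem IsBorel.approx (hsat : 𝔘.CountablySaturated) {D : Set (𝔘.Star X)} (hD : 𝔘.IsBorel D)
    (z : 𝔘.Star (Finset X)) {h : 𝔘.HN} (hz : 𝔘.map Finset.card z ≤ h) (k : ℕ) :
    ∃ z₁ z₂ : 𝔘.Star (Finset X), (∀ ξ ∈ fext z₁, ξ ∈ D) ∧ (∀ ξ ∈ fext z₂, ξ ∉ D) ∧
      loss z z₁ z₂ * 𝔘.std (2 ^ k) ≤ h := by
  induction D, hD using MeasurableSpace.generateFrom_induction generalizing k with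
  | hC D hD _ =>
    obtain ⟨a, rfl⟩ := IsInternal.exists_ext hD
    obtain ⟨Ω, ω, a, z, h, rfl, rfl, rfl⟩ := rep₃ a z h
    refine ⟨𝔘.map (fun w => (z w).filter (· ∈ a w)) ω, 𝔘.map (fun w => (z w).filter (· ∉ a w)) ω,
      fun ξ hξ => ?_, fun ξ hξ hξ' => ?_, ?_⟩
    · obtain ⟨Ω', ω', ξ, f, rfl, rfl⟩ := rep₂ ξ ω
      simp only [map_map, map_mem_fext, map_mem_ext] at *
      exact hξ.mono fun w hw => (Finset.mem_filter.1 hw).2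
    · obtain ⟨Ω', ω', ξ, f, rfl, rfl⟩ := rep₂ ξ ω
      simp only [map_map, map_mem_fext, map_mem_ext] at *
      obtain ⟨w, h1, h2⟩ := (hξ.and hξ').exists
      exact (Finset.mem_filter.1 h1).2 h2
    · simp [std_eq ω, Finset.filter_union_filter_not_eq]
  | empty =>
    refine ⟨𝔘.std ∅, z, fun ξ hξ => ?_, fun ξ _ => by simp, ?_⟩
    · rw [← rep₁ ξ, std_eq ξ, map_mem_fext] at hξ
      obtain ⟨w, hw⟩ := hξ.exists
      exact absurd hw (Finset.notMem_empty _)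
    · obtain ⟨Ω, ω, z, h, rfl, rfl⟩ := rep₂ z h
      simp [std_eq ω]
  | compl D _ ih =>
    obtain ⟨z₁, z₂, h1, h2, h3⟩ := ih k
    refine ⟨z₂, z₁, h2, fun ξ hξ hn => hn (h1 ξ hξ), ?_⟩
    convert h3 using 2
    obtain ⟨Ω, ω, z, z₁, z₂, rfl, rfl, rfl⟩ := rep₃ z z₁ z₂
    simp [Finset.union_comm]
  | iUnion D _ ih =>
    choose z₁ z₂ h1 h2 h3 using fun n => ih n (k + n + 2)
    obtain ⟨α, hα⟩ := hsat.exists_seq (fun n => 𝔘.pair (z₁ n) (z₂ n))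
    obtain ⟨Ω, ω, f, z, h, rfl, rfl, rfl⟩ := rep₃ α z h
    simp only [map_map] at hα
    have hz1 : ∀ n, z₁ n = 𝔘.map (fun w => (f w n).1) ω := fun n => by
      rw [← map_fst_pair (z₁ n) (z₂ n), ← hα n, map_map]
    have hz2 : ∀ n, z₂ n = 𝔘.map (fun w => (f w n).2) ω := fun n => by
      rw [← map_snd_pair (z₁ n) (z₂ n), ← hα n, map_map]
    simp only [hz1, hz2, loss_map, std_eq ω, map_mul_map, map_le_map, map_map] at h1 h2 h3 hz
    let Q : ℕ → Ω → Finset X := fun n w => (z w).filter (fun x => ∀ i ≤ n, x ∈ (f w i).2)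
    have hQmono : ∀ w m n, m ≤ n → Q n w ⊆ Q m w := by
      intro w m n hmn x hx
      simp only [Q, Finset.mem_filter] at hx ⊢
      exact ⟨hx.1, fun i hi => hx.2 i (by omega)⟩
    -- The sets `Q n` decrease and start with at most `h` elements, so a loss of more than `h / 2 ^
    -- (k + 1)` can occur only finitely often. The induction in `key` is on the number of such
    -- losses still possible.
    have hstab : ∃ n₀, ∀ m, ∀ᶠ w in (filt ω : Filter Ω),
        (Q n₀ w \ Q m w).card * 2 ^ (k + 1) ≤ h w := by
      have key : ∀ j n, (∀ᶠ w in (filt ω : Filter Ω), (Q n w).card * 2 ^ (k + 1) ≤ j * h w) →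
          ∃ n₀, ∀ m, ∀ᶠ w in (filt ω : Filter Ω),
            (Q n₀ w \ Q m w).card * 2 ^ (k + 1) ≤ h w := by
        intro j
        induction j with
        | zero =>
          intro n hn
          refine ⟨n, fun m => hn.mono fun w hw => ?_⟩
          have := Nat.mul_le_mul_right (2 ^ (k + 1))
            (Finset.card_le_card (Finset.sdiff_subset : Q n w \ Q m w ⊆ Q n w))
          omega
        | succ j ihj =>
          intro n hn
          by_cases hst : ∀ m, ∀ᶠ w in (filt ω : Filter Ω),
            (Q n w \ Q m w).card * 2 ^ (k + 1) ≤ h w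
          · exact ⟨n, hst⟩
          · push Not at hst
            obtain ⟨m, hm⟩ := hst
            refine ihj (max n m) ?_
            filter_upwards [hn, hm] with w hw1 hw2
            have e1 := Finset.card_sdiff_add_card_eq_card (hQmono w n (max n m) (le_max_left _ _))
            have e2 := Finset.card_le_card (Finset.sdiff_subset_sdiff (Finset.Subset.refl (Q n w))
              (hQmono w m (max n m) (le_max_right _ _)))
            have e3 := Nat.mul_le_mul_right (2 ^ (k + 1)) e2
            rw [← e1, Nat.add_mul, Nat.add_mul] at hw1
            simp only [one_mul] at hw1
            omega
      refine key (2 ^ (k + 1)) 0 (hz.mono fun w hw => ?_)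
      rw [mul_comm]
      exact Nat.mul_le_mul_left _ ((Finset.card_le_card (Finset.filter_subset _ _)).trans hw)
    obtain ⟨n₀, hn₀⟩ := hstab
    -- Saturation replaces the intersection of all `Q m`, which need not be internal, by a
    -- hyperfinite set below all of them that still contains almost all of `Q n₀`.
    obtain ⟨ω', rfl, hω'⟩ := hsat.exists_ext (ω := ω) (X := Finset X)
      (fun m w q => q ⊆ Q m w ∧ (Q n₀ w \ q).card * 2 ^ (k + 1) ≤ h w) (fun N => by
        filter_upwards [hn₀ N] with w hw
        exact ⟨Q N w, fun n hn => ⟨hQmono w n N hn, hw⟩⟩)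
    refine ⟨𝔘.map (fun p => (Finset.range (n₀ + 1)).biUnion (fun i => (f p.1 i).1)) ω',
      𝔘.map Prod.snd ω', fun ξ hξ => ?_, fun ξ hξ hξ' => ?_, ?_⟩
    · by_contra hn
      simp only [Set.mem_iUnion, not_exists] at hn
      have h4 : ∀ i, ξ ∉ fext (𝔘.map (fun w => (f w i).1) (𝔘.map Prod.fst ω')) :=
        fun i hi => hn i (h1 i ξ hi)
      clear * - hξ h4
      obtain ⟨Ω', ω', ξ, g, rfl, rfl⟩ := rep₂ ξ ω'
      simp only [map_map, map_mem_fext, ← eventually_filt_not] at hξ h4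
      have := (Filter.eventually_all_finset (Finset.range (n₀ + 1))).2 fun i _ => h4 i
      obtain ⟨w, hw1, hw2⟩ := (hξ.and this).exists
      obtain ⟨i, hi, hxi⟩ := Finset.mem_biUnion.1 hw1
      exact hw2 i hi hxi
    · obtain ⟨m, hm⟩ := Set.mem_iUnion.1 hξ'
      refine h2 m ξ ?_ hm
      have h4 := hω' m
      clear * - hξ h4
      obtain ⟨Ω', ω', ξ, g, rfl, rfl⟩ := rep₂ ξ ω'
      simp only [map_map, map_mem_fext, eventually_filt_map] at *
      filter_upwards [hξ, h4] with w hw1 hw2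
      exact (Finset.mem_filter.1 (hw2.1 hw1)).2 m le_rfl
    · simp only [map_map, loss_map, std_eq ω', map_mul_map, map_le_map]
      have h5 : ∀ᶠ p in (filt ω' : Filter (Ω × Finset X)), ∀ i ∈ Finset.range (n₀ + 1),
          (z p.1 \ ((f p.1 i).1 ∪ (f p.1 i).2)).card * 2 ^ (k + i + 2) ≤ h p.1 :=
        (Filter.eventually_all_finset _).2 fun i _ => by simpa using h3 i
      filter_upwards [h5, hω' 0] with p hp1 hp2
      have e1 := Finset.card_sdiff_biUnion_mul_le (z := z p.1) (f := f p.1) (k := k) (n := n₀)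
        (h := h p.1) (fun i hi => hp1 i (Finset.mem_range.2 (by omega)))
      have hsub : z p.1 \ ((Finset.range (n₀ + 1)).biUnion (fun i => (f p.1 i).1) ∪ p.2) ⊆
          (z p.1 \ ((Finset.range (n₀ + 1)).biUnion (fun i => (f p.1 i).1) ∪ Q n₀ p.1)) ∪
            (Q n₀ p.1 \ p.2) := by
        intro x hx
        simp only [Finset.mem_sdiff, Finset.mem_union, not_or] at hx ⊢
        tauto
      have e2 := (Finset.card_le_card hsub).trans (Finset.card_union_le _ _)
      have e3 := Nat.mul_le_mul_right (2 ^ (k + 1)) e2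
      have e4 := hp2.2
      rw [Nat.add_mul] at e3
      have e5 : ∀ N : ℕ, N * 2 ^ (k + 1) = 2 * (N * 2 ^ k) := fun N => by ring
      change _ * 2 ^ (k + 1) ≤ _ at e1
      rw [e5] at e3
      simp only [Q] at e3 e4
      omega

end NonstandardUniverse

/-! ### Selections from sets of pairs -/

open Classical in
/-- A finite set of pairs `(x, y) ∈ s` with one pair for each `x < 2 ^ c` in the domain of `s`. -/
noncomputable def Set.selection (s : Set (ℕ × ℕ)) (c : ℕ) : Finset (ℕ × ℕ) :=
  ((Finset.range (2 ^ c)).image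
    (fun x => (x, if h : ∃ y, (x, y) ∈ s then h.choose else 0))).filter (· ∈ s)

open Classical in
theorem Set.card_selection_le (s : Set (ℕ × ℕ)) (c : ℕ) : (s.selection c).card ≤ 2 ^ c := by
  refine (Finset.card_filter_le _ _).trans (Finset.card_image_le.trans ?_)
  simp

open Classical in
theorem Set.mem_of_mem_selection {s : Set (ℕ × ℕ)} {c : ℕ} {p : ℕ × ℕ} (h : p ∈ s.selection c) :
    p.1 < 2 ^ c ∧ p ∈ s := by
  obtain ⟨h1, h2⟩ := Finset.mem_filter.1 h
  obtain ⟨x, hx, rfl⟩ := Finset.mem_image.1 h1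
  exact ⟨Finset.mem_range.1 hx, h2⟩

open Classical in
-- Distance less than `1` is equality, so `hs` makes `s` the graph of a partial function, and the
-- selected value is the only one.
theorem Set.mem_selection {s : Set (ℕ × ℕ)}
    (hs : ∀ p ∈ s, ∀ p' ∈ s, Nat.dist p.1 p'.1 < 1 → Nat.dist p.2 p'.2 < 1) {c : ℕ} {p : ℕ × ℕ}
    (hp : p ∈ s) (hc : p.1 < 2 ^ c) : p ∈ s.selection c := by
  refine Finset.mem_filter.2 ⟨Finset.mem_image.2 ⟨p.1, Finset.mem_range.2 hc, ?_⟩, hp⟩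
  have h : ∃ y, (p.1, y) ∈ s := ⟨p.2, hp⟩
  rw [dif_pos h]
  have := hs _ hp _ h.choose_spec (by simp [Nat.dist_self])
  rw [Nat.dist_lt_iff] at this
  ext
  · rfl
  · dsimp only at this ⊢; omega

open Classical in
theorem Set.countBelow_image_fst_selection (s : Set (ℕ × ℕ)) {c : ℕ} {t : Finset (ℕ × ℕ)}
    (ht : t ⊆ s.selection c) : Nat.countBelow c (Prod.fst '' (t : Set (ℕ × ℕ))) = t.card := by
  have hinj : Set.InjOn Prod.fst (t : Set (ℕ × ℕ)) := by
    intro p hp p' hp' hpp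
    obtain ⟨x, -, rfl⟩ := Finset.mem_image.1 (Finset.mem_filter.1 (ht hp)).1
    obtain ⟨x', -, rfl⟩ := Finset.mem_image.1 (Finset.mem_filter.1 (ht hp')).1
    dsimp only at hpp
    rw [hpp]
  rw [← Finset.card_image_of_injOn hinj, Nat.countBelow]
  congr 1
  ext x
  simp only [Finset.mem_filter, Finset.mem_range, Set.mem_image, Finset.mem_coe, Finset.mem_image,
    and_iff_right_iff_imp, forall_exists_index, and_imp]
  rintro p hp rfl
  exact (Set.mem_of_mem_selection (ht hp)).1

namespace NonstandardUniverse

open Filter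

variable {𝔘 : NonstandardUniverse.{u}} {X Y Z Ω : Type}

/-! ### Borel reductions of countably cofinal relations -/

theorem hdist_lt_one_iff {x y : 𝔘.HN} : hdist x y < 𝔘.std 1 ↔ x = y := by
  obtain ⟨Ω, ω, f, g, rfl, rfl⟩ := rep₂ x y
  simp only [std_eq ω, hdist_map, map_lt_map, map_eq_map_iff, Nat.dist_lt_iff]
  refine eventually_congr (Eventually.of_forall fun w => ?_)
  omega

/-- Infinitesimal density of an internal partial reduction. -/
theorem CountablySaturated.hcount_le_of_internal_reduction (hsat : 𝔘.CountablySaturated)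
    {a c : ℕ → 𝔘.HN} (ha : IsIncreasing a) (hc : Antitone c) {C : 𝔘.HN} (hC : ∀ n, a n < C)
    {g : 𝔘.Star (Set (ℕ × ℕ))}
    (h : ∀ ζ ∈ ext g, ∀ ζ' ∈ ext g,
      (∃ n, hdist (𝔘.map Prod.fst ζ) (𝔘.map Prod.fst ζ') < twoPow (a n)) ↔
        ∀ k, hdist (𝔘.map Prod.snd ζ) (𝔘.map Prod.snd ζ') < c k) (m : ℕ) :
    hcount C (𝔘.map (fun s => Prod.fst '' s) g) * 𝔘.std (2 ^ m) ≤ twoPow C := by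
  -- The reduction holds on the whole internal set, so one `m₁` serves every `n'`. Any finite
  -- increase of the exponent beyond `a m₁` can then be exploited, and no infinite gap is needed.
  obtain ⟨m₁, h1⟩ := hsat.exists_dist_imp (G := fun _ => ext g) (fun _ => isInternal_ext g)
    (fun _ _ _ => le_rfl) Prod.snd Prod.fst (c := c)
    (d := fun n => twoPow (a n)) hc (fun m n hmn => twoPow_le_twoPow.2 (ha.monotone hmn))
    (fun ζ ζ' hζ hζ' hd => (h ζ (hζ 0) ζ' (hζ' 0)).2 hd)
  refine hcount_image_mul_le (P := a (m₁ + (m + 1))) (R := a m₁) (S := a m₁) (Q := a m₁)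
    (q := Prod.fst) (fun ζ hζ ζ' hζ' hd => ?_) (fun ζ hζ ζ' hζ' hd => hd) le_rfl (hC _).le ?_
  · exact h1 ζ hζ ζ' hζ' ((h ζ hζ ζ' hζ').1 ⟨_, hd⟩ _)
  · have := ha.add_le m₁ (m + 1)
    clear * - this
    generalize a m₁ = x at *
    generalize a (m₁ + (m + 1)) = y at *
    obtain ⟨Ω, ω, x, y, rfl, rfl⟩ := rep₂ x y
    simp only [std_eq ω, map_add_map, map_le_map] at *
    filter_upwards [this] with w hw
    omega

/-- A countably cofinal relation is not Borel reducible to an intersection of internal distance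
conditions. -/
theorem CountablySaturated.not_borel_of_cofinal (hsat : 𝔘.CountablySaturated) {a c : ℕ → 𝔘.HN}
    (ha : IsIncreasing a) (hc : Antitone c) {ϑ : 𝔘.HN → 𝔘.HN} (hϑ : 𝔘.IsBorel (𝔘.graph ϑ)) :
    ¬ ∀ x x', (∃ n, hdist x x' < twoPow (a n)) ↔ ∀ k, hdist (ϑ x) (ϑ x') < c k := by
  classical
  intro h
  obtain ⟨C, hC⟩ := hsat.exists_gt a
  -- Each covering set is an internal partial function: distance less than `1` encodes equality. It
  -- need not lie inside the graph of `ϑ`, whence the approximation that follows.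
  obtain ⟨G, hGi, hG, hcov⟩ := hϑ.isCD.exists_cover (fun G => ∀ ζ ∈ G, ∀ ζ' ∈ G,
      hdist (𝔘.map Prod.fst ζ) (𝔘.map Prod.fst ζ') < 𝔘.std 1 →
      hdist (𝔘.map Prod.snd ζ) (𝔘.map Prod.snd ζ') < 𝔘.std 1) (fun G hG hGa hGϑ =>
    hsat.exists_dist_imp hG hGa Prod.fst Prod.snd (c := fun _ => 𝔘.std 1)
      (d := fun _ => 𝔘.std 1) (fun _ _ _ => le_rfl) (fun _ _ _ => le_rfl)
      (fun ζ ζ' hζ hζ' hd => by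
        have h1 := hGϑ (Set.mem_iInter.2 hζ)
        have h2 := hGϑ (Set.mem_iInter.2 hζ')
        have h3 := hdist_lt_one_iff.1 (hd 0)
        rw [mem_graph_iff] at h1 h2
        refine ⟨0, hdist_lt_one_iff.2 ?_⟩
        rw [← h1, ← h2, h3]))
  choose g hg using fun i => (hGi i).exists_ext
  have happ : ∀ i, ∃ z₁ z₂ : 𝔘.Star (Finset (ℕ × ℕ)), (∀ ξ ∈ fext z₁, ξ ∈ 𝔘.graph ϑ) ∧
      (∀ ξ ∈ fext z₂, ξ ∉ 𝔘.graph ϑ) ∧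
      loss (𝔘.map₂ Set.selection (g i) C) z₁ z₂ * 𝔘.std (2 ^ (i + 3)) ≤ twoPow C := by
    intro i
    refine hϑ.approx hsat _ ?_ _
    generalize g i = γ
    clear hC
    obtain ⟨Ω, ω, γ, C, rfl, rfl⟩ := rep₂ γ C
    simp only [map₂_map, map_map, twoPow_map, map_le_map]
    exact Eventually.of_forall fun w => Set.card_selection_le _ _
  choose z₁ z₂ hz₁ hz₂ hloss using happ
  -- The part `z₁ i` lies inside the graph, so it is an internal partial reduction and has
  -- infinitesimal density.
  have hsmall : ∀ i, hcount C (𝔘.map (fun p : (Set (ℕ × ℕ) × ℕ) × Finset (ℕ × ℕ) =>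
      Prod.fst '' ((p.1.1.selection p.1.2 ∩ p.2 : Finset (ℕ × ℕ)) : Set (ℕ × ℕ)))
      (𝔘.pair (𝔘.pair (g i) C) (z₁ i))) * 𝔘.std (2 ^ (i + 3)) ≤ twoPow C := by
    intro i
    have := hsat.hcount_le_of_internal_reduction ha hc hC
      (g := 𝔘.map (fun p : (Set (ℕ × ℕ) × ℕ) × Finset (ℕ × ℕ) =>
        ((p.1.1.selection p.1.2 ∩ p.2 : Finset (ℕ × ℕ)) : Set (ℕ × ℕ)))
        (𝔘.pair (𝔘.pair (g i) C) (z₁ i))) ?_ (i + 3)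
    · rwa [map_map] at this
    · have hsub : ∀ ζ ∈ ext (𝔘.map (fun p : (Set (ℕ × ℕ) × ℕ) × Finset (ℕ × ℕ) =>
        ((p.1.1.selection p.1.2 ∩ p.2 : Finset (ℕ × ℕ)) : Set (ℕ × ℕ)))
        (𝔘.pair (𝔘.pair (g i) C) (z₁ i))), ϑ (𝔘.map Prod.fst ζ) = 𝔘.map Prod.snd ζ := by
        intro ζ hζ
        refine hz₁ i ζ ?_
        generalize g i = γ at hζ
        generalize z₁ i = z at hζ ⊢
        clear * - hζ
        obtain ⟨Ω, ω, γ, z, C, ζ, rfl, rfl, rfl, rfl⟩ := rep₄ γ z C ζ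
        simp only [pair_map, map_map, map_mem_ext, map_mem_fext] at *
        exact hζ.mono fun w hw => (Finset.mem_inter.1 (Finset.mem_coe.1 hw)).2
      intro ζ hζ ζ' hζ'
      rw [← hsub ζ hζ, ← hsub ζ' hζ']
      exact h _ _
  -- What `z₂ i` leaves of the selection is the small part in `z₁ i` plus the loss, each of density
  -- at most `2 ^ -(i + 3)`. The point of the graph over an uncovered `x` would lie in a selection
  -- and outside `z₂ i`, a contradiction.
  obtain ⟨x, hxC, hx⟩ := hsat.exists_notMem (c := C) (a := fun i => 𝔘.map
      (fun p : (Set (ℕ × ℕ) × ℕ) × Finset (ℕ × ℕ) =>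
        Prod.fst '' ((p.1.1.selection p.1.2 \ p.2 : Finset (ℕ × ℕ)) : Set (ℕ × ℕ)))
      (𝔘.pair (𝔘.pair (g i) C) (z₂ i))) (fun i => by
    have h1 := hsmall i
    have h2 := hloss i
    clear * - h1 h2
    generalize g i = γ at *
    generalize z₁ i = z at *
    generalize z₂ i = z' at *
    obtain ⟨Ω, ω, γ, z, z', C, rfl, rfl, rfl, rfl⟩ := rep₄ γ z z' C
    simp only [pair_map, map_map, hcount_map, std_eq ω, map_mul_map, twoPow_map, map_le_map,
      map₂_map, loss_map] at *
    filter_upwards [h1, h2] with w hw1 hw2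
    rw [Set.countBelow_image_fst_selection (γ w) (Finset.inter_subset_left)] at hw1
    rw [Set.countBelow_image_fst_selection (γ w) (Finset.sdiff_subset)]
    have hsub : (γ w).selection (C w) \ z' w ⊆ ((γ w).selection (C w) ∩ z w) ∪
        ((γ w).selection (C w) \ (z w ∪ z' w)) := by
      intro p hp
      simp only [Finset.mem_sdiff, Finset.mem_union, Finset.mem_inter, not_or] at *
      tauto
    have e1 := (Finset.card_le_card hsub).trans (Finset.card_union_le _ _)
    have e2 := Nat.mul_le_mul_right (2 ^ (i + 3)) e1
    have e3 : ∀ N, N * 2 ^ (i + 3) = 2 * (N * 2 ^ (i + 2)) := fun N => by ring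
    rw [Nat.add_mul, e3] at e2
    have e4 : ((γ w).selection (C w) \ (z w ∪ z' w)).card * 2 ^ (i + 3) ≤ 2 ^ C w := by
      convert hw2
    omega)
  obtain ⟨i, hi⟩ := hcov _ (pair_mem_graph ϑ x)
  have hnot : 𝔘.pair x (ϑ x) ∉ fext (z₂ i) := fun hmem => hz₂ i _ hmem (pair_mem_graph ϑ x)
  refine hx i ?_
  have hGi := hG i
  rw [hg i] at hi hGi
  generalize g i = γ at *
  generalize z₂ i = z' at *
  generalize ϑ x = y at *
  clear * - hGi hi hnot hxC
  obtain ⟨Ω, ω, x, y, γ, z', C, -, rfl, rfl, rfl, rfl, rfl, -⟩ := rep₆ x y γ z' C x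
  simp only [std_eq ω] at hGi
  have hfun := eventually_dist_imp hGi
  simp only [pair_map, map_mem_ext, map_mem_fext, ← eventually_filt_not, twoPow_map, map_lt_map,
    map_map] at *
  filter_upwards [hfun, hi, hnot, hxC] with w h1 h2 h3 h4
  refine ⟨(x w, y w), ?_, rfl⟩
  rw [Finset.mem_coe, Finset.mem_sdiff]
  exact ⟨Set.mem_selection h1 h2 h4, h3⟩

end NonstandardUniverse

/-! ### Spreading binary blocks -/

/-- The use of the separating zero digit: points in the lower halves of different blocks of length
`2 * M` are more than `M` apart. -/
theorem Nat.eq_of_dist_add_mul_lt {M u v p q : ℕ} (hu : u < M) (hv : v < M)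
    (h : Nat.dist (u + p * (2 * M)) (v + q * (2 * M)) < M) : p = q := by
  rw [Nat.dist_lt_iff] at h
  rcases lt_trichotomy p q with hpq | hpq | hpq
  · have := Nat.mul_le_mul_right (2 * M) (Nat.succ_le_of_lt hpq)
    rw [Nat.succ_mul] at this
    omega
  · exact hpq
  · have := Nat.mul_le_mul_right (2 * M) (Nat.succ_le_of_lt hpq)
    rw [Nat.succ_mul] at this
    omega

/-- There is a map which sends, for each `j ≤ N`, the binary digits from position `α j` on to
positions above `β j`, with a separating zero digit. -/
theorem Nat.exists_spread (α β : ℕ → ℕ) (N : ℕ)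
    (hα : ∀ j < N, α j ≤ α (j + 1)) (hβ : ∀ j < N, β j + (α (j + 1) - α j) + 1 ≤ β (j + 1)) :
    ∃ Θ : ℕ → ℕ, ∀ j ≤ N, ∀ x y,
      x / 2 ^ α j = y / 2 ^ α j ↔ Nat.dist (Θ x) (Θ y) < 2 ^ β j := by
  -- The digits of `x` from position `α i` up to `α (i + 1)`. In `L` they are placed from position
  -- `β i + 1` on, position `β i` being kept zero.
  let blk : ℕ → ℕ → ℕ := fun i x => x / 2 ^ α i % 2 ^ (α (i + 1) - α i)
  let L : ℕ → ℕ → ℕ := fun j x => ∑ i ∈ Finset.range j, blk i x * (2 * 2 ^ β i)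
  have hLs : ∀ j x, L (j + 1) x = L j x + blk j x * (2 * 2 ^ β j) :=
    fun j x => Finset.sum_range_succ _ _
  have hmono : ∀ i j, i ≤ j → j ≤ N → α i ≤ α j := by
    intro i j hij
    induction j, hij using Nat.le_induction with
    | base => simp
    | succ j _ ih => exact fun hj => (ih (by omega)).trans (hα j (by omega))
  -- The first `j` blocks fit below position `β j`; this is where the bound on `β (j + 1)` is used.
  have hL : ∀ j ≤ N, ∀ x, L j x < 2 ^ β j := by
    intro j hj x
    induction j with
    | zero => simp [L]
    | succ j ih =>
      have h1 := ih (by omega)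
      have h2 : blk j x < 2 ^ (α (j + 1) - α j) := Nat.mod_lt _ (by positivity)
      have h3 := Nat.pow_le_pow_right (n := 2) two_pos (hβ j (by omega))
      have h4 := Nat.mul_le_mul_right (2 * 2 ^ β j) (Nat.succ_le_of_lt h2)
      have h5 : 2 ^ (β j + (α (j + 1) - α j) + 1) = 2 ^ (α (j + 1) - α j) * (2 * 2 ^ β j) := by
        ring
      rw [Nat.succ_mul] at h4
      rw [hLs]
      omega
  have hquot : ∀ i j, i ≤ j → j ≤ N → ∀ x, x / 2 ^ α j = x / 2 ^ α i / 2 ^ (α j - α i) := by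
    intro i j hij hj x
    rw [Nat.div_div_eq_div_mul, ← pow_add, Nat.add_sub_cancel' (hmono i j hij hj)]
  have hLeq : ∀ x y j k, j ≤ k → k ≤ N → x / 2 ^ α j = y / 2 ^ α j →
      L k x + L j y = L k y + L j x := by
    intro x y j k hjk hk hq
    induction k, hjk using Nat.le_induction with
    | base => omega
    | succ k hk' ih =>
      have h1 := ih (by omega)
      have h2 : blk k x = blk k y := by
        simp only [blk]
        rw [hquot j k hk' (by omega) x, hquot j k hk' (by omega) y, hq]
      rw [hLs, hLs, h2]
      omega
  let Θ : ℕ → ℕ := fun x => L N x + x / 2 ^ α N * (2 * 2 ^ β N)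
  have hΘ : ∀ x y, ∀ j ≤ N, x / 2 ^ α j = y / 2 ^ α j → Θ x + L j y = Θ y + L j x := by
    intro x y j hj hq
    have h1 := hLeq x y j N hj le_rfl hq
    have h2 : x / 2 ^ α N = y / 2 ^ α N := by
      rw [hquot j N hj le_rfl x, hquot j N hj le_rfl y, hq]
    simp only [Θ, h2]
    omega
  -- Downward induction from the top level: agreement above `α (j + 1)` lets the higher digits
  -- cancel, after which block `j` is recovered from the distance.
  have hback : ∀ x y d j, j + d = N → Nat.dist (Θ x) (Θ y) < 2 ^ β j →
      x / 2 ^ α j = y / 2 ^ α j := by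
    intro x y d
    induction d with
    | zero =>
      intro j hj hd
      obtain rfl : j = N := by omega
      exact Nat.eq_of_dist_add_mul_lt (hL j le_rfl x) (hL j le_rfl y) hd
    | succ d ih =>
      intro j hj hd
      have hlt : 2 ^ β j ≤ 2 ^ β (j + 1) :=
        Nat.pow_le_pow_right two_pos (by have := hβ j (by omega); omega)
      have hq := ih (j + 1) (by omega) (hd.trans_le hlt)
      have h1 := hΘ x y (j + 1) (by omega) hq
      have h2 : blk j x = blk j y := by
        refine Nat.eq_of_dist_add_mul_lt (hL j (by omega) x) (hL j (by omega) y) ?_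
        rw [← hLs, ← hLs]
        rw [Nat.dist_lt_iff] at hd ⊢
        omega
      rw [hquot j (j + 1) (by omega) (by omega) x, hquot j (j + 1) (by omega) (by omega) y] at hq
      rw [← Nat.div_add_mod (x / 2 ^ α j) (2 ^ (α (j + 1) - α j)),
        ← Nat.div_add_mod (y / 2 ^ α j) (2 ^ (α (j + 1) - α j)), hq]
      simp only [blk] at h2
      rw [h2]
  refine ⟨Θ, fun j hj x y => ⟨fun hq => ?_, fun hd => hback x y (N - j) j (by omega) hd⟩⟩
  have h1 := hΘ x y j hj hq
  have h2 := hL j hj x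
  have h3 := hL j hj y
  rw [Nat.dist_lt_iff]
  omega

/-- A finite decreasing sequence is read backwards. Only finitely many levels are treated here;
saturation provides all standard levels later. -/
theorem Nat.exists_spread_decreasing (α β : ℕ → ℕ) (N : ℕ)
    (hα : ∀ j < N, α (j + 1) ≤ α j) (hβ : ∀ j < N, β (j + 1) + (α j - α (j + 1)) + 1 ≤ β j) :
    ∃ Θ : ℕ → ℕ, ∀ j ≤ N, ∀ x y,
      x / 2 ^ α j = y / 2 ^ α j ↔ Nat.dist (Θ x) (Θ y) < 2 ^ β j := by
  have e : ∀ j < N, N - j = N - (j + 1) + 1 := fun j hj => by omega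
  obtain ⟨Θ, hΘ⟩ := Nat.exists_spread (fun j => α (N - j)) (fun j => β (N - j)) N
    (fun j hj => by
      have := hα (N - (j + 1)) (by omega)
      rwa [← e j hj] at this)
    (fun j hj => by
      have := hβ (N - (j + 1)) (by omega)
      rwa [← e j hj] at this)
  refine ⟨Θ, fun j hj x y => ?_⟩
  have := hΘ (N - j) (by omega) x y
  rwa [Nat.sub_sub_self hj] at this

namespace NonstandardUniverse

open Filter

variable {𝔘 : NonstandardUniverse.{u}} {X Y Z Ω : Type}

/-- `⌊x / 2 ^ a⌋`. -/
noncomputable def hquot (x a : 𝔘.HN) : 𝔘.HN := 𝔘.map₂ (fun x a => x / 2 ^ a) x a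

@[simp] theorem hquot_map (f g : Ω → ℕ) (ω : 𝔘.Star Ω) :
    hquot (𝔘.map f ω) (𝔘.map g ω) = 𝔘.map (fun w => f w / 2 ^ g w) ω := map₂_map _ _ _ _

/-- The residue of `x` modulo `2 ^ p` is less than `2 ^ p - 2 ^ q`. -/
def Room (p q x : 𝔘.HN) : Prop :=
  𝔘.rel (fun (x : ℕ) (r : ℕ × ℕ) => x % 2 ^ r.1 + 2 ^ r.2 < 2 ^ r.1) x (𝔘.pair p q)

@[simp] theorem room_map (p q x : Ω → ℕ) (ω : 𝔘.Star Ω) :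
    Room (𝔘.map p ω) (𝔘.map q ω) (𝔘.map x ω) ↔
      ∀ᶠ w in (filt ω : Filter Ω), x w % 2 ^ p w + 2 ^ q w < 2 ^ p w := by
  simp [Room]

theorem isInternal_room (p q : 𝔘.HN) : 𝔘.IsInternal {x | Room p q x} := isInternal_rel _ _

/-- With this much room, adding less than `2 ^ q` to `x` causes no carry past position `p`. -/
theorem Room.hquot_eq {p q x y : 𝔘.HN} (h : Room p q x) (hxy : x ≤ y)
    (hd : hdist x y < twoPow q) : hquot x p = hquot y p := by
  obtain ⟨Ω, ω, p, q, x, y, rfl, rfl, rfl, rfl⟩ := rep₄ p q x y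
  simp only [room_map, map_le_map, hdist_map, twoPow_map, map_lt_map, hquot_map,
    map_eq_map_iff] at *
  filter_upwards [h, hxy, hd] with w h1 h2 h3
  rw [Nat.dist_lt_iff] at h3
  have h4 := Nat.div_add_mod' (x w) (2 ^ p w)
  symm
  refine Nat.div_eq_of_lt_le (by omega) ?_
  rw [Nat.succ_mul]
  omega

theorem hdist_lt_of_hquot_eq {p x y : 𝔘.HN} (h : hquot x p = hquot y p) :
    hdist x y < twoPow p := by
  obtain ⟨Ω, ω, p, x, y, rfl, rfl, rfl⟩ := rep₃ p x y
  simp only [hdist_map, twoPow_map, map_lt_map, hquot_map, map_eq_map_iff] at *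
  filter_upwards [h] with w hw
  have e1 := Nat.div_add_mod (x w) (2 ^ p w)
  have e2 := Nat.div_add_mod (y w) (2 ^ p w)
  have l1 := Nat.mod_lt (x w) (pow_pos two_pos (p w) : 0 < 2 ^ p w)
  have l2 := Nat.mod_lt (y w) (pow_pos two_pos (p w) : 0 < 2 ^ p w)
  rw [hw] at e1
  rw [Nat.dist_lt_iff]; omega

/-- Without room the residue is at least `2 ^ p - 2 ^ q`, so adding `2 ^ q` wraps it around to less
than `2 ^ q`, far from the top. -/
theorem room_add_twoPow {p q q' x : 𝔘.HN} (hq : q < p) (hq' : q' < p) (h : ¬ Room p q x) :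
    Room p q' (x + twoPow q) := by
  obtain ⟨Ω, ω, p, q, q', x, rfl, rfl, rfl, rfl⟩ := rep₄ p q q' x
  rw [room_map, ← eventually_filt_not] at h
  simp only [room_map, map_add_map, twoPow_map, map_lt_map] at *
  filter_upwards [hq, hq', h] with w h1 h2 h3
  have l1 := Nat.mod_lt (x w) (pow_pos two_pos (p w) : 0 < 2 ^ p w)
  have p1 := Nat.pow_le_pow_right (n := 2) two_pos (Nat.succ_le_of_lt h1)
  have p2 := Nat.pow_le_pow_right (n := 2) two_pos (Nat.succ_le_of_lt h2)
  rw [Nat.pow_succ] at p1 p2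
  have p3 : 0 < 2 ^ q w := by positivity
  have e1 := Nat.div_add_mod (x w) (2 ^ p w)
  have e2 : x w + 2 ^ q w = (x w % 2 ^ p w + 2 ^ q w - 2 ^ p w) + 2 ^ p w * (x w / 2 ^ p w + 1) := by
    rw [Nat.mul_add, Nat.mul_one]; omega
  rw [e2, Nat.add_mul_mod_self_left, Nat.mod_eq_of_lt (by omega)]
  omega

theorem near_trans {p q x y z : 𝔘.HN} (h1 : hdist x y < twoPow p) (h2 : hdist y z < twoPow p)
    (hpq : p < q) : hdist x z < twoPow q := by
  obtain ⟨Ω, ω, p, q, x, y, z, -, rfl, rfl, rfl, rfl, rfl, -⟩ := rep₆ p q x y z p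
  simp only [hdist_map, twoPow_map, map_lt_map] at *
  filter_upwards [h1, h2, hpq] with w h1 h2 h3
  have p1 := Nat.pow_le_pow_right (n := 2) two_pos (Nat.succ_le_of_lt h3)
  rw [Nat.pow_succ] at p1
  rw [Nat.dist_lt_iff] at *
  omega

/-- The least multiple of `2 ^ p` that is greater than `x`. -/
noncomputable def roundUp (p x : 𝔘.HN) : 𝔘.HN := 𝔘.map₂ (fun p x => (x / 2 ^ p + 1) * 2 ^ p) p x

@[simp] theorem roundUp_map (f g : Ω → ℕ) (ω : 𝔘.Star Ω) :
    roundUp (𝔘.map f ω) (𝔘.map g ω) = 𝔘.map (fun w => (g w / 2 ^ f w + 1) * 2 ^ f w) ω :=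
  map₂_map _ _ _ _

theorem hdist_roundUp_lt {p q q' x : 𝔘.HN} (h : ¬ Room p q x) (hq : q < q') :
    hdist x (roundUp p x) < twoPow q' := by
  obtain ⟨Ω, ω, p, q, q', x, rfl, rfl, rfl, rfl⟩ := rep₄ p q q' x
  rw [room_map, ← eventually_filt_not] at h
  simp only [hdist_map, roundUp_map, twoPow_map, map_lt_map] at *
  filter_upwards [hq, h] with w h1 h2
  have p1 := Nat.pow_lt_pow_right (a := 2) one_lt_two h1
  have l1 := Nat.mod_lt (x w) (pow_pos two_pos (p w) : 0 < 2 ^ p w)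
  have e1 := Nat.div_add_mod' (x w) (2 ^ p w)
  rw [Nat.dist_lt_iff, Nat.succ_mul]
  omega

/-- A multiple of `2 ^ p` has residue `0` modulo smaller powers; modulo a larger `2 ^ p'` its
residue is at most `2 ^ p' - 2 ^ p`. -/
theorem room_roundUp {p p' q' x : 𝔘.HN} (hq' : q' < p') (h : p < p' → q' < p) :
    Room p' q' (roundUp p x) := by
  rcases le_or_gt p' p with hp | hp
  · clear h
    obtain ⟨Ω, ω, p, p', q', x, rfl, rfl, rfl, rfl⟩ := rep₄ p p' q' x
    simp only [room_map, roundUp_map, map_le_map, map_lt_map] at *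
    filter_upwards [hp, hq'] with w h1 h2
    have : 2 ^ p' w ∣ (x w / 2 ^ p w + 1) * 2 ^ p w := (pow_dvd_pow 2 h1).mul_left _
    rw [Nat.mod_eq_zero_of_dvd this, Nat.zero_add]
    exact Nat.pow_lt_pow_right one_lt_two h2
  · replace h := h hp
    obtain ⟨Ω, ω, p, p', q', x, rfl, rfl, rfl, rfl⟩ := rep₄ p p' q' x
    simp only [room_map, roundUp_map, map_lt_map] at *
    filter_upwards [hp, h] with w h1 h2
    obtain ⟨d, hd⟩ := pow_dvd_pow 2 h1.le
    have p1 := Nat.pow_lt_pow_right (a := 2) one_lt_two h2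
    rw [hd, Nat.mul_comm (_ + 1), Nat.mul_mod_mul_left]
    have hd0 : 0 < d := Nat.pos_of_ne_zero fun h0 => by
      rw [h0, Nat.mul_zero] at hd
      exact (pow_pos two_pos (p' w) : 0 < 2 ^ p' w).ne' hd
    have := Nat.mul_le_mul_left (2 ^ p w) (Nat.succ_le_of_lt (Nat.mod_lt (x w / 2 ^ p w + 1) hd0))
    rw [Nat.mul_succ] at this
    omega

theorem CountablySaturated.exists_spread_aux (hsat : 𝔘.CountablySaturated) {ω : 𝔘.Star Ω}
    {A B : ℕ → Ω → ℕ} (h : ∀ N, ∀ᶠ w in (filt ω : Filter Ω), ∃ Θ : ℕ → ℕ, ∀ j ≤ N, ∀ x y,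
      x / 2 ^ A j w = y / 2 ^ A j w ↔ Nat.dist (Θ x) (Θ y) < 2 ^ B j w) :
    ∃ t : 𝔘.Star (ℕ → ℕ), ∀ j x y, hquot x (𝔘.map (A j) ω) = hquot y (𝔘.map (A j) ω) ↔
      hdist (app t x) (app t y) < twoPow (𝔘.map (B j) ω) := by
  obtain ⟨ω', rfl, h'⟩ := hsat.exists_ext (ω := ω) (X := ℕ → ℕ) (fun j w Θ => ∀ x y,
    x / 2 ^ A j w = y / 2 ^ A j w ↔ Nat.dist (Θ x) (Θ y) < 2 ^ B j w) h
  refine ⟨𝔘.map Prod.snd ω', fun j x y => ?_⟩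
  have hj := h' j
  clear h h'
  obtain ⟨Ω'', ω'', g, x, y, rfl, rfl, rfl⟩ := rep₃ ω' x y
  simp only [map_map, hquot_map, app_map, hdist_map, twoPow_map, map_eq_map_iff, map_lt_map,
    eventually_filt_map] at *
  exact eventually_congr (hj.mono fun w hw => hw _ _)

theorem CountablySaturated.exists_spread (hsat : 𝔘.CountablySaturated) {α β : ℕ → 𝔘.HN}
    (hα : ∀ j, α j ≤ α (j + 1)) (hβ : ∀ j, β j + (α (j + 1) - α j) + 𝔘.std 1 ≤ β (j + 1)) :
    ∃ t : 𝔘.Star (ℕ → ℕ), ∀ j x y, hquot x (α j) = hquot y (α j) ↔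
      hdist (app t x) (app t y) < twoPow (β j) := by
  obtain ⟨a, ha⟩ := hsat.exists_seq α
  obtain ⟨b, hb⟩ := hsat.exists_seq β
  obtain ⟨Ω, ω, a, b, rfl, rfl⟩ := rep₂ a b
  simp only [map_map] at ha hb
  simp only [← ha, ← hb, std_eq ω, map_add_map, map_sub_map, map_le_map] at *
  refine hsat.exists_spread_aux fun N => ?_
  have h1 := (Filter.eventually_all_finset (Finset.range N)).2 fun i _ => hα i
  have h2 := (Filter.eventually_all_finset (Finset.range N)).2 fun i _ => hβ i
  filter_upwards [h1, h2] with w h1 h2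
  exact Nat.exists_spread (a w) (b w) N (fun j hj => h1 j (Finset.mem_range.2 hj))
    (fun j hj => h2 j (Finset.mem_range.2 hj))

theorem CountablySaturated.exists_spread_decreasing (hsat : 𝔘.CountablySaturated)
    {α β : ℕ → 𝔘.HN} (hα : ∀ j, α (j + 1) ≤ α j)
    (hβ : ∀ j, β (j + 1) + (α j - α (j + 1)) + 𝔘.std 1 ≤ β j) :
    ∃ t : 𝔘.Star (ℕ → ℕ), ∀ j x y, hquot x (α j) = hquot y (α j) ↔
      hdist (app t x) (app t y) < twoPow (β j) := by
  obtain ⟨a, ha⟩ := hsat.exists_seq α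
  obtain ⟨b, hb⟩ := hsat.exists_seq β
  obtain ⟨Ω, ω, a, b, rfl, rfl⟩ := rep₂ a b
  simp only [map_map] at ha hb
  simp only [← ha, ← hb, std_eq ω, map_add_map, map_sub_map, map_le_map] at *
  refine hsat.exists_spread_aux fun N => ?_
  have h1 := (Filter.eventually_all_finset (Finset.range N)).2 fun i _ => hα i
  have h2 := (Filter.eventually_all_finset (Finset.range N)).2 fun i _ => hβ i
  filter_upwards [h1, h2] with w h1 h2
  exact Nat.exists_spread_decreasing (a w) (b w) N (fun j hj => h1 j (Finset.mem_range.2 hj))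
    (fun j hj => h2 j (Finset.mem_range.2 hj))

open scoped MeasureTheory

/-! ### Sufficient conditions for Borel reducibility -/

open Classical in
-- The first index `i` with `x ∈ Bad i`, if any, divides the domain into countably many Borel
-- pieces, on each of which the map is internal.
theorem isBorel_graph_first {Bad : ℕ → Set (𝔘.Star X)} (hBad : ∀ i, 𝔘.IsBorel (Bad i))
    (t : 𝔘.Star (X → Y)) (s : ℕ → 𝔘.Star (X → Y)) :
    𝔘.IsBorel (𝔘.graph fun x => if h : ∃ i, x ∈ Bad i then app (s (Nat.find h)) x else app t x) := by
  let B : ℕ → Set (𝔘.Star X) := fun n =>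
    if n = 0 then (⋃ i, Bad i)ᶜ else Bad (n - 1) \ ⋃ i ∈ Finset.range (n - 1), Bad i
  have hB : ∀ n, 𝔘.IsBorel (B n) := by
    intro n
    simp only [B]
    split_ifs
    · exact MeasurableSet.compl (m := borelSpace 𝔘 X)
        (MeasurableSet.iUnion (m := borelSpace 𝔘 X) hBad)
    · exact MeasurableSet.diff (m := borelSpace 𝔘 X) (hBad _)
        (Finset.measurableSet_biUnion (m := borelSpace 𝔘 X) _ fun i _ => hBad i)
  refine measurableSet_graph (m := borelSpace 𝔘 (X × Y)) (fun C hC => hC.isBorel) (B := B)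
    (fun i => (hB i).preimage Prod.fst) (fun n => if n = 0 then t else s (n - 1)) ?_ ?_
  · intro n x hx
    rcases Nat.eq_zero_or_pos n with rfl | hn
    · simp only [B, if_true, Set.mem_compl_iff, Set.mem_iUnion] at hx
      rw [dif_neg hx, if_pos rfl]
    · have hn0 : n ≠ 0 := by omega
      simp only [B, if_neg hn0, Set.mem_sdiff, Set.mem_iUnion, Finset.mem_range, exists_prop,
        not_exists, not_and] at hx
      have h : ∃ i, x ∈ Bad i := ⟨_, hx.1⟩
      rw [dif_pos h, if_neg hn0, (Nat.find_eq_iff h).2 hx]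
  · intro x
    by_cases h : ∃ i, x ∈ Bad i
    · refine ⟨Nat.find h + 1, ?_⟩
      simp only [B, Nat.add_eq_zero_iff, one_ne_zero, and_false, if_false, Nat.add_sub_cancel,
        Set.mem_sdiff, Set.mem_iUnion, Finset.mem_range, exists_prop, not_exists, not_and]
      exact ⟨Nat.find_spec h, fun i hi => Nat.find_min h hi⟩
    · exact ⟨0, by simpa [B] using h⟩

theorem IsBorel.iInter {A : ℕ → Set (𝔘.Star X)} (h : ∀ i, 𝔘.IsBorel (A i)) :
    𝔘.IsBorel (⋂ i, A i) := MeasurableSet.iInter (m := borelSpace 𝔘 X) h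

/-- The spreading map respects quotients, not distances. The two agree at points where a distance of
any source scale can be added without a carry past some higher scale, so the remaining points are
first moved within their classes. -/
theorem CountablySaturated.exists_borel_of_gaps (hsat : 𝔘.CountablySaturated) {α β : ℕ → 𝔘.HN}
    (hα : IsIncreasing α) (hβ : ∀ j, β j + (α (j + 1) - α j) + 𝔘.std 1 ≤ β (j + 1)) :
    ∃ ϑ : 𝔘.HN → 𝔘.HN, 𝔘.IsBorel (𝔘.graph ϑ) ∧ ∀ x x',
      (∃ n, hdist x x' < twoPow (α n)) ↔ ∃ n, hdist (ϑ x) (ϑ x') < twoPow (β n) := by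
  classical
  obtain ⟨t, ht⟩ := hsat.exists_spread (fun j => (hα j (j + 1) (by omega)).le) hβ
  -- At these points all digits between `α i` and every later `α j` are ones. Adding `2 ^ α i` turns
  -- them into zeros, after which the point is bad for no index.
  let Bad : ℕ → Set 𝔘.HN := fun i => ⋂ j, {x | Room (α (i + 1 + j)) (α i) x}ᶜ
  have hBad : ∀ i, 𝔘.IsBorel (Bad i) :=
    fun i => IsBorel.iInter fun j => (isInternal_room _ _).compl.isBorel
  have hbad : ∀ i x, x ∈ Bad i → ∀ j, i < j → ¬ Room (α j) (α i) x := by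
    intro i x hx j hij
    obtain ⟨k, rfl⟩ := Nat.exists_eq_add_of_lt hij
    have := Set.mem_iInter.1 hx k
    rwa [show i + 1 + k = i + k + 1 by omega] at this
  have hnbad : ∀ i x, x ∉ Bad i → ∃ j, i < j ∧ Room (α j) (α i) x := by
    intro i x hx
    simp only [Bad, Set.mem_iInter, not_forall, Set.mem_compl_iff, not_not] at hx
    obtain ⟨k, hk⟩ := hx
    exact ⟨_, by omega, hk⟩
  let ν : 𝔘.HN → 𝔘.HN := fun x => if h : ∃ i, x ∈ Bad i then x + twoPow (α (Nat.find h)) else x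
  let E : 𝔘.HN → 𝔘.HN → Prop := fun x x' => ∃ n, hdist x x' < twoPow (α n)
  have Esymm : ∀ x y, E x y → E y x := fun x y ⟨n, hn⟩ => ⟨n, by rwa [hdist_comm]⟩
  have Etrans : ∀ x y z, E x y → E y z → E x z := by
    rintro x y z ⟨n, hn⟩ ⟨m, hm⟩
    exact ⟨max n m + 1, near_trans
      (hn.trans_le (twoPow_le_twoPow.2 (hα.monotone (le_max_left n m))))
      (hm.trans_le (twoPow_le_twoPow.2 (hα.monotone (le_max_right n m)))) (hα _ _ (by omega))⟩
  have hν : ∀ x, E x (ν x) := by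
    intro x
    simp only [ν]
    split_ifs with h
    · refine ⟨Nat.find h + 1, ?_⟩
      have := hα (Nat.find h) (Nat.find h + 1) (by omega)
      generalize α (Nat.find h) = p at *
      generalize α (Nat.find h + 1) = q at *
      clear * - this
      obtain ⟨Ω, ω, x, p, q, rfl, rfl, rfl⟩ := rep₃ x p q
      simp only [twoPow_map, map_add_map, hdist_map, map_lt_map] at *
      filter_upwards [this] with w hw
      have := Nat.pow_lt_pow_right (a := 2) one_lt_two hw
      have : 0 < 2 ^ p w := by positivity
      rw [Nat.dist_lt_iff]
      omega
    · refine ⟨0, ?_⟩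
      generalize α 0 = p
      clear * -
      obtain ⟨Ω, ω, x, p, rfl, rfl⟩ := rep₂ x p
      simp [Nat.dist_self]
  have hνbad : ∀ x i, ν x ∉ Bad i := by
    intro x i hi
    simp only [ν] at hi
    split_ifs at hi with h
    · have h1 := hbad _ _ (Nat.find_spec h)
      set k := Nat.find h
      exact hbad i _ hi (max i k + 1) (by have := le_max_left i k; omega)
        (room_add_twoPow (hα _ _ (by have := le_max_right i k; omega))
          (hα _ _ (by have := le_max_left i k; omega))
          (h1 _ (by have := le_max_right i k; omega)))
    · exact h ⟨i, hi⟩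
  have hEq : ∀ x y, (∀ i, x ∉ Bad i) → (∀ i, y ∉ Bad i) →
      (E x y ↔ ∃ j, hquot x (α j) = hquot y (α j)) := by
    intro x y hx hy
    constructor
    · rintro ⟨n, hn⟩
      rcases le_total x y with hxy | hxy
      · obtain ⟨j, -, hj⟩ := hnbad n x (hx n)
        exact ⟨j, hj.hquot_eq hxy hn⟩
      · obtain ⟨j, -, hj⟩ := hnbad n y (hy n)
        exact ⟨j, (hj.hquot_eq hxy (by rwa [hdist_comm])).symm⟩
    · rintro ⟨j, hj⟩
      exact ⟨j, hdist_lt_of_hquot_eq hj⟩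
  refine ⟨fun x => app t (ν x), ?_, fun x x' => ?_⟩
  · convert isBorel_graph_first hBad t
      (fun i => 𝔘.map₂ (fun Θ a => fun x => Θ (x + 2 ^ a)) t (α i)) using 2
    funext x
    simp only [ν]
    split_ifs with h
    · generalize α (Nat.find h) = p
      clear * -
      obtain ⟨Ω, ω, x, p, t, rfl, rfl, rfl⟩ := rep₃ x p t
      simp
    · rfl
  · change E x x' ↔ _
    have h1 : E x x' ↔ E (ν x) (ν x') :=
      ⟨fun h => Etrans _ _ _ (Esymm _ _ (hν x)) (Etrans _ _ _ h (hν x')),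
        fun h => Etrans _ _ _ (hν x) (Etrans _ _ _ h (Esymm _ _ (hν x')))⟩
    rw [h1, hEq _ _ (hνbad x) (hνbad x')]
    exact exists_congr fun j => ht j _ _

/-- Here the harmful points lie just below a multiple of some `2 ^ α i`, at a distance negligible at
every scale. Rounding up to that multiple stays in the class and leaves a point that is bad for no
index. -/
theorem CountablySaturated.exists_borel_of_gaps_decreasing (hsat : 𝔘.CountablySaturated)
    {α β : ℕ → 𝔘.HN} (hα : IsDecreasing α)
    (hβ : ∀ j, β (j + 1) + (α j - α (j + 1)) + 𝔘.std 1 ≤ β j) :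
    ∃ ϑ : 𝔘.HN → 𝔘.HN, 𝔘.IsBorel (𝔘.graph ϑ) ∧ ∀ x x',
      (∀ n, hdist x x' < twoPow (α n)) ↔ ∀ n, hdist (ϑ x) (ϑ x') < twoPow (β n) := by
  classical
  obtain ⟨t, ht⟩ := hsat.exists_spread_decreasing (fun j => (hα j (j + 1) (by omega)).le) hβ
  let Bad : ℕ → Set 𝔘.HN := fun i => ⋂ j, {x | Room (α i) (α (i + 1 + j)) x}ᶜ
  have hBad : ∀ i, 𝔘.IsBorel (Bad i) :=
    fun i => IsBorel.iInter fun j => (isInternal_room _ _).compl.isBorel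
  have hbad : ∀ i x, x ∈ Bad i → ∀ j, i < j → ¬ Room (α i) (α j) x := by
    intro i x hx j hij
    obtain ⟨k, rfl⟩ := Nat.exists_eq_add_of_lt hij
    have := Set.mem_iInter.1 hx k
    rwa [show i + 1 + k = i + k + 1 by omega] at this
  have hnbad : ∀ i x, x ∉ Bad i → ∃ j, i < j ∧ Room (α i) (α j) x := by
    intro i x hx
    simp only [Bad, Set.mem_iInter, not_forall, Set.mem_compl_iff, not_not] at hx
    obtain ⟨k, hk⟩ := hx
    exact ⟨_, by omega, hk⟩
  let ν : 𝔘.HN → 𝔘.HN := fun x => if h : ∃ i, x ∈ Bad i then roundUp (α (Nat.find h)) x else x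
  let E : 𝔘.HN → 𝔘.HN → Prop := fun x x' => ∀ n, hdist x x' < twoPow (α n)
  have Esymm : ∀ x y, E x y → E y x := fun x y h n => by rw [hdist_comm]; exact h n
  have Etrans : ∀ x y z, E x y → E y z → E x z := fun x y z h h' n =>
    near_trans (h (n + 1)) (h' (n + 1)) (hα n (n + 1) (by omega))
  have hν : ∀ x, E x (ν x) := by
    intro x n
    simp only [ν]
    split_ifs with h
    · have h1 := hbad _ _ (Nat.find_spec h)
      set k := Nat.find h
      exact hdist_roundUp_lt (h1 (max n k + 1) (by have := le_max_right n k; omega))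
        (hα n (max n k + 1) (by have := le_max_left n k; omega))
    · generalize α n = p
      clear * -
      obtain ⟨Ω, ω, x, p, rfl, rfl⟩ := rep₂ x p
      simp [Nat.dist_self]
  have hνbad : ∀ x i, ν x ∉ Bad i := by
    intro x i hi
    simp only [ν] at hi
    split_ifs at hi with h
    · set k := Nat.find h
      exact hbad i _ hi (max i k + 1) (by have := le_max_left i k; omega)
        (room_roundUp (hα _ _ (by have := le_max_left i k; omega))
          fun _ => hα _ _ (by have := le_max_right i k; omega))
    · exact h ⟨i, hi⟩
  have hEq : ∀ x y, (∀ i, x ∉ Bad i) → (∀ i, y ∉ Bad i) →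
      (E x y ↔ ∀ j, hquot x (α j) = hquot y (α j)) := by
    intro x y hx hy
    constructor
    · intro hE n
      rcases le_total x y with hxy | hxy
      · obtain ⟨j, -, hj⟩ := hnbad n x (hx n)
        exact hj.hquot_eq hxy (hE j)
      · obtain ⟨j, -, hj⟩ := hnbad n y (hy n)
        exact (hj.hquot_eq hxy (by rw [hdist_comm]; exact hE j)).symm
    · exact fun h j => hdist_lt_of_hquot_eq (h j)
  refine ⟨fun x => app t (ν x), ?_, fun x x' => ?_⟩
  · convert isBorel_graph_first hBad t
      (fun i => 𝔘.map₂ (fun Θ a => fun x => Θ ((x / 2 ^ a + 1) * 2 ^ a)) t (α i)) using 2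
    funext x
    simp only [ν]
    split_ifs with h
    · generalize α (Nat.find h) = p
      clear * -
      obtain ⟨Ω, ω, x, p, t, rfl, rfl, rfl⟩ := rep₃ x p t
      simp
    · rfl
  · change E x x' ↔ _
    have h1 : E x x' ↔ E (ν x) (ν x') :=
      ⟨fun h => Etrans _ _ _ (Esymm _ _ (hν x)) (Etrans _ _ _ h (hν x')),
        fun h => Etrans _ _ _ (hν x) (Etrans _ _ _ h (Esymm _ _ (hν x')))⟩
    rw [h1, hEq _ _ (hνbad x) (hνbad x')]
    exact forall_congr' fun j => ht j _ _

/-- A recursion thins out `a` and replaces `b` by an interleaved sequence, so that each single step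
of the target exceeds the corresponding step of the source. -/
theorem CountablySaturated.exists_borel_of_growth (hsat : 𝔘.CountablySaturated)
    {a b : ℕ → 𝔘.HN} (ha : IsIncreasing a) (hb : IsIncreasing b)
    (hQ : ∀ k, ∃ n, ∀ n' > n, ∃ k' > k, a n' - a n ≤ b k' - b k) :
    ∃ ϑ : 𝔘.HN → 𝔘.HN, 𝔘.IsBorel (𝔘.graph ϑ) ∧ ∀ x x',
      (∃ n, hdist x x' < twoPow (a n)) ↔ ∃ n, hdist (ϑ x) (ϑ x') < twoPow (b n) := by
  -- The invariant says that the growth of `a` beyond `p.1` is still available for `b` beyond `p.2`.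
  let S := {p : 𝔘.HN × 𝔘.HN // (∀ n, ∃ k, a n + p.2 ≤ b k + p.1) ∧ ∃ n, p.1 ≤ a n}
  have step : ∀ (i : ℕ) (p : S), ∃ p' : S, p.1.1 < p'.1.1 ∧
      p.1.2 + (p'.1.1 - p.1.1) + 𝔘.std 1 ≤ p'.1.2 ∧ a i ≤ p'.1.1 ∧ b i ≤ p'.1.2 := by
    rintro i ⟨⟨α, β⟩, hI, n₀, hn₀⟩
    obtain ⟨n, hn⟩ := hQ i
    set N := max (max n n₀) i + 1 with hN
    have hNn : n < N := by have := le_max_left n n₀; have := le_max_left (max n n₀) i; omega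
    have hNn₀ : n₀ < N := by have := le_max_right n n₀; have := le_max_left (max n n₀) i; omega
    have hNi : i < N := by have := le_max_right (max n n₀) i; omega
    have hαN : α < a N := hn₀.trans_lt (ha _ _ hNn₀)
    -- The maximum makes room for the block and passes `b i`. If the block term is larger, the old
    -- invariant persists; if `b i` is larger, the growth condition at `i` applies. Looking at `M >
    -- m` pays for the added `1`.
    refine ⟨⟨(a N, max (b i) (β + (a N - α)) + 𝔘.std 1), fun m => ?_, N, le_rfl⟩, hαN, ?_,
      (ha _ _ hNi).le, ?_⟩
    · set M := max m N + 1 with hM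
      have hmM : a m < a M := ha _ _ (by have := le_max_left m N; omega)
      have hNM : a N < a M := ha _ _ (by have := le_max_right m N; omega)
      rcases le_total (b i) (β + (a N - α)) with hle | hle
      · rw [max_eq_right hle]
        obtain ⟨k', hk'⟩ := hI M
        refine ⟨k', ?_⟩
        dsimp only at hk' ⊢
        clear * - hk' hmM hαN
        generalize a m = am at *
        generalize a M = aM at *
        generalize a N = aN at *
        generalize b k' = bk at *
        obtain ⟨Ω, ω, am, aM, aN, bk, α, β, rfl, rfl, rfl, rfl, rfl, rfl⟩ := rep₆ am aM aN bk α β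
        simp only [std_eq ω, map_add_map, map_sub_map, map_le_map, map_lt_map] at *
        filter_upwards [hk', hmM, hαN] with w h1 h2 h3
        omega
      · rw [max_eq_left hle]
        obtain ⟨k', hk', hd⟩ := hn M (by have := le_max_right m N; omega)
        refine ⟨k', ?_⟩
        have h1 := ha _ _ hNn
        have h2 := hb _ _ hk'
        dsimp only
        clear * - h1 h2 hd hmM hNM
        generalize a m = am at *
        generalize a M = aM at *
        generalize a N = aN at *
        generalize a n = an at *
        generalize b k' = bk at *
        generalize b i = bi at *
        obtain ⟨Ω, ω, am, aM, aN, an, bk, bi, rfl, rfl, rfl, rfl, rfl, rfl⟩ :=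
          rep₆ am aM aN an bk bi
        simp only [std_eq ω, map_add_map, map_sub_map, map_le_map, map_lt_map] at *
        filter_upwards [h1, h2, hd, hmM, hNM] with w h1 h2 h3 h4 h5
        omega
    · have := le_max_right (b i) (β + (a N - α))
      rw [← lt_add_one_iff, ← add_one_le_iff] at this
      exact this
    · have := le_max_left (b i) (β + (a N - α))
      rw [← lt_add_one_iff] at this
      exact this.le
  obtain ⟨n₀, hn₀⟩ := hQ 0
  have hstart : ∀ m, ∃ k, a m + b 0 ≤ b k + a n₀ := by
    intro m
    rcases le_or_gt m n₀ with hm | hm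
    · refine ⟨0, ?_⟩
      have h1 := ha.monotone hm
      generalize a m = am at *
      generalize a n₀ = an at *
      generalize b 0 = bk at *
      clear * - h1
      obtain ⟨Ω, ω, am, an, bk, rfl, rfl, rfl⟩ := rep₃ am an bk
      simp only [map_add_map, map_le_map] at *
      filter_upwards [h1] with w h1
      omega
    · obtain ⟨k', hk', hd⟩ := hn₀ m hm
      refine ⟨k', ?_⟩
      have h1 := ha _ _ hm
      have h2 := hb _ _ hk'
      clear * - h1 h2 hd
      generalize a m = am at *
      generalize a n₀ = an at *
      generalize b 0 = b0 at *
      generalize b k' = bk at *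
      obtain ⟨Ω, ω, am, an, b0, bk, rfl, rfl, rfl, rfl⟩ := rep₄ am an b0 bk
      simp only [map_add_map, map_sub_map, map_le_map, map_lt_map] at *
      filter_upwards [h1, h2, hd] with w h1 h2 h3
      omega
  choose nxt hnxt using step
  let s : ℕ → S := fun i => Nat.rec ⟨(a n₀, b 0), hstart, n₀, le_rfl⟩ nxt i
  have hs : ∀ i, s (i + 1) = nxt i (s i) := fun i => rfl
  have hα : IsIncreasing fun i => (s i).1.1 := by
    have : StrictMono fun i => (s i).1.1 := strictMono_nat_of_lt_succ fun i => by
      rw [hs]; exact (hnxt i (s i)).1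
    exact fun m n hmn => this hmn
  obtain ⟨ϑ, h1, h2⟩ := hsat.exists_borel_of_gaps (α := fun i => (s i).1.1)
    (β := fun i => (s i).1.2) hα (fun j => by simp only [hs]; exact (hnxt j (s j)).2.1)
  refine ⟨ϑ, h1, fun x x' => ?_⟩
  have e1 : (∃ n, hdist x x' < twoPow (a n)) ↔ ∃ n, hdist x x' < twoPow (s n).1.1 := by
    constructor
    · rintro ⟨n, hn⟩
      refine ⟨n + 1, hn.trans_le (twoPow_le_twoPow.2 ?_)⟩
      rw [hs]; exact (hnxt n (s n)).2.2.1
    · rintro ⟨n, hn⟩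
      obtain ⟨m, hm⟩ := (s n).2.2
      exact ⟨m, hn.trans_le (twoPow_le_twoPow.2 hm)⟩
  have e2 : ∀ y y' : 𝔘.HN, (∃ n, hdist y y' < twoPow (b n)) ↔
      ∃ n, hdist y y' < twoPow (s n).1.2 := by
    intro y y'
    constructor
    · rintro ⟨n, hn⟩
      refine ⟨n + 1, hn.trans_le (twoPow_le_twoPow.2 ?_)⟩
      rw [hs]; exact (hnxt n (s n)).2.2.2
    · rintro ⟨n, hn⟩
      obtain ⟨m, hm⟩ := (s n).2.2
      obtain ⟨k, hk⟩ := (s n).2.1 m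
      refine ⟨k, hn.trans_le (twoPow_le_twoPow.2 ?_)⟩
      generalize (s n).1.1 = α at *
      generalize (s n).1.2 = β at *
      generalize a m = am at *
      generalize b k = bk at *
      clear * - hm hk
      obtain ⟨Ω, ω, am, α, β, bk, rfl, rfl, rfl, rfl⟩ := rep₄ am α β bk
      simp only [map_add_map, map_le_map] at *
      filter_upwards [hm, hk] with w h1 h2
      omega
  rw [e1, e2, h2 x x']

theorem IsDecreasing.pos {b : ℕ → 𝔘.HN} (hb : IsDecreasing b) (k : ℕ) : 𝔘.std 1 ≤ b k := by
  have h1 := hb k (k + 1) (by omega)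
  have h2 := zero_le_hn (b (k + 1))
  generalize b (k + 1) = y at *
  generalize b k = x at *
  obtain ⟨Ω, ω, x, y, rfl, rfl⟩ := rep₂ x y
  simp only [std_eq ω, map_le_map, map_lt_map] at *
  filter_upwards [h1] with w h1
  omega

theorem CountablySaturated.exists_borel_of_growth_decreasing (hsat : 𝔘.CountablySaturated)
    {a b : ℕ → 𝔘.HN} (ha : IsDecreasing a) (hb : IsDecreasing b)
    (hQ : ∀ k, ∃ n, ∀ n' > n, ∃ k' > k, a n - a n' ≤ b k - b k') :
    ∃ ϑ : 𝔘.HN → 𝔘.HN, 𝔘.IsBorel (𝔘.graph ϑ) ∧ ∀ x x',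
      (∀ n, hdist x x' < twoPow (a n)) ↔ ∀ n, hdist (ϑ x) (ϑ x') < twoPow (b n) := by
  let S := {p : 𝔘.HN × 𝔘.HN // (∀ n, ∃ k, p.1 + b k ≤ p.2 + a n) ∧ ∃ n, a n ≤ p.1}
  have step : ∀ (i : ℕ) (p : S), ∃ p' : S, p'.1.1 < p.1.1 ∧
      p'.1.2 + (p.1.1 - p'.1.1) + 𝔘.std 1 ≤ p.1.2 ∧ p'.1.1 ≤ a i ∧ p'.1.2 ≤ b i := by
    rintro i ⟨⟨α, β⟩, hI, n₀, hn₀⟩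
    obtain ⟨n, hn⟩ := hQ i
    set N := max (max n n₀) i + 1 with hN
    have hNn : n < N := by have := le_max_left n n₀; have := le_max_left (max n n₀) i; omega
    have hNn₀ : n₀ < N := by have := le_max_right n n₀; have := le_max_left (max n n₀) i; omega
    have hNi : i < N := by have := le_max_right (max n n₀) i; omega
    have hαN : a N < α := (ha _ _ hNn₀).trans_le hn₀
    -- Subtraction is truncated, so the room below `β` has to be secured before descending.
    have hpos : (α - a N) + 𝔘.std 1 ≤ β := by
      obtain ⟨k, hk⟩ := hI N
      have h1 := hb.pos k
      dsimp only at hk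
      clear * - hk h1 hαN
      generalize a N = aN at *
      generalize b k = bk at *
      obtain ⟨Ω, ω, aN, α, β, bk, rfl, rfl, rfl, rfl⟩ := rep₄ aN α β bk
      simp only [std_eq ω, map_add_map, map_sub_map, map_le_map, map_lt_map] at *
      filter_upwards [hk, h1, hαN] with w h1 h2 h3
      omega
    have hbi := hb.pos i
    refine ⟨⟨(a N, min (b i) (β - (α - a N)) - 𝔘.std 1), fun m => ?_, N, le_rfl⟩, hαN, ?_,
      (ha _ _ hNi).le, ?_⟩
    · set M := max m N + 1 with hM
      have hmM : a M < a m := ha _ _ (by have := le_max_left m N; omega)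
      have hNM : a M < a N := ha _ _ (by have := le_max_right m N; omega)
      rcases le_total (b i) (β - (α - a N)) with hle | hle
      · rw [min_eq_left hle]
        obtain ⟨k', hk', hd⟩ := hn M (by have := le_max_right m N; omega)
        refine ⟨k', ?_⟩
        have h1 := ha _ _ hNn
        have h2 := hb _ _ hk'
        dsimp only
        clear * - h1 h2 hd hmM hNM hbi
        generalize a m = am at *
        generalize a M = aM at *
        generalize a N = aN at *
        generalize a n = an at *
        generalize b k' = bk at *
        generalize b i = bi at *
        obtain ⟨Ω, ω, am, aM, aN, an, bk, bi, rfl, rfl, rfl, rfl, rfl, rfl⟩ :=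
          rep₆ am aM aN an bk bi
        simp only [std_eq ω, map_add_map, map_sub_map, map_le_map, map_lt_map] at *
        filter_upwards [h1, h2, hd, hmM, hNM, hbi] with w h1 h2 h3 h4 h5 h6
        omega
      · rw [min_eq_right hle]
        obtain ⟨k', hk'⟩ := hI M
        refine ⟨k', ?_⟩
        dsimp only at hk' ⊢
        clear * - hk' hmM hαN hpos
        generalize a m = am at *
        generalize a M = aM at *
        generalize a N = aN at *
        generalize b k' = bk at *
        obtain ⟨Ω, ω, am, aM, aN, bk, α, β, rfl, rfl, rfl, rfl, rfl, rfl⟩ := rep₆ am aM aN bk α β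
        simp only [std_eq ω, map_add_map, map_sub_map, map_le_map, map_lt_map] at *
        filter_upwards [hk', hmM, hαN, hpos] with w h1 h2 h3 h4
        omega
    · have := min_le_right (b i) (β - (α - a N))
      dsimp only
      generalize min (b i) (β - (α - a N)) = μ at *
      clear * - this hpos
      generalize a N = aN at *
      obtain ⟨Ω, ω, aN, α, β, μ, rfl, rfl, rfl, rfl⟩ := rep₄ aN α β μ
      simp only [std_eq ω, map_add_map, map_sub_map, map_le_map] at *
      filter_upwards [this, hpos] with w h1 h2
      omega
    · have := min_le_left (b i) (β - (α - a N))
      dsimp only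
      generalize min (b i) (β - (α - a N)) = μ at *
      clear * - this
      generalize b i = bi at *
      obtain ⟨Ω, ω, bi, μ, rfl, rfl⟩ := rep₂ bi μ
      simp only [std_eq ω, map_sub_map, map_le_map] at *
      filter_upwards [this] with w h1
      omega
  obtain ⟨n₀, hn₀⟩ := hQ 0
  have hstart : ∀ m, ∃ k, a n₀ + b k ≤ b 0 + a m := by
    intro m
    rcases le_or_gt m n₀ with hm | hm
    · refine ⟨0, ?_⟩
      have h1 := ha.antitone hm
      generalize a m = am at *
      generalize a n₀ = an at *
      generalize b 0 = bk at *
      clear * - h1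
      obtain ⟨Ω, ω, am, an, bk, rfl, rfl, rfl⟩ := rep₃ am an bk
      simp only [map_add_map, map_le_map] at *
      filter_upwards [h1] with w h1
      omega
    · obtain ⟨k', hk', hd⟩ := hn₀ m hm
      refine ⟨k', ?_⟩
      have h1 := ha _ _ hm
      have h2 := hb _ _ hk'
      clear * - h1 h2 hd
      generalize a m = am at *
      generalize a n₀ = an at *
      generalize b 0 = b0 at *
      generalize b k' = bk at *
      obtain ⟨Ω, ω, am, an, b0, bk, rfl, rfl, rfl, rfl⟩ := rep₄ am an b0 bk
      simp only [map_add_map, map_sub_map, map_le_map, map_lt_map] at *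
      filter_upwards [h1, h2, hd] with w h1 h2 h3
      omega
  choose nxt hnxt using step
  let s : ℕ → S := fun i => Nat.rec ⟨(a n₀, b 0), hstart, n₀, le_rfl⟩ nxt i
  have hs : ∀ i, s (i + 1) = nxt i (s i) := fun i => rfl
  have hα : IsDecreasing fun i => (s i).1.1 := by
    have : StrictAnti fun i => (s i).1.1 := strictAnti_nat_of_succ_lt fun i => by
      rw [hs]; exact (hnxt i (s i)).1
    exact fun m n hmn => this hmn
  obtain ⟨ϑ, h1, h2⟩ := hsat.exists_borel_of_gaps_decreasing (α := fun i => (s i).1.1)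
    (β := fun i => (s i).1.2) hα (fun j => by simp only [hs]; exact (hnxt j (s j)).2.1)
  refine ⟨ϑ, h1, fun x x' => ?_⟩
  have e1 : (∀ n, hdist x x' < twoPow (a n)) ↔ ∀ n, hdist x x' < twoPow (s n).1.1 := by
    constructor
    · intro h n
      obtain ⟨m, hm⟩ := (s n).2.2
      exact (h m).trans_le (twoPow_le_twoPow.2 hm)
    · intro h n
      refine (h (n + 1)).trans_le (twoPow_le_twoPow.2 ?_)
      rw [hs]; exact (hnxt n (s n)).2.2.1
  have e2 : ∀ y y' : 𝔘.HN, (∀ n, hdist y y' < twoPow (b n)) ↔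
      ∀ n, hdist y y' < twoPow (s n).1.2 := by
    intro y y'
    constructor
    · intro h n
      obtain ⟨m, hm⟩ := (s n).2.2
      obtain ⟨k, hk⟩ := (s n).2.1 m
      refine (h k).trans_le (twoPow_le_twoPow.2 ?_)
      generalize (s n).1.1 = α at *
      generalize (s n).1.2 = β at *
      generalize a m = am at *
      generalize b k = bk at *
      clear * - hm hk
      obtain ⟨Ω, ω, am, α, β, bk, rfl, rfl, rfl, rfl⟩ := rep₄ am α β bk
      simp only [map_add_map, map_le_map] at *
      filter_upwards [hm, hk] with w h1 h2
      omega
    · intro h n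
      refine (h (n + 1)).trans_le (twoPow_le_twoPow.2 ?_)
      rw [hs]; exact (hnxt n (s n)).2.2.2
  rw [e1, e2, h2]

/-! ### Cuts -/

theorem mem_iUnion_below {a : ℕ → 𝔘.HN} {x : 𝔘.HN} :
    x ∈ (⋃ n, below (twoPow (a n))) ↔ ∃ n, x < twoPow (a n) := by
  simp [below]

theorem mem_iInter_below {a : ℕ → 𝔘.HN} {x : 𝔘.HN} :
    x ∈ (⋂ n, below (twoPow (a n))) ↔ ∀ n, x < twoPow (a n) := by
  simp [below]

theorem monadic_iUnion {a : ℕ → 𝔘.HN} {x y : 𝔘.HN} :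
    monadic (⋃ n, below (twoPow (a n))) x y ↔ ∃ n, hdist x y < twoPow (a n) := mem_iUnion_below

theorem monadic_iInter {a : ℕ → 𝔘.HN} {x y : 𝔘.HN} :
    monadic (⋂ n, below (twoPow (a n))) x y ↔ ∀ n, hdist x y < twoPow (a n) := mem_iInter_below

theorem diag_iff {x y : 𝔘.HN} : 𝔘.diag x y ↔ hdist x y < 𝔘.std 1 := hdist_lt_one_iff.symm

theorem lt_twoPow_self (x : 𝔘.HN) : x < twoPow x := by
  rw [← rep₁ x]
  simp [Nat.lt_two_pow_self]

/-- The integer part of the binary logarithm. -/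
theorem exists_twoPow_le_lt {x : 𝔘.HN} (hx : 𝔘.std 1 ≤ x) :
    ∃ l, twoPow l ≤ x ∧ x < twoPow (l + 𝔘.std 1) := by
  refine ⟨𝔘.map Nat.log2 x, ?_⟩
  rw [← rep₁ x, std_eq x] at hx ⊢
  simp only [map_map, twoPow_map, map_le_map, map_lt_map, map_add_map] at *
  refine ⟨hx.mono fun w hw => ?_, hx.mono fun w hw => ?_⟩
  · exact Nat.log2_self_le (by omega)
  · exact Nat.lt_log2_self

/-- Running maxima, increased by one, turn any sequence in `S` into a strictly increasing one that
dominates it. -/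
theorem exists_increasing {S : Set 𝔘.HN} (hS : ∀ x ∈ S, x + 𝔘.std 1 ∈ S) {f : ℕ → 𝔘.HN}
    (hf : ∀ n, f n ∈ S) : ∃ a : ℕ → 𝔘.HN, IsIncreasing a ∧ (∀ n, a n ∈ S) ∧ ∀ n, f n ≤ a n := by
  let a : ℕ → 𝔘.HN := fun n => Nat.rec (f 0) (fun n x => max x (f (n + 1)) + 𝔘.std 1) n
  have ha : ∀ n, a (n + 1) = max (a n) (f (n + 1)) + 𝔘.std 1 := fun n => rfl
  have hlt : ∀ x y : 𝔘.HN, x ≤ y → x < y + 𝔘.std 1 := fun x y => lt_add_one_iff.2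
  refine ⟨a, ?_, fun n => ?_, fun n => ?_⟩
  · have : StrictMono a := strictMono_nat_of_lt_succ fun n => by
      rw [ha]; exact hlt _ _ (le_max_left _ _)
    exact fun m n h => this h
  · induction n with
    | zero => exact hf 0
    | succ n ih =>
      rw [ha]
      refine hS _ ?_
      rcases max_choice (a n) (f (n + 1)) with h | h <;> rw [h]
      · exact ih
      · exact hf _
  · cases n with
    | zero => exact le_rfl
    | succ n => rw [ha]; exact (hlt _ _ (le_max_right _ _)).le

theorem exists_decreasing {S : Set 𝔘.HN} (hS : ∀ x ∈ S, x - 𝔘.std 1 ∈ S)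
    (hS0 : ∀ x ∈ S, 𝔘.std 1 ≤ x) {f : ℕ → 𝔘.HN}
    (hf : ∀ n, f n ∈ S) : ∃ a : ℕ → 𝔘.HN, IsDecreasing a ∧ (∀ n, a n ∈ S) ∧ ∀ n, a n ≤ f n := by
  let a : ℕ → 𝔘.HN := fun n => Nat.rec (f 0) (fun n x => min x (f (n + 1)) - 𝔘.std 1) n
  have ha : ∀ n, a (n + 1) = min (a n) (f (n + 1)) - 𝔘.std 1 := fun n => rfl
  have hlt : ∀ x y : 𝔘.HN, 𝔘.std 1 ≤ x → x ≤ y → x - 𝔘.std 1 < y := by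
    intro x y hx hxy
    obtain ⟨Ω, ω, x, y, rfl, rfl⟩ := rep₂ x y
    simp only [std_eq ω, map_sub_map, map_lt_map, map_le_map] at *
    filter_upwards [hx, hxy] with w h1 h2
    omega
  have hmin : ∀ n, a n ∈ S → min (a n) (f (n + 1)) ∈ S := by
    intro n hn
    rcases min_choice (a n) (f (n + 1)) with h | h <;> rw [h]
    · exact hn
    · exact hf _
  have hmem : ∀ n, a n ∈ S := by
    intro n
    induction n with
    | zero => exact hf 0
    | succ n ih => rw [ha]; exact hS _ (hmin n ih)
  refine ⟨a, ?_, hmem, fun n => ?_⟩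
  · have : StrictAnti a := strictAnti_nat_of_succ_lt fun n => by
      rw [ha]; exact hlt _ _ (hS0 _ (hmin n (hmem n))) (min_le_left _ _)
    exact fun m n h => this h
  · cases n with
    | zero => exact le_rfl
    | succ n => rw [ha]; exact (hlt _ _ (hS0 _ (hmin n (hmem n))) (min_le_right _ _)).le

theorem IsAdditiveCut.twoPow_add_one_mem {U : Set 𝔘.HN} (hU : IsAdditiveCut U) {x : 𝔘.HN}
    (hx : twoPow x ∈ U) : twoPow (x + 𝔘.std 1) ∈ U := by
  rw [twoPow_add_one]
  exact hU.2 _ _ hx hx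

/-- Closure under doubling keeps the rounded-up logarithms of the bounds inside the cut. -/
theorem IsAdditiveCut.exists_increasing {U : Set 𝔘.HN} (hU : IsAdditiveCut U)
    (hc : IsCountablyCofinal U) :
    ∃ a : ℕ → 𝔘.HN, IsIncreasing a ∧ U = ⋃ n, below (twoPow (a n)) := by
  obtain ⟨u, hu, rfl⟩ := hc
  have hmem : ∀ n, u n ∈ ⋃ n, below (u n) :=
    fun n => Set.mem_iUnion.2 ⟨n + 1, hu n (n + 1) (by omega)⟩
  have hpos : ∀ n, 𝔘.std 1 ≤ u (n + 1) := by
    intro n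
    have h1 := hu n (n + 1) (by omega)
    have h2 := zero_le_hn (u n)
    have h3 := h2.trans_lt h1
    rw [← add_one_le_iff, std_add_std] at h3
    exact h3
  -- The index is shifted because `u 0` may be zero and have no logarithm.
  choose l hl hl' using fun n => exists_twoPow_le_lt (hpos n)
  obtain ⟨a, ha, haS, hfa⟩ := NonstandardUniverse.exists_increasing
    (S := {x | twoPow x ∈ ⋃ n, below (u n)}) (fun x hx => hU.twoPow_add_one_mem hx)
    (f := fun n => l n + 𝔘.std 1)
    (fun n => hU.twoPow_add_one_mem (hU.1 _ _ (hl n) (hmem _)))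
  refine ⟨a, ha, Set.Subset.antisymm (fun x hx => ?_) (fun x hx => ?_)⟩
  · obtain ⟨n, hn⟩ := Set.mem_iUnion.1 hx
    refine mem_iUnion_below.2 ⟨n, ?_⟩
    exact lt_trans (lt_trans hn (hu n (n + 1) (by omega)))
      ((hl' n).trans_le (twoPow_le_twoPow.2 (hfa n)))
  · obtain ⟨n, hn⟩ := mem_iUnion_below.1 hx
    exact hU.1 _ _ hn.le (haS n)

theorem IsCountablyCoinitial.one_mem {U : Set 𝔘.HN} (hc : IsCountablyCoinitial U) :
    𝔘.std 1 ∈ U := by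
  obtain ⟨u, hu, rfl⟩ := hc
  refine Set.mem_iInter.2 fun n => ?_
  exact (hu.pos (n + 1)).trans_lt (hu n (n + 1) (by omega))

/-- The exponents whose powers lie outside the cut are closed under subtracting one: if half of a
power were in the cut, so would be the power. -/
theorem IsAdditiveCut.exists_decreasing {U : Set 𝔘.HN} (hU : IsAdditiveCut U)
    (hc : IsCountablyCoinitial U) :
    ∃ a : ℕ → 𝔘.HN, IsDecreasing a ∧ U = ⋂ n, below (twoPow (a n)) := by
  have h1U := hc.one_mem
  obtain ⟨u, hu, rfl⟩ := hc
  have hmem : ∀ n, u n ∉ ⋂ n, below (u n) := fun n h => lt_irrefl (u n) (Set.mem_iInter.1 h n)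
  choose l hl hl' using fun n => exists_twoPow_le_lt (hu.pos n)
  have hS0 : ∀ x : 𝔘.HN, twoPow x ∉ ⋂ n, below (u n) → 𝔘.std 1 ≤ x := by
    intro x hx
    by_contra hn
    refine hx (hU.1 _ _ ?_ h1U)
    rw [not_le] at hn
    clear * - hn
    rw [← rep₁ x, std_eq x] at *
    simp only [map_lt_map, twoPow_map, map_le_map] at *
    filter_upwards [hn] with w hw
    obtain rfl : w = 0 := by omega
    simp
  have hS1 : ∀ x : 𝔘.HN, twoPow x ∉ ⋂ n, below (u n) → twoPow (x - 𝔘.std 1) ∉ ⋂ n, below (u n) := by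
    intro x hx hn
    refine hx ?_
    have := hU.twoPow_add_one_mem hn
    convert this using 2
    have h0 := hS0 x hx
    clear * - h0
    rw [← rep₁ x, std_eq x] at *
    simp only [map_le_map, map_sub_map, map_add_map, map_eq_map_iff] at *
    filter_upwards [h0] with w hw
    omega
  obtain ⟨a, ha, haS, hfa⟩ := NonstandardUniverse.exists_decreasing
    (S := {x | twoPow x ∉ ⋂ n, below (u n)}) (fun x hx => hS1 x hx) (fun x hx => hS0 x hx)
    (f := l) (fun n hn => hmem n (hU.1 _ _ (hl' n).le (hU.twoPow_add_one_mem hn)))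
  refine ⟨a, ha, Set.Subset.antisymm (fun x hx => ?_) (fun x hx => ?_)⟩
  · refine mem_iInter_below.2 fun n => lt_of_not_ge fun hle => haS n (hU.1 _ _ hle hx)
  · refine Set.mem_iInter.2 fun n => ?_
    exact (mem_iInter_below.1 hx n).trans_le ((twoPow_le_twoPow.2 (hfa n)).trans (hl n))

/-- A cut is not both countably cofinal and countably coinitial. -/
theorem CountablySaturated.not_cofinal_and_coinitial (hsat : 𝔘.CountablySaturated)
    {U : Set 𝔘.HN} (h1 : IsCountablyCofinal U) (h2 : IsCountablyCoinitial U) : False := by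
  obtain ⟨a, ha, rfl⟩ := h1
  obtain ⟨b, hb, hab⟩ := h2
  have hle : ∀ m n, a m < b n := by
    intro m n
    have : a m ∈ ⋃ n, below (a n) := Set.mem_iUnion.2 ⟨m + 1, ha m (m + 1) (by omega)⟩
    rw [hab] at this
    exact Set.mem_iInter.1 this n
  -- Saturation puts an element into the gap between the two sequences, and it would have to lie
  -- both inside and outside the cut.
  obtain ⟨x, hx⟩ := hsat.exists_forall (fun n => {x | 𝔘.rel (fun (x : ℕ) (p : ℕ × ℕ) =>
      p.1 ≤ x ∧ x < p.2) x (𝔘.pair (a n) (b n))}) (fun n => isInternal_rel _ _) (fun N => by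
    refine ⟨a N, fun n hn => ?_⟩
    have h1 := ha.monotone hn
    have h2 := hle N n
    generalize a N = x at *
    generalize a n = y at *
    generalize b n = z at *
    clear * - h1 h2
    obtain ⟨Ω, ω, x, y, z, rfl, rfl, rfl⟩ := rep₃ x y z
    simp only [pair_map, Set.mem_ofPred_eq, rel_map, map_le_map, map_lt_map] at *
    exact h1.and h2)
  have hx' : ∀ n, a n ≤ x ∧ x < b n := by
    intro n
    have h := hx n
    generalize a n = y at *
    generalize b n = z at *
    clear * - h
    obtain ⟨Ω, ω, x, y, z, rfl, rfl, rfl⟩ := rep₃ x y z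
    simp only [pair_map, Set.mem_ofPred_eq, rel_map, map_le_map, map_lt_map] at *
    exact ⟨h.mono fun w hw => hw.1, h.mono fun w hw => hw.2⟩
  have : x ∈ ⋃ n, below (a n) := by
    rw [hab]; exact Set.mem_iInter.2 fun n => (hx' n).2
  obtain ⟨n, hn⟩ := Set.mem_iUnion.1 this
  exact absurd hn (not_lt.2 (hx' n).1)

/-! ### Slow cuts and infinite gaps of exponents -/

theorem IsInfinite.std_le {c : 𝔘.HN} (hc : IsInfinite c) (n : ℕ) : 𝔘.std n ≤ c := by
  by_contra hn
  rw [not_le] at hn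
  have h1 : ∀ i, ∀ᶠ w in (filt c : Filter ℕ), w ≠ i := by
    intro i
    have := hc i
    rw [← rep₁ c, std_eq c, ne_eq, map_eq_map_iff, ← eventually_filt_not] at this
    exact this
  have h2 : ∀ᶠ w in (filt c : Filter ℕ), w < n := by
    rw [← rep₁ c, std_eq c, map_lt_map] at hn
    exact hn
  have h3 := (Filter.eventually_all_finset (Finset.range n)).2 fun i _ => h1 i
  obtain ⟨w, h4, h5⟩ := (h2.and h3).exists
  exact h5 w (Finset.mem_range.2 h4) rfl

theorem isInfinite_of_std_le {c : 𝔘.HN} (hc : ∀ n, 𝔘.std n ≤ c) : IsInfinite c := by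
  intro n hn
  have := hc (n + 1)
  rw [hn, std_le_std] at this
  omega

theorem IsCountablyCofinal.one_mem {U : Set 𝔘.HN} (h : IsCountablyCofinal U) : 𝔘.std 1 ∈ U := by
  obtain ⟨a, ha, rfl⟩ := h
  refine Set.mem_iUnion.2 ⟨2, ?_⟩
  have h1 := ha.add_le 0 2
  have h2 : 𝔘.std 2 ≤ a 0 + 𝔘.std 2 := by
    generalize a 0 = x
    rw [← rep₁ x, std_eq x]
    simp
  exact lt_of_lt_of_le (std_lt_std.2 (by omega : 1 < 2)) (h2.trans h1)

theorem isIncreasing_add_std (l : 𝔘.HN) : IsIncreasing fun n => l + 𝔘.std n := by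
  intro m n hmn
  dsimp only
  rw [← rep₁ l, std_eq l, std_eq l]
  simpa using hmn

theorem isDecreasing_sub_std {l : 𝔘.HN} (hl : ∀ n, 𝔘.std n ≤ l) :
    IsDecreasing fun n => l - 𝔘.std n := by
  intro m n hmn
  have := hl n
  rw [← rep₁ l, std_eq l] at *
  simp only [std_eq l, map_sub_map, map_lt_map, map_le_map] at *
  filter_upwards [this] with w hw
  omega

/-- The normal form of slow countably cofinal cuts. -/
theorem exists_eq_of_cutMul {U : Set 𝔘.HN} (hU : IsCountablyCofinal U) {c : 𝔘.HN}
    (hc : U = cutMul (below c)) : ∃ l : 𝔘.HN, U = ⋃ n, below (twoPow (l + 𝔘.std n)) := by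
  have h1 := hU.one_mem
  rw [hc] at h1
  obtain ⟨n, x, hx, hxn⟩ := h1
  -- The largest element of `below c` is `c - 1`, and its logarithm is the base exponent `l`; it is
  -- not zero because the cut contains `1`.
  have hc1 : 𝔘.std 1 ≤ c - 𝔘.std 1 := by
    clear hc
    change x < c at hx
    obtain ⟨Ω, ω, x, c, rfl, rfl⟩ := rep₂ x c
    simp only [std_eq ω, map_sub_map, map_mul_map, map_lt_map, map_le_map] at *
    filter_upwards [hx, hxn] with w h1 h2
    rcases Nat.eq_zero_or_pos (x w) with h0 | h0
    · rw [h0] at h2; omega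
    · omega
  obtain ⟨l, hl, hl'⟩ := exists_twoPow_le_lt hc1
  refine ⟨l, ?_⟩
  rw [hc]
  ext y
  rw [mem_iUnion_below]
  constructor
  · rintro ⟨n, x, hx, hy⟩
    refine ⟨n + 1, ?_⟩
    clear hc hxn
    change x < c at hx
    obtain ⟨Ω, ω, x, c, y, l, rfl, rfl, rfl, rfl⟩ := rep₄ x c y l
    simp only [std_eq ω, map_sub_map, map_mul_map, map_lt_map, map_le_map, twoPow_map,
      map_add_map] at *
    filter_upwards [hx, hy, hl', hc1] with w h1 h2 h3 h4
    have h5 : n < 2 ^ n := Nat.lt_two_pow_self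
    calc y w ≤ x w * n := h2
      _ ≤ 2 ^ (l w + 1) * n := Nat.mul_le_mul_right _ (by omega)
      _ < 2 ^ (l w + 1) * 2 ^ n := Nat.mul_lt_mul_of_pos_left h5 (by positivity)
      _ = 2 ^ (l w + (n + 1)) := by ring
  · rintro ⟨n, hn⟩
    refine ⟨2 ^ n, c - 𝔘.std 1, ?_, ?_⟩
    · change c - 𝔘.std 1 < c
      clear * - hc1
      rw [← rep₁ c, std_eq c] at *
      simp only [map_sub_map, map_le_map, map_lt_map] at *
      filter_upwards [hc1] with w h1
      omega
    · clear * - hl hn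
      obtain ⟨Ω, ω, c, y, l, rfl, rfl, rfl⟩ := rep₃ c y l
      simp only [std_eq ω, map_sub_map, map_mul_map, map_lt_map, map_le_map, twoPow_map,
        map_add_map] at *
      filter_upwards [hl, hn] with w h1 h2
      rw [pow_add] at h2
      exact h2.le.trans (Nat.mul_le_mul_right _ h1)

/-- The normal form of slow countably coinitial cuts. -/
theorem exists_eq_of_cutDiv {U : Set 𝔘.HN} {c : 𝔘.HN} (hinf : IsInfinite c)
    (hc : U = cutDiv (below c)) :
    ∃ l : 𝔘.HN, (∀ n, 𝔘.std n ≤ l) ∧ U = ⋂ n, below (twoPow (l - 𝔘.std n)) := by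
  obtain ⟨l, hl, hl'⟩ := exists_twoPow_le_lt (hinf.std_le 1)
  have hlinf : ∀ n, 𝔘.std n ≤ l := by
    intro n
    by_contra hn
    rw [not_le] at hn
    have h1 := hinf.std_le (2 ^ n)
    clear * - hn h1 hl'
    obtain ⟨Ω, ω, c, l, rfl, rfl⟩ := rep₂ c l
    simp only [std_eq ω, map_lt_map, map_le_map, twoPow_map, map_add_map] at *
    obtain ⟨w, ⟨h2, h3⟩, h4⟩ := ((hn.and h1).and hl').exists
    have := Nat.pow_le_pow_right (n := 2) two_pos (Nat.succ_le_of_lt h2)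
    simp only [Nat.succ_eq_add_one] at this
    omega
  refine ⟨l, hlinf, ?_⟩
  rw [hc]
  ext y
  rw [mem_iInter_below]
  constructor
  · intro h n
    have h1 : y * 𝔘.std (2 ^ (n + 1)) < c := h (2 ^ (n + 1))
    have h2 := hlinf n
    clear * - h1 h2 hl'
    obtain ⟨Ω, ω, c, y, l, rfl, rfl, rfl⟩ := rep₃ c y l
    simp only [std_eq ω, map_sub_map, map_mul_map, map_lt_map, map_le_map, twoPow_map,
      map_add_map] at *
    filter_upwards [h1, h2, hl'] with w h1 h2 h3
    refine Nat.lt_of_mul_lt_mul_right (a := 2 ^ (n + 1)) ?_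
    rw [← pow_add, show l w - n + (n + 1) = l w + 1 by omega]
    exact h1.trans h3
  · intro h n
    change y * 𝔘.std n < c
    have h1 := h n
    have h2 := hlinf n
    clear * - h1 h2 hl
    obtain ⟨Ω, ω, c, y, l, rfl, rfl, rfl⟩ := rep₃ c y l
    simp only [std_eq ω, map_sub_map, map_mul_map, map_lt_map, map_le_map, twoPow_map] at *
    filter_upwards [h1, h2, hl] with w h1 h2 h3
    have h5 : n < 2 ^ n := Nat.lt_two_pow_self
    calc y w * n ≤ y w * 2 ^ n := Nat.mul_le_mul_left _ h5.le
      _ < 2 ^ (l w - n) * 2 ^ n := Nat.mul_lt_mul_of_pos_right h1 (by positivity)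
      _ = 2 ^ l w := by rw [← pow_add, Nat.sub_add_cancel h2]
      _ ≤ c w := h3

theorem isCountablyCofinal_iUnion {a : ℕ → 𝔘.HN} (ha : IsIncreasing a) :
    IsCountablyCofinal (⋃ n, below (twoPow (a n))) :=
  ⟨fun n => twoPow (a n), fun m n h => twoPow_lt_twoPow.2 (ha m n h), rfl⟩

theorem isCountablyCoinitial_iInter {a : ℕ → 𝔘.HN} (ha : IsDecreasing a) :
    IsCountablyCoinitial (⋂ n, below (twoPow (a n))) :=
  ⟨fun n => twoPow (a n), fun m n h => twoPow_lt_twoPow.2 (ha m n h), rfl⟩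

theorem add_lt_twoPow {x y p q : 𝔘.HN} (hx : x < twoPow p) (hy : y < twoPow p) (hpq : p < q) :
    x + y < twoPow q := by
  obtain ⟨Ω, ω, x, y, p, q, rfl, rfl, rfl, rfl⟩ := rep₄ x y p q
  simp only [twoPow_map, map_add_map, map_lt_map] at *
  filter_upwards [hx, hy, hpq] with w h1 h2 h3
  have := Nat.pow_le_pow_right (n := 2) two_pos (Nat.succ_le_of_lt h3)
  rw [Nat.pow_succ] at this
  omega

theorem isAdditiveCut_iUnion {a : ℕ → 𝔘.HN} (ha : IsIncreasing a) :
    IsAdditiveCut (⋃ n, below (twoPow (a n))) := by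
  refine ⟨fun x y hxy hy => ?_, fun x y hx hy => ?_⟩
  · obtain ⟨n, hn⟩ := mem_iUnion_below.1 hy
    exact mem_iUnion_below.2 ⟨n, hxy.trans_lt hn⟩
  · obtain ⟨n, hn⟩ := mem_iUnion_below.1 hx
    obtain ⟨m, hm⟩ := mem_iUnion_below.1 hy
    exact mem_iUnion_below.2 ⟨max n m + 1, add_lt_twoPow
      (hn.trans_le (twoPow_le_twoPow.2 (ha.monotone (le_max_left n m))))
      (hm.trans_le (twoPow_le_twoPow.2 (ha.monotone (le_max_right n m)))) (ha _ _ (by omega))⟩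

theorem isAdditiveCut_iInter {a : ℕ → 𝔘.HN} (ha : IsDecreasing a) :
    IsAdditiveCut (⋂ n, below (twoPow (a n))) := by
  refine ⟨fun x y hxy hy => mem_iInter_below.2 fun n => hxy.trans_lt (mem_iInter_below.1 hy n),
    fun x y hx hy => mem_iInter_below.2 fun n => add_lt_twoPow (mem_iInter_below.1 hx (n + 1))
      (mem_iInter_below.1 hy (n + 1)) (ha _ _ (by omega))⟩

/-- If all exponents stay within finite distance above some `a n`, the cut consists of what lies
below the finite multiples of `2 ^ a n`. -/
theorem infinite_gaps_of_not_isSlow {a : ℕ → 𝔘.HN} (ha : IsIncreasing a)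
    (h : ¬ IsSlow (⋃ n, below (twoPow (a n)))) : ∀ n, ∃ n', ∀ m : ℕ, a n + 𝔘.std m ≤ a n' := by
  by_contra! hn
  obtain ⟨n, hn⟩ := hn
  -- The added `1` puts `2 ^ a n` itself into `below c`.
  refine h ⟨isAdditiveCut_iUnion ha, Or.inl ⟨isCountablyCofinal_iUnion ha,
    twoPow (a n) + 𝔘.std 1, ?_⟩⟩
  ext y
  rw [mem_iUnion_below]
  constructor
  · rintro ⟨n', hn'⟩
    obtain ⟨m, hm⟩ := hn n'
    refine ⟨2 ^ m, twoPow (a n), lt_add_one_iff.2 le_rfl, ?_⟩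
    generalize a n = p at *
    generalize a n' = q at *
    clear * - hn' hm
    obtain ⟨Ω, ω, y, p, q, rfl, rfl, rfl⟩ := rep₃ y p q
    simp only [std_eq ω, map_mul_map, map_lt_map, map_le_map, twoPow_map, map_add_map] at *
    filter_upwards [hn', hm] with w h1 h2
    have := Nat.pow_le_pow_right (n := 2) two_pos h2.le
    rw [pow_add] at this
    omega
  · rintro ⟨k, x, hx, hy⟩
    have hx := lt_add_one_iff.1 hx
    refine ⟨n + k, ?_⟩
    have h1 := ha.add_le n k
    generalize a n = p at *
    generalize a (n + k) = q at *
    clear * - hx hy h1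
    obtain ⟨Ω, ω, x, y, p, q, rfl, rfl, rfl, rfl⟩ := rep₄ x y p q
    simp only [std_eq ω, map_mul_map, map_lt_map, map_le_map, twoPow_map, map_add_map] at *
    filter_upwards [hx, hy, h1] with w h1 h2 h3
    have h5 : k < 2 ^ k := Nat.lt_two_pow_self
    calc y w ≤ x w * k := h2
      _ ≤ 2 ^ p w * k := Nat.mul_le_mul_right _ h1
      _ < 2 ^ p w * 2 ^ k := Nat.mul_lt_mul_of_pos_left h5 (by positivity)
      _ = 2 ^ (p w + k) := by ring
      _ ≤ 2 ^ q w := Nat.pow_le_pow_right two_pos h3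

theorem IsDecreasing.std_le {a : ℕ → 𝔘.HN} (ha : IsDecreasing a) (n m : ℕ) :
    𝔘.std m ≤ a n := by
  refine le_trans ?_ (ha.add_le n m)
  generalize a (n + m) = x
  rw [← rep₁ x, std_eq x]
  simp

theorem infinite_gaps_of_not_isSlow_decreasing {a : ℕ → 𝔘.HN} (ha : IsDecreasing a)
    (h : ¬ IsSlow (⋂ n, below (twoPow (a n)))) : ∀ n, ∃ n', ∀ m : ℕ, a n' + 𝔘.std m ≤ a n := by
  by_contra! hn
  obtain ⟨n, hn⟩ := hn
  refine h ⟨isAdditiveCut_iInter ha, Or.inr ⟨isCountablyCoinitial_iInter ha, twoPow (a n),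
    isInfinite_of_std_le fun m => (ha.std_le n m).trans (lt_twoPow_self _).le, ?_⟩⟩
  ext y
  rw [mem_iInter_below]
  constructor
  · intro hy k
    change y * 𝔘.std k < twoPow (a n)
    have h1 := hy (n + k)
    have h2 := ha.add_le n k
    generalize a n = p at *
    generalize a (n + k) = q at *
    clear * - h1 h2
    obtain ⟨Ω, ω, y, p, q, rfl, rfl, rfl⟩ := rep₃ y p q
    simp only [std_eq ω, map_mul_map, map_lt_map, map_le_map, twoPow_map, map_add_map] at *
    filter_upwards [h1, h2] with w h1 h2
    have h5 : k < 2 ^ k := Nat.lt_two_pow_self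
    calc y w * k ≤ y w * 2 ^ k := Nat.mul_le_mul_left _ h5.le
      _ < 2 ^ q w * 2 ^ k := Nat.mul_lt_mul_of_pos_right h1 (by positivity)
      _ = 2 ^ (q w + k) := by ring
      _ ≤ 2 ^ p w := Nat.pow_le_pow_right two_pos h2
  · intro hy n'
    obtain ⟨m, hm⟩ := hn n'
    have h1 : y * 𝔘.std (2 ^ m) < twoPow (a n) := hy (2 ^ m)
    generalize a n = p at *
    generalize a n' = q at *
    clear * - h1 hm
    obtain ⟨Ω, ω, y, p, q, rfl, rfl, rfl⟩ := rep₃ y p q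
    simp only [std_eq ω, map_mul_map, map_lt_map, twoPow_map, map_add_map] at *
    filter_upwards [h1, hm] with w h1 h2
    refine Nat.lt_of_mul_lt_mul_right (a := 2 ^ m) ?_
    rw [← pow_add]
    exact h1.trans_le (Nat.pow_le_pow_right two_pos h2.le)

/-- In the slow normal form all exponents are at finite distance from `l`, which an infinite gap
above `l` contradicts. -/
theorem CountablySaturated.not_isSlow (hsat : 𝔘.CountablySaturated) {a : ℕ → 𝔘.HN}
    (ha : IsIncreasing a) (h : ∀ n, ∃ n', ∀ m : ℕ, a n + 𝔘.std m ≤ a n') :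
    ¬ IsSlow (⋃ n, below (twoPow (a n))) := by
  rintro ⟨-, ⟨hc, c, hc'⟩ | ⟨hc, -⟩⟩
  · obtain ⟨l, hl⟩ := exists_eq_of_cutMul hc hc'
    have h1 : twoPow l ∈ ⋃ n, below (twoPow (a n)) := by
      rw [hl]
      exact mem_iUnion_below.2 ⟨1, twoPow_lt_twoPow.2 (lt_add_one_iff.2 le_rfl)⟩
    obtain ⟨n, hn⟩ := mem_iUnion_below.1 h1
    obtain ⟨n', hn'⟩ := h n
    have h2 : twoPow (a n') ∈ ⋃ n, below (twoPow (a n)) :=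
      mem_iUnion_below.2 ⟨n' + 1, twoPow_lt_twoPow.2 (ha _ _ (by omega))⟩
    rw [hl] at h2
    obtain ⟨m, hm⟩ := mem_iUnion_below.1 h2
    have h3 := hn' m
    rw [twoPow_lt_twoPow] at hn hm
    generalize a n = p at *
    generalize a n' = q at *
    clear * - hn hm h3
    obtain ⟨Ω, ω, p, q, l, rfl, rfl, rfl⟩ := rep₃ p q l
    simp only [std_eq ω, map_lt_map, map_le_map, map_add_map] at *
    obtain ⟨w, ⟨h1, h2⟩, h3⟩ := ((hn.and hm).and h3).exists
    omega
  · exact hsat.not_cofinal_and_coinitial (isCountablyCofinal_iUnion ha) hc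

theorem CountablySaturated.not_isSlow_decreasing (hsat : 𝔘.CountablySaturated) {a : ℕ → 𝔘.HN}
    (ha : IsDecreasing a) (h : ∀ n, ∃ n', ∀ m : ℕ, a n' + 𝔘.std m ≤ a n) :
    ¬ IsSlow (⋂ n, below (twoPow (a n))) := by
  rintro ⟨-, ⟨hc, -⟩ | ⟨hc, c, hinf, hc'⟩⟩
  · exact hsat.not_cofinal_and_coinitial hc (isCountablyCoinitial_iInter ha)
  · obtain ⟨l, hlinf, hl⟩ := exists_eq_of_cutDiv hinf hc'
    have h1 : twoPow l ∉ ⋂ n, below (twoPow (a n)) := by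
      rw [hl, mem_iInter_below]
      intro h0
      have h0 := h0 0
      rw [twoPow_lt_twoPow] at h0
      rw [← rep₁ l, std_eq l] at h0
      simp at h0
    rw [mem_iInter_below] at h1
    push Not at h1
    obtain ⟨n, hn⟩ := h1
    obtain ⟨n', hn'⟩ := h n
    have h2 : twoPow (a n') ∉ ⋂ n, below (twoPow (a n)) := fun h0 =>
      lt_irrefl _ (mem_iInter_below.1 h0 n')
    rw [hl, mem_iInter_below] at h2
    push Not at h2
    obtain ⟨m, hm⟩ := h2
    have h3 := hn' (m + 1)
    have h4 := hlinf m
    rw [twoPow_le_twoPow] at hn hm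
    generalize a n = p at *
    generalize a n' = q at *
    clear * - hn hm h3 h4
    obtain ⟨Ω, ω, p, q, l, rfl, rfl, rfl⟩ := rep₃ p q l
    simp only [std_eq ω, map_le_map, map_add_map, map_sub_map] at *
    obtain ⟨w, ⟨⟨h1, h2⟩, h3⟩, h4⟩ := (((hn.and hm).and h3).and h4).exists
    omega

/-! ### Countably determined cuts -/

theorem isInternal_le (v : 𝔘.HN) : 𝔘.IsInternal {x | x ≤ v} :=
  isInternal_rel (fun m n : ℕ => m ≤ n) v

theorem isInternal_ge (v : 𝔘.HN) : 𝔘.IsInternal {x | v ≤ x} := by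
  convert isInternal_rel (fun m n : ℕ => n ≤ m) v using 1
  ext x
  obtain ⟨Ω, ω, x, v, rfl, rfl⟩ := rep₂ x v
  simp

/-- Transfer of the existence of a maximum in a nonempty bounded set of natural numbers. -/
theorem IsInternal.exists_max {D : Set 𝔘.HN} (hD : 𝔘.IsInternal D) {x v : 𝔘.HN} (hx : x ∈ D)
    (hxv : x ≤ v) : ∃ m ∈ D, m ≤ v ∧ ∀ y ∈ D, y ≤ v → y ≤ m := by
  classical
  obtain ⟨d, rfl⟩ := hD.exists_ext
  obtain ⟨Ω, ω, d, x, v, rfl, rfl, rfl⟩ := rep₃ d x v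
  simp only [map_mem_ext, map_le_map] at hx hxv
  have key : ∀ᶠ w in (filt ω : Filter Ω), ∃ m, m ∈ d w ∧ m ≤ v w ∧
      ∀ y ∈ d w, y ≤ v w → y ≤ m := by
    filter_upwards [hx, hxv] with w h1 h2
    have h3 : ((Finset.range (v w + 1)).filter (· ∈ d w)).Nonempty :=
      ⟨x w, Finset.mem_filter.2 ⟨Finset.mem_range.2 (by omega), h1⟩⟩
    have h4 := Finset.mem_filter.1 (Finset.max'_mem _ h3)
    refine ⟨_, h4.2, Nat.lt_succ_iff.1 (Finset.mem_range.1 h4.1), fun y hy hyv => ?_⟩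
    exact Finset.le_max' _ _ (Finset.mem_filter.2 ⟨Finset.mem_range.2 (by omega), hy⟩)
  obtain ⟨ω', rfl, h⟩ := eventually_exists_iff.1 key
  refine ⟨𝔘.map Prod.snd ω', ?_, ?_, fun y hy hyv => ?_⟩
  · simp only [map_map, map_mem_ext]
    exact h.mono fun w hw => hw.1
  · simp only [map_map, map_le_map]
    exact h.mono fun w hw => hw.2.1
  · clear hx hxv key hD
    obtain ⟨Ω', ω', y, g, rfl, rfl⟩ := rep₂ y ω'
    simp only [map_map, map_mem_ext, map_le_map, eventually_filt_map] at *
    filter_upwards [h, hy, hyv] with w h1 h2 h3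
    exact h1.2.2 _ h2 h3

/-- An additive countably determined cut is countably cofinal or countably coinitial. -/
theorem CountablySaturated.cofinal_or_coinitial (hsat : 𝔘.CountablySaturated) {U : Set 𝔘.HN}
    (hU : IsAdditiveCut U) (hCD : 𝔘.IsCD U) (h1U : 𝔘.std 1 ∈ U) (huniv : U ≠ Set.univ) :
    IsCountablyCofinal U ∨ IsCountablyCoinitial U := by
  classical
  by_contra! hcon
  obtain ⟨hcof, hcoi⟩ := hcon
  have hup : ∀ x ∈ U, x + 𝔘.std 1 ∈ U := fun x hx => hU.2 _ _ hx h1U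
  have hge : ∀ x ∉ U, 𝔘.std 1 ≤ x := fun x hx => le_of_not_ge fun h => hx (hU.1 _ _ h h1U)
  have hdown : ∀ x ∈ Uᶜ, x - 𝔘.std 1 ∈ Uᶜ := by
    intro x hx hn
    refine hx ?_
    have := hup _ hn
    convert this using 1
    have h0 := hge x hx
    clear * - h0
    rw [← rep₁ x, std_eq x] at *
    simp only [map_le_map, map_sub_map, map_add_map, map_eq_map_iff] at *
    filter_upwards [h0] with w hw
    omega
  -- Otherwise a sequence in `U` without a bound in `U` would make `U` countably cofinal; `hbdd'` is
  -- the dual statement for the complement.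
  have hbdd : ∀ f : ℕ → 𝔘.HN, (∀ n, f n ∈ U) → ∃ w ∈ U, ∀ n, f n ≤ w := by
    intro f hf
    by_contra! hn
    obtain ⟨a, ha, haU, hfa⟩ := exists_increasing hup hf
    refine hcof ⟨a, ha, Set.Subset.antisymm (fun x hx => ?_) (fun x hx => ?_)⟩
    · obtain ⟨n, hn⟩ := hn x hx
      exact Set.mem_iUnion.2 ⟨n, hn.trans_le (hfa n)⟩
    · obtain ⟨n, hn⟩ := Set.mem_iUnion.1 hx
      exact hU.1 _ _ (le_of_lt hn) (haU n)
  have hbdd' : ∀ f : ℕ → 𝔘.HN, (∀ n, f n ∉ U) → ∃ w, w ∉ U ∧ ∀ n, w ≤ f n := by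
    intro f hf
    by_contra! hn
    obtain ⟨a, ha, haU, hfa⟩ := exists_decreasing hdown (fun x hx => hge x hx) (f := f) hf
    refine hcoi ⟨a, ha, Set.Subset.antisymm (fun x hx => ?_) (fun x hx => ?_)⟩
    · exact Set.mem_iInter.2 fun n => lt_of_not_ge fun h => haU n (hU.1 _ _ h hx)
    · by_contra hxU
      obtain ⟨n, hn⟩ := hn x hxU
      exact lt_asymm hn (lt_of_lt_of_le (Set.mem_iInter.1 hx n) (hfa n))
  obtain ⟨v, hv⟩ : ∃ v, v ∉ U := by
    by_contra! h
    exact huniv (Set.eq_univ_of_forall h)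
  obtain ⟨C, hC, hCU⟩ := isCD_iff.1 hCD
  -- Cofinality in `U` passes to one of any two complementary parts. The generators can thus be
  -- decided one by one, giving a single decreasing sequence of constituents cofinal in `U`.
  let Good : Set 𝔘.HN → Prop := fun D => ∀ u ∈ U, ∃ x ∈ D, x ∈ U ∧ u ≤ x
  have hsplit : ∀ D A, Good D → ¬ Good (D ∩ A) → Good (D ∩ Aᶜ) := by
    intro D A hD hA u hu
    simp only [Good, not_forall, not_exists, not_and] at hA
    obtain ⟨u', hu', hA⟩ := hA
    have hmax : max u u' ∈ U := by rcases max_choice u u' with h | h <;> rw [h] <;> assumption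
    obtain ⟨x, hxD, hxU, hx⟩ := hD _ hmax
    exact ⟨x, ⟨hxD, fun hxA => hA x ⟨hxD, hxA⟩ hxU ((le_max_right _ _).trans hx)⟩, hxU,
      (le_max_left _ _).trans hx⟩
  let step : ℕ → Set 𝔘.HN → Set 𝔘.HN := fun n D =>
    if Good (D ∩ C n) then D ∩ C n else D ∩ (C n)ᶜ
  let D : ℕ → Set 𝔘.HN := fun n => Nat.rec (motive := fun _ => Set 𝔘.HN) Set.univ step n
  have hDs : ∀ n, (Good (D n ∩ C n) ∧ D (n + 1) = D n ∩ C n) ∨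
      (¬ Good (D n ∩ C n) ∧ D (n + 1) = D n ∩ (C n)ᶜ) := by
    intro n
    by_cases h : Good (D n ∩ C n)
    · exact Or.inl ⟨h, if_pos h⟩
    · exact Or.inr ⟨h, if_neg h⟩
  have hDint : ∀ n, 𝔘.IsInternal (D n) := by
    intro n
    induction n with
    | zero => exact isInternal_univ
    | succ n ih =>
      rcases hDs n with ⟨-, h⟩ | ⟨-, h⟩ <;> rw [h]
      · exact ih.inter (hC n)
      · exact ih.inter (hC n).compl
  have hDgood : ∀ n, Good (D n) := by
    intro n
    induction n with
    | zero => exact fun u hu => ⟨u, trivial, hu, le_rfl⟩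
    | succ n ih =>
      rcases hDs n with ⟨h', h⟩ | ⟨h', h⟩ <;> rw [h]
      · exact h'
      · exact hsplit _ _ ih h'
  have hDanti : Antitone D := antitone_nat_of_succ_le fun n => by
    rcases hDs n with ⟨-, h⟩ | ⟨-, h⟩ <;> rw [h] <;> exact Set.inter_subset_left
  -- Overspill: the largest element of `D n` below a fixed `v ∉ U` cannot lie in `U`, because `D n`
  -- is cofinal there.
  have hDU : ∀ n, ∃ y ∈ D n, y ∉ U := by
    intro n
    obtain ⟨x, hxD, hxU, -⟩ := hDgood n _ h1U
    obtain ⟨m, hmD, -, hm⟩ := (hDint n).exists_max hxD (le_of_not_ge fun h => hv (hU.1 _ _ h hxU))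
    refine ⟨m, hmD, fun hmU => ?_⟩
    obtain ⟨y, hyD, hyU, hy⟩ := hDgood n _ (hup m hmU)
    have := hm y hyD (le_of_not_ge fun h => hv (hU.1 _ _ h hyU))
    exact absurd (add_one_le_iff.1 hy) (not_lt.2 this)
  choose f hfD hfU _ using fun n => hDgood n _ h1U
  choose g hgD hgU using hDU
  obtain ⟨w, hw, hfw⟩ := hbdd f hfU
  obtain ⟨w', hw', hgw⟩ := hbdd' g hgU
  -- The bounds `w ∈ U` and `w' ∉ U` keep the two limit points on their sides of the cut, yet no
  -- generator separates these points.
  obtain ⟨x, hx⟩ := hsat.exists_forall (fun n => D n ∩ {x | x ≤ w})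
    (fun n => (hDint n).inter (isInternal_le w))
    (fun N => ⟨f N, fun n hn => ⟨hDanti hn (hfD N), hfw N⟩⟩)
  obtain ⟨y, hy⟩ := hsat.exists_forall (fun n => D n ∩ {x | w' ≤ x})
    (fun n => (hDint n).inter (isInternal_ge w'))
    (fun N => ⟨g N, fun n hn => ⟨hDanti hn (hgD N), hgw N⟩⟩)
  have hyU : y ∉ U := fun h => hw' (hU.1 _ _ (hy 0).2 h)
  refine hyU (hCU x y (fun m => ?_) (hU.1 _ _ (hx 0).2 hw))
  have h1 := (hx (m + 1)).1
  have h2 := (hy (m + 1)).1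
  rcases hDs m with ⟨-, h⟩ | ⟨-, h⟩ <;> rw [h] at h1 h2
  · exact ⟨fun _ => h2.2, fun _ => h1.2⟩
  · exact ⟨fun h => absurd h h1.2, fun h => absurd h h2.2⟩

end NonstandardUniverse

/-! ### Slow countably cofinal cuts -/

/-- Sequences of residues modulo `2 ^ n` that differ by a translation by an integer. -/
def Nat.translationSetoid : Setoid (ℕ → ℕ) where
  r ρ ρ' := ∃ m m' : ℕ, ∀ n, ρ n + m ≡ ρ' n + m' [MOD 2 ^ n]
  iseqv :=
    { refl := fun ρ => ⟨0, 0, fun _ => rfl⟩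
      symm := fun ⟨m, m', h⟩ => ⟨m', m, fun n => (h n).symm⟩
      trans := by
        rintro ρ ρ' ρ'' ⟨m, m', h⟩ ⟨k, k', h'⟩
        refine ⟨m + k, k' + m', fun n => ?_⟩
        have h1 := (h n).add_right k
        have h2 := (h' n).add_right m'
        rw [add_assoc] at h1 h2
        rw [add_comm k m', ← add_assoc, add_assoc _ k'] at h2
        exact h1.trans h2 }

theorem Nat.eq_of_forall_modEq {a b : ℕ} (h : ∀ n, a ≡ b [MOD 2 ^ n]) : a = b := by
  have h1 : a + b < 2 ^ (a + b) := Nat.lt_two_pow_self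
  exact (h (a + b)).eq_of_lt_of_lt (by omega) (by omega)

/-- The chosen representative of the translation class of a sequence of residues. -/
noncomputable def Nat.translationRep (ρ : ℕ → ℕ) : ℕ → ℕ :=
  (Quotient.mk Nat.translationSetoid ρ).out

theorem Nat.exists_translationRep (ρ : ℕ → ℕ) :
    ∃ p : ℕ × ℕ, ∀ n, ρ n + p.1 ≡ Nat.translationRep ρ n + p.2 [MOD 2 ^ n] := by
  obtain ⟨m, k, h⟩ := Nat.translationSetoid.symm (Quotient.mk_out (s := Nat.translationSetoid) ρ)
  exact ⟨(m, k), h⟩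

/-- A translation that takes a sequence of residues to the chosen representative. -/
noncomputable def Nat.translation (ρ : ℕ → ℕ) : ℕ × ℕ := (Nat.exists_translationRep ρ).choose

/-- Both sequences have the same representative, and integer translations act freely on sequences of
residues, so the two chosen translations differ exactly by `d`. -/
theorem Nat.translation_spec {ρ ρ' : ℕ → ℕ} {d : ℕ} (h : ∀ n, ρ' n ≡ ρ n + d [MOD 2 ^ n]) :
    (Nat.translation ρ).1 + (Nat.translation ρ').2 =
      d + (Nat.translation ρ').1 + (Nat.translation ρ).2 := by
  have hrep : Nat.translationRep ρ = Nat.translationRep ρ' := by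
    unfold Nat.translationRep
    congr 1
    refine Quotient.sound (s := Nat.translationSetoid) ⟨d, 0, fun n => ?_⟩
    rw [Nat.add_zero]
    exact (h n).symm
  have h1 := (Nat.exists_translationRep ρ).choose_spec
  have h2 := (Nat.exists_translationRep ρ').choose_spec
  change ∀ n, ρ n + (Nat.translation ρ).1 ≡ _ + (Nat.translation ρ).2 [MOD 2 ^ n] at h1
  change ∀ n, ρ' n + (Nat.translation ρ').1 ≡ _ + (Nat.translation ρ').2 [MOD 2 ^ n] at h2
  rw [← hrep] at h2
  generalize Nat.translation ρ = p at *
  generalize Nat.translation ρ' = q at *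
  generalize Nat.translationRep ρ = σ at *
  refine Nat.eq_of_forall_modEq fun n => Nat.ModEq.add_left_cancel' (ρ n + σ n) ?_
  have e1 := (h1 n).add ((h2 n).symm.trans ((h n).add_right q.1))
  calc ρ n + σ n + (p.1 + q.2) = ρ n + p.1 + (σ n + q.2) := by ring
    _ ≡ σ n + p.2 + (ρ n + d + q.1) [MOD 2 ^ n] := e1
    _ = ρ n + σ n + (d + q.1 + p.2) := by ring

namespace NonstandardUniverse

open Filter

variable {𝔘 : NonstandardUniverse.{u}} {X Y Z Ω : Type}

/-! ### Representatives for finite distance -/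

theorem exists_eq_std_of_lt {x : 𝔘.HN} {n : ℕ} (h : x < 𝔘.std n) : ∃ i, x = 𝔘.std i := by
  by_contra! hn
  exact absurd (IsInfinite.std_le hn n) (not_le.2 h)

theorem exists_residue (x : 𝔘.HN) (n : ℕ) : ∃ i, 𝔘.map (fun m => m % 2 ^ n) x = 𝔘.std i := by
  refine exists_eq_std_of_lt (n := 2 ^ n) ?_
  rw [std_eq x, map_lt_map]
  exact Eventually.of_forall fun m => Nat.mod_lt _ (by positivity)

/-- The standard residue of `x` modulo `2 ^ n`. -/
noncomputable def residue (x : 𝔘.HN) (n : ℕ) : ℕ := (exists_residue x n).choose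

theorem residue_spec (x : 𝔘.HN) (n : ℕ) :
    𝔘.map (fun m => m % 2 ^ n) x = 𝔘.std (residue x n) := (exists_residue x n).choose_spec

theorem residue_add_std (x : 𝔘.HN) (d n : ℕ) :
    residue (x + 𝔘.std d) n ≡ residue x n + d [MOD 2 ^ n] := by
  have h1 := residue_spec x n
  have h2 := residue_spec (x + 𝔘.std d) n
  generalize residue x n = i at *
  generalize residue (x + 𝔘.std d) n = j at *
  have e : x + 𝔘.std d = 𝔘.map (fun m => m + d) x := by
    nth_rewrite 1 [← rep₁ x]
    rw [std_eq x, map_add_map]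
  rw [e, map_map] at h2
  rw [std_eq x, map_eq_map_iff] at h1 h2
  obtain ⟨w, h1, h2⟩ := (h1.and h2).exists
  rw [← h1, ← h2]
  exact (Nat.mod_modEq _ _).trans ((Nat.mod_modEq w (2 ^ n)).symm.add_right d)

theorem isInternal_residue (n i : ℕ) : 𝔘.IsInternal {x : 𝔘.HN | residue x n = i} := by
  refine ⟨𝔘.std {m | m % 2 ^ n = i}, ?_⟩
  ext x
  have h1 := residue_spec x n
  simp only [Set.mem_ofPred_eq]
  rw [← std_injective (𝔘 := 𝔘), ← h1]
  clear h1
  obtain ⟨Ω, ω, f, rfl⟩ : ∃ (Ω : Type) (ω : 𝔘.Star Ω) (f : Ω → ℕ), 𝔘.map f ω = x :=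
    ⟨ℕ, x, _, rep₁ x⟩
  simp [std_eq ω]

theorem isInternal_singleton_std (i : ℕ) : 𝔘.IsInternal {x : 𝔘.HN | x = 𝔘.std i} := by
  refine ⟨𝔘.std {i}, ?_⟩
  ext x
  obtain ⟨Ω, ω, f, rfl⟩ : ∃ (Ω : Type) (ω : 𝔘.Star Ω) (f : Ω → ℕ), 𝔘.map f ω = x :=
    ⟨ℕ, x, _, rep₁ x⟩
  simp [std_eq ω]

open Classical in
/-- A choice of an element in each class of hyperintegers at finite distance. -/
noncomputable def finiteRep (z : 𝔘.HN) : 𝔘.HN :=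
  if ∃ i, z = 𝔘.std i then 𝔘.std 0
  else z + 𝔘.std (Nat.translation (residue z)).1 - 𝔘.std (Nat.translation (residue z)).2

/-- The translation taking residues to their representative changes by exactly `-d` and compensates
the shift. For infinite `z` the subtraction is not truncated; standard `z` are all sent to `0`. -/
theorem finiteRep_add_std (z : 𝔘.HN) (d : ℕ) : finiteRep (z + 𝔘.std d) = finiteRep z := by
  unfold finiteRep
  by_cases hz : ∃ i, z = 𝔘.std i
  · obtain ⟨i, rfl⟩ := hz
    rw [if_pos ⟨i + d, std_add_std i d⟩, if_pos ⟨i, rfl⟩]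
  · have hinf : ∀ n, 𝔘.std n ≤ z := IsInfinite.std_le fun n hn => hz ⟨n, hn⟩
    have hz' : ¬ ∃ i, z + 𝔘.std d = 𝔘.std i := by
      rintro ⟨i, hi⟩
      have h1 := hinf (i + 1)
      clear hz hinf
      obtain ⟨Ω, ω, z, -, rfl, -⟩ := rep₂ z z
      simp only [std_eq ω, map_add_map, map_eq_map_iff, map_le_map] at *
      obtain ⟨w, h1, h2⟩ := (h1.and hi).exists
      omega
    rw [if_neg hz, if_neg hz']
    have h1 := Nat.translation_spec (fun n => residue_add_std z d n)
    have h2 := hinf ((Nat.translation (residue z)).2 +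
      (Nat.translation (residue (z + 𝔘.std d))).2)
    generalize Nat.translation (residue z) = p at *
    generalize Nat.translation (residue (z + 𝔘.std d)) = q at *
    clear * - h1 h2
    obtain ⟨Ω, ω, z, -, rfl, -⟩ := rep₂ z z
    simp only [std_eq ω, map_add_map, map_sub_map, map_eq_map_iff, map_le_map] at *
    filter_upwards [h2] with w h2
    omega

theorem finiteRep_of_infinite {z : 𝔘.HN} (hz : ¬ ∃ i, z = 𝔘.std i) :
    (∀ i, finiteRep z ≠ 𝔘.std i) ∧ ∃ m m', finiteRep z = z + 𝔘.std m - 𝔘.std m' := by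
  have hinf : ∀ n, 𝔘.std n ≤ z := IsInfinite.std_le fun n hn => hz ⟨n, hn⟩
  have h : finiteRep z = z + 𝔘.std (Nat.translation (residue z)).1 -
      𝔘.std (Nat.translation (residue z)).2 := if_neg hz
  refine ⟨fun i hi => ?_, _, _, h⟩
  rw [h] at hi
  have h1 := hinf ((Nat.translation (residue z)).2 + i + 1)
  generalize Nat.translation (residue z) = p at *
  clear * - hi h1
  obtain ⟨Ω, ω, z, -, rfl, -⟩ := rep₂ z z
  simp only [std_eq ω, map_add_map, map_sub_map, map_eq_map_iff, map_le_map] at *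
  obtain ⟨w, h1, h2⟩ := (h1.and hi).exists
  omega

theorem finiteRep_eq_iff {x y : 𝔘.HN} :
    finiteRep x = finiteRep y ↔ ∃ n : ℕ, hdist x y < 𝔘.std n := by
  constructor
  · intro h
    by_cases hx : ∃ i, x = 𝔘.std i <;> by_cases hy : ∃ i, y = 𝔘.std i
    · obtain ⟨i, rfl⟩ := hx
      obtain ⟨j, rfl⟩ := hy
      refine ⟨i + j + 1, ?_⟩
      rw [std_eq (𝔘.std ()) i, std_eq (𝔘.std ()) j, std_eq (𝔘.std ()) (i + j + 1)]
      simp only [hdist_map, map_lt_map, Nat.dist_lt_iff]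
      exact Eventually.of_forall fun _ => by omega
    · have h0 : finiteRep x = 𝔘.std 0 := if_pos hx
      exact absurd (h.symm.trans h0) ((finiteRep_of_infinite hy).1 0)
    · have h0 : finiteRep y = 𝔘.std 0 := if_pos hy
      exact absurd (h.trans h0) ((finiteRep_of_infinite hx).1 0)
    · obtain ⟨-, m, m', hm⟩ := finiteRep_of_infinite hx
      obtain ⟨-, k, k', hk⟩ := finiteRep_of_infinite hy
      rw [hm, hk] at h
      refine ⟨m + m' + k + k' + 1, ?_⟩
      clear * - h
      obtain ⟨Ω, ω, x, y, rfl, rfl⟩ := rep₂ x y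
      simp only [std_eq ω, map_add_map, map_sub_map, map_eq_map_iff, hdist_map, map_lt_map,
        Nat.dist_lt_iff] at *
      filter_upwards [h] with w h
      omega
  · rintro ⟨n, hn⟩
    obtain ⟨d, hd⟩ := exists_eq_std_of_lt hn
    rcases le_total x y with hxy | hxy
    · have : y = x + 𝔘.std d := by
        rw [← hd]
        clear * - hxy
        obtain ⟨Ω, ω, x, y, rfl, rfl⟩ := rep₂ x y
        simp only [hdist_map, map_add_map, map_eq_map_iff, map_le_map, Nat.dist] at *
        filter_upwards [hxy] with w h
        omega
      rw [this, finiteRep_add_std]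
    · have : x = y + 𝔘.std d := by
        rw [← hd]
        clear * - hxy
        obtain ⟨Ω, ω, x, y, rfl, rfl⟩ := rep₂ x y
        simp only [hdist_map, map_add_map, map_eq_map_iff, map_le_map, Nat.dist] at *
        filter_upwards [hxy] with w h
        omega
      rw [this, finiteRep_add_std]

theorem IsCD.preimage_hquot {A : Set 𝔘.HN} (hA : 𝔘.IsCD A) (l : 𝔘.HN) :
    𝔘.IsCD {x | hquot x l ∈ A} := by
  obtain ⟨C, hC, h⟩ := isCD_iff.1 hA
  refine isCD_iff.2 ⟨fun m => {x | hquot x l ∈ C m}, fun m => ?_, fun ξ η hm hξ => h _ _ hm hξ⟩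
  obtain ⟨c, hc⟩ := (hC m).exists_ext
  simp only [hc]
  refine ⟨𝔘.map₂ (fun s a => {x | x / 2 ^ a ∈ s}) c l, ?_⟩
  ext x
  obtain ⟨Ω, ω, x, l, c, rfl, rfl, rfl⟩ := rep₃ x l c
  simp

/-- The choice of representatives is arbitrary, but the translation depends only on the residues of
`x`, and these are decided by countably many internal sets. -/
theorem isCD_translation (p : ℕ × ℕ) :
    𝔘.IsCD {x : 𝔘.HN | (¬ ∃ i, x = 𝔘.std i) ∧ Nat.translation (residue x) = p} := by
  have h1 : 𝔘.IsCD {x : 𝔘.HN | Nat.translation (residue x) = p} := by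
    refine isCD_iff.2 ⟨fun k => {x | residue x k.unpair.1 = k.unpair.2},
      fun k => isInternal_residue _ _, fun ξ η hm hξ => ?_⟩
    have : residue ξ = residue η := by
      funext n
      have := (hm (Nat.pair n (residue ξ n))).1 (by simp)
      simpa using this.symm
    simp only [Set.mem_ofPred_eq] at *
    rw [← this, hξ]
  have h2 : 𝔘.IsCD {x : 𝔘.HN | ¬ ∃ i, x = 𝔘.std i} := by
    refine isCD_iff.2 ⟨fun k => {x | x = 𝔘.std k}, fun k => isInternal_singleton_std k,
      fun ξ η hm hξ ⟨i, hi⟩ => hξ ⟨i, (hm i).2 hi⟩⟩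
  exact MeasurableSet.inter (m := cdSpace 𝔘 ℕ) h2 h1

theorem isCD_finite : 𝔘.IsCD {x : 𝔘.HN | ∃ i, x = 𝔘.std i} :=
  isCD_iff.2 ⟨fun k => {x | x = 𝔘.std k}, fun k => isInternal_singleton_std k,
    fun _ _ hm ⟨i, hi⟩ => ⟨i, (hm i).1 hi⟩⟩

/-- On each of countably many CD pieces the translation is constant and the map is internal. The
factor `C` serves to separate distinct values modulo a target cut. -/
theorem isCD_graph_finiteRep (l C : 𝔘.HN) :
    𝔘.IsCD (𝔘.graph fun x => finiteRep (hquot x l) * C) := by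
  let B : ℕ → Set 𝔘.HN := fun n => if n = 0 then {x | ∃ i, x = 𝔘.std i} else
    {x | (¬ ∃ i, x = 𝔘.std i) ∧ Nat.translation (residue x) = (n - 1).unpair}
  have hB : ∀ n, 𝔘.IsCD (B n) := by
    intro n
    simp only [B]
    split_ifs
    · exact isCD_finite
    · exact isCD_translation _
  refine measurableSet_graph (m := cdSpace 𝔘 (ℕ × ℕ)) (fun C hC => hC.isCD)
    (B := fun n => {x | hquot x l ∈ B n}) (fun n => ((hB n).preimage_hquot l).preimage Prod.fst)
    (fun n => if n = 0 then 𝔘.std (fun _ => 0) else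
      𝔘.map₂ (fun l C => fun x => (x / 2 ^ l + (n - 1).unpair.1 - (n - 1).unpair.2) * C) l C)
    ?_ ?_
  · intro n x hx
    rcases Nat.eq_zero_or_pos n with rfl | hn
    · simp only [B, if_true, Set.mem_ofPred_eq] at hx
      rw [if_pos rfl]
      have h0 : finiteRep (hquot x l) = 𝔘.std 0 := if_pos hx
      rw [h0]
      clear * -
      obtain ⟨Ω, ω, x, C, rfl, rfl⟩ := rep₂ x C
      simp [std_eq ω]
    · have hn0 : n ≠ 0 := by omega
      simp only [B, if_neg hn0, Set.mem_ofPred_eq] at hx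
      rw [if_neg hn0]
      have h0 : finiteRep (hquot x l) = hquot x l + 𝔘.std (Nat.translation (residue _)).1 -
        𝔘.std (Nat.translation (residue _)).2 := if_neg hx.1
      rw [h0, hx.2]
      clear * -
      obtain ⟨Ω, ω, x, C, l, rfl, rfl, rfl⟩ := rep₃ x C l
      simp [std_eq ω]
  · intro x
    by_cases h : ∃ i, hquot x l = 𝔘.std i
    · exact ⟨0, by simpa [B] using h⟩
    · refine ⟨Nat.pair (Nat.translation (residue (hquot x l))).1
        (Nat.translation (residue (hquot x l))).2 + 1, ?_⟩
      simp only [B, Nat.add_eq_zero_iff, one_ne_zero, and_false, if_false, Nat.add_sub_cancel,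
        Nat.unpair_pair, Set.mem_ofPred_eq]
      exact ⟨h, trivial⟩

theorem exists_hdist_lt_add_std_iff {x y l : 𝔘.HN} :
    (∃ n : ℕ, hdist x y < twoPow (l + 𝔘.std n)) ↔ finiteRep (hquot x l) = finiteRep (hquot y l) := by
  rw [finiteRep_eq_iff]
  have hdiv : ∀ a b k P : ℕ, 0 < P → a < b + k * P → a / P < b / P + (k + 1) := by
    intro a b k P hP h
    rw [Nat.div_lt_iff_lt_mul hP]
    have h1 := Nat.div_add_mod' b P
    have h2 := Nat.mod_lt b hP
    have h3 : (b / P + (k + 1)) * P = b / P * P + k * P + P := by ring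
    omega
  have hmul : ∀ a b k P : ℕ, 0 < P → a / P < b / P + k → a < b + k * P := by
    intro a b k P hP h
    have h1 := Nat.div_add_mod' b P
    have h4 := Nat.div_add_mod' a P
    have h2 := Nat.mod_lt a hP
    have h3 := Nat.mul_le_mul_right P (Nat.succ_le_of_lt h)
    have h5 : (a / P).succ * P = a / P * P + P := by rw [Nat.succ_mul]
    have h6 : (b / P + k) * P = b / P * P + k * P := by ring
    omega
  constructor
  · rintro ⟨n, hn⟩
    refine ⟨2 ^ n + 1, ?_⟩
    obtain ⟨Ω, ω, x, y, l, rfl, rfl, rfl⟩ := rep₃ x y l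
    simp only [std_eq ω, map_add_map, hdist_map, map_lt_map, twoPow_map, hquot_map,
      Nat.dist_lt_iff] at *
    filter_upwards [hn] with w hw
    rw [pow_add, mul_comm] at hw
    exact ⟨hdiv _ _ _ _ (by positivity) hw.1, hdiv _ _ _ _ (by positivity) hw.2⟩
  · rintro ⟨n, hn⟩
    refine ⟨n, ?_⟩
    obtain ⟨Ω, ω, x, y, l, rfl, rfl, rfl⟩ := rep₃ x y l
    simp only [std_eq ω, map_add_map, hdist_map, map_lt_map, twoPow_map, hquot_map,
      Nat.dist_lt_iff] at *
    filter_upwards [hn] with w hw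
    have h1 : n * 2 ^ l w ≤ 2 ^ (l w + n) := by
      rw [pow_add, mul_comm]
      exact Nat.mul_le_mul_left _ Nat.lt_two_pow_self.le
    have h2 := hmul _ _ _ (2 ^ l w) (by positivity) hw.1
    have h3 := hmul _ _ _ (2 ^ l w) (by positivity) hw.2
    omega

/-! ### Reductions between monadic relations -/

theorem mul_std_one (g : 𝔘.HN) : g * 𝔘.std 1 = g := by
  rw [← rep₁ g, std_eq g]
  simp

/-- Distinct multiples of `C` are at least `C` apart, so equality embeds into the relation of any
nonempty cut omitting `C`. -/
theorem hdist_mul_mem_iff {U : Set 𝔘.HN} (hU : IsCut U) (hne : U.Nonempty) {C : 𝔘.HN}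
    (hC : C ∉ U) {x y : 𝔘.HN} : hdist (x * C) (y * C) ∈ U ↔ x = y := by
  constructor
  · intro h
    by_contra hxy
    refine hC (hU _ _ ?_ h)
    clear h hC
    obtain ⟨Ω, ω, x, y, C, rfl, rfl, rfl⟩ := rep₃ x y C
    simp only [map_eq_map_iff, ← eventually_filt_not, map_mul_map, hdist_map, map_le_map] at *
    filter_upwards [hxy] with w hw
    rw [Nat.dist_mul_right]
    exact Nat.le_mul_of_pos_left _ (Nat.dist_pos_of_ne hw)
  · rintro rfl
    obtain ⟨u, hu⟩ := hne
    refine hU _ _ ?_ hu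
    clear hC hu
    obtain ⟨Ω, ω, x, C, u, rfl, rfl, rfl⟩ := rep₃ x C u
    simp

theorem borelRed_diag_monadic {U : Set 𝔘.HN} (hU : IsProperAdditiveCDCut U) :
    BorelRed 𝔘.diag (monadic U) := by
  obtain ⟨hU, -, hne, huniv⟩ := hU
  obtain ⟨C, hC⟩ := (Set.ne_univ_iff_exists_notMem U).1 huniv
  have happ : ∀ x, app (𝔘.map (fun c x => x * c) C) x = x * C := by
    intro x
    clear hC
    obtain ⟨Ω, ω, x, C, rfl, rfl⟩ := rep₂ x C
    simp
  refine ⟨app (𝔘.map (fun c x => x * c) C), isBorel_graph_app _, fun x y => ?_⟩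
  rw [happ, happ]
  exact (hdist_mul_mem_iff hU.1 (Set.nonempty_iff_ne_empty.2 hne) hC).symm

theorem CountablySaturated.borelRed_of_growth (hsat : 𝔘.CountablySaturated) {a b : ℕ → 𝔘.HN}
    (ha : IsIncreasing a) (hb : IsIncreasing b)
    (h : ∀ k, ∃ n, ∀ n' > n, ∃ k' > k, a n' - a n ≤ b k' - b k) :
    BorelRed (monadic (⋃ n, below (twoPow (a n)))) (monadic (⋃ n, below (twoPow (b n)))) := by
  obtain ⟨ϑ, h1, h2⟩ := hsat.exists_borel_of_growth ha hb h
  exact ⟨ϑ, h1, fun x y => by rw [monadic_iUnion, monadic_iUnion, h2]⟩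

/-- In particular the growth condition does not depend on the sequences of exponents that present
the two cuts, which is why `CofinalLE` may ask for some pair of sequences. -/
theorem CountablySaturated.cdRed_iUnion_iff (hsat : 𝔘.CountablySaturated) {a b : ℕ → 𝔘.HN}
    (ha : IsIncreasing a) (hb : IsIncreasing b) :
    CDRed (monadic (⋃ n, below (twoPow (a n)))) (monadic (⋃ n, below (twoPow (b n)))) ↔
      ∀ k, ∃ n, ∀ n' > n, ∃ k' > k, a n' - a n ≤ b k' - b k := by
  refine ⟨?_, fun h => (hsat.borelRed_of_growth ha hb h).cdRed⟩
  rintro ⟨ϑ, h1, h2⟩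
  simp only [monadic_iUnion] at h2
  exact hsat.cofinal_growth ha hb h1 h2

theorem CountablySaturated.borelRed_iUnion_iff (hsat : 𝔘.CountablySaturated) {a b : ℕ → 𝔘.HN}
    (ha : IsIncreasing a) (hb : IsIncreasing b) :
    BorelRed (monadic (⋃ n, below (twoPow (a n)))) (monadic (⋃ n, below (twoPow (b n)))) ↔
      ∀ k, ∃ n, ∀ n' > n, ∃ k' > k, a n' - a n ≤ b k' - b k :=
  ⟨fun h => (hsat.cdRed_iUnion_iff ha hb).1 h.cdRed, hsat.borelRed_of_growth ha hb⟩

theorem CountablySaturated.borelRed_of_growth_decreasing (hsat : 𝔘.CountablySaturated)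
    {a b : ℕ → 𝔘.HN} (ha : IsDecreasing a) (hb : IsDecreasing b)
    (h : ∀ k, ∃ n, ∀ n' > n, ∃ k' > k, a n - a n' ≤ b k - b k') :
    BorelRed (monadic (⋂ n, below (twoPow (a n)))) (monadic (⋂ n, below (twoPow (b n)))) := by
  obtain ⟨ϑ, h1, h2⟩ := hsat.exists_borel_of_growth_decreasing ha hb h
  exact ⟨ϑ, h1, fun x y => by rw [monadic_iInter, monadic_iInter, h2]⟩

theorem CountablySaturated.cdRed_iInter_iff (hsat : 𝔘.CountablySaturated) {a b : ℕ → 𝔘.HN}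
    (ha : IsDecreasing a) (hb : IsDecreasing b) :
    CDRed (monadic (⋂ n, below (twoPow (a n)))) (monadic (⋂ n, below (twoPow (b n)))) ↔
      ∀ k, ∃ n, ∀ n' > n, ∃ k' > k, a n - a n' ≤ b k - b k' := by
  refine ⟨?_, fun h => (hsat.borelRed_of_growth_decreasing ha hb h).cdRed⟩
  rintro ⟨ϑ, h1, h2⟩
  simp only [monadic_iInter] at h2
  exact hsat.coinitial_growth ha hb h1 h2

theorem CountablySaturated.borelRed_iInter_iff (hsat : 𝔘.CountablySaturated) {a b : ℕ → 𝔘.HN}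
    (ha : IsDecreasing a) (hb : IsDecreasing b) :
    BorelRed (monadic (⋂ n, below (twoPow (a n)))) (monadic (⋂ n, below (twoPow (b n)))) ↔
      ∀ k, ∃ n, ∀ n' > n, ∃ k' > k, a n - a n' ≤ b k - b k' :=
  ⟨fun h => (hsat.cdRed_iInter_iff ha hb).1 h.cdRed, hsat.borelRed_of_growth_decreasing ha hb⟩

theorem CountablySaturated.monadic_cofinal (hsat : 𝔘.CountablySaturated) {U V : Set 𝔘.HN}
    (hU : IsAdditiveCut U) (hV : IsAdditiveCut V) (hUc : IsCountablyCofinal U)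
    (hVc : IsCountablyCofinal V) :
    (BorelRed (monadic U) (monadic V) ∨ BorelRed (monadic V) (monadic U)) ∧
    (BorelRed (monadic U) (monadic V) ↔ CDRed (monadic U) (monadic V)) ∧
    (CDRed (monadic U) (monadic V) ↔ CofinalLE U V) ∧
    (IsSlow U → CDRed (monadic U) (monadic V)) := by
  obtain ⟨a, ha, haU⟩ := hU.exists_increasing hUc
  obtain ⟨b, hb, hbV⟩ := hV.exists_increasing hVc
  refine ⟨?_, ?_, ⟨fun h => ?_, ?_⟩, ?_⟩
  · subst haU hbV
    rw [hsat.borelRed_iUnion_iff ha hb, hsat.borelRed_iUnion_iff hb ha, or_iff_not_imp_left]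
    -- A failure at one index bounds all growth of `b` beyond it by a single step of `a`, starting
    -- as late as desired; this is the converse growth condition.
    intro hn k
    push Not at hn
    obtain ⟨n, hn⟩ := hn
    obtain ⟨k', hk, h⟩ := hn k
    exact ⟨n, fun n' hn' => ⟨k', hk, (h n' hn').le⟩⟩
  · subst haU hbV
    rw [hsat.borelRed_iUnion_iff ha hb, hsat.cdRed_iUnion_iff ha hb]
  · rw [haU, hbV, hsat.cdRed_iUnion_iff ha hb] at h
    exact ⟨a, b, ha, hb, haU, hbV, h⟩
  · rintro ⟨a, b, ha, hb, rfl, rfl, h⟩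
    exact (hsat.cdRed_iUnion_iff ha hb).2 h
  · rintro ⟨-, ⟨-, c, hc⟩ | ⟨h, -⟩⟩
    · obtain ⟨l, hl⟩ := exists_eq_of_cutMul hUc hc
      rw [hl, hbV, hsat.cdRed_iUnion_iff (isIncreasing_add_std l) hb]
      -- The source grows by exactly `n'`, and any strictly increasing sequence grows by at least
      -- that much in `n'` steps.
      refine fun k => ⟨0, fun n' hn' => ⟨k + n', by omega, ?_⟩⟩
      have := hb.add_le k n'
      generalize b (k + n') = y at *
      generalize b k = x at *
      clear * - this
      obtain ⟨Ω, ω, x, y, l, rfl, rfl, rfl⟩ := rep₃ x y l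
      simp only [std_eq ω, map_add_map, map_sub_map, map_le_map] at *
      filter_upwards [this] with w hw
      omega
    · exact (hsat.not_cofinal_and_coinitial hUc h).elim

theorem CountablySaturated.monadic_coinitial (hsat : 𝔘.CountablySaturated) {U V : Set 𝔘.HN}
    (hU : IsAdditiveCut U) (hV : IsAdditiveCut V) (hUc : IsCountablyCoinitial U)
    (hVc : IsCountablyCoinitial V) :
    (BorelRed (monadic U) (monadic V) ∨ BorelRed (monadic V) (monadic U)) ∧
    (BorelRed (monadic U) (monadic V) ↔ CDRed (monadic U) (monadic V)) ∧
    (CDRed (monadic U) (monadic V) ↔ CoinitialLE U V) ∧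
    (IsSlow U → CDRed (monadic U) (monadic V)) := by
  obtain ⟨a, ha, haU⟩ := hU.exists_decreasing hUc
  obtain ⟨b, hb, hbV⟩ := hV.exists_decreasing hVc
  refine ⟨?_, ?_, ⟨fun h => ?_, ?_⟩, ?_⟩
  · subst haU hbV
    rw [hsat.borelRed_iInter_iff ha hb, hsat.borelRed_iInter_iff hb ha, or_iff_not_imp_left]
    intro hn k
    push Not at hn
    obtain ⟨n, hn⟩ := hn
    obtain ⟨k', hk, h⟩ := hn k
    exact ⟨n, fun n' hn' => ⟨k', hk, (h n' hn').le⟩⟩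
  · subst haU hbV
    rw [hsat.borelRed_iInter_iff ha hb, hsat.cdRed_iInter_iff ha hb]
  · rw [haU, hbV, hsat.cdRed_iInter_iff ha hb] at h
    exact ⟨a, b, ha, hb, haU, hbV, h⟩
  · rintro ⟨a, b, ha, hb, rfl, rfl, h⟩
    exact (hsat.cdRed_iInter_iff ha hb).2 h
  · rintro ⟨-, ⟨h, -⟩ | ⟨-, c, hinf, hc⟩⟩
    · exact (hsat.not_cofinal_and_coinitial h hUc).elim
    · obtain ⟨l, hlinf, hl⟩ := exists_eq_of_cutDiv hinf hc
      rw [hl, hbV, hsat.cdRed_iInter_iff (isDecreasing_sub_std hlinf) hb]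
      refine fun k => ⟨0, fun n' hn' => ⟨k + n', by omega, ?_⟩⟩
      have := hb.add_le k n'
      generalize b (k + n') = y at *
      generalize b k = x at *
      clear * - this
      obtain ⟨Ω, ω, x, y, l, rfl, rfl, rfl⟩ := rep₃ x y l
      simp only [std_eq ω, map_add_map, map_sub_map, map_le_map] at *
      filter_upwards [this] with w hw
      omega

theorem CountablySaturated.exists_finiteRep (hsat : 𝔘.CountablySaturated) {U : Set 𝔘.HN}
    (hUc : IsCountablyCofinal U) (hs : IsSlow U) :
    ∃ l, ∀ x y, monadic U x y ↔ finiteRep (hquot x l) = finiteRep (hquot y l) := by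
  obtain ⟨-, ⟨-, c, hc⟩ | ⟨h, -⟩⟩ := hs
  · obtain ⟨l, rfl⟩ := exists_eq_of_cutMul hUc hc
    exact ⟨l, fun x y => by rw [monadic_iUnion, exists_hdist_lt_add_std_iff]⟩
  · exact (hsat.not_cofinal_and_coinitial hUc h).elim

theorem CountablySaturated.monadic_cofinal_coinitial (hsat : 𝔘.CountablySaturated)
    {U V : Set 𝔘.HN} (hU : IsAdditiveCut U) (hV : IsAdditiveCut V) (hVuniv : V ≠ Set.univ)
    (hUc : IsCountablyCofinal U) (hVc : IsCountablyCoinitial V) :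
    ¬ CDRed (monadic V) (monadic U) ∧ ¬ BorelRed (monadic U) (monadic V) ∧
    (CDRed (monadic U) (monadic V) ↔ IsSlow U) := by
  obtain ⟨a, ha, haU⟩ := hU.exists_increasing hUc
  obtain ⟨b, hb, hbV⟩ := hV.exists_decreasing hVc
  have ha' : Monotone fun n => twoPow (a n) := fun m n h => twoPow_le_twoPow.2 (ha.monotone h)
  have hb' : Antitone fun n => twoPow (b n) := fun m n h => twoPow_le_twoPow.2 (hb.antitone h)
  refine ⟨?_, ?_, ?_, fun hs => ?_⟩
  · rintro ⟨ϑ, h1, h2⟩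
    simp only [haU, hbV, monadic_iUnion, monadic_iInter] at h2
    exact hsat.not_cd_of_coinitial hb ha' h1 h2
  · rintro ⟨ϑ, h1, h2⟩
    simp only [haU, hbV, monadic_iUnion, monadic_iInter] at h2
    exact hsat.not_borel_of_cofinal ha hb' h1 h2
  · rintro ⟨ϑ, h1, h2⟩
    by_contra hs
    simp only [haU, hbV, monadic_iUnion, monadic_iInter] at h2
    rw [haU] at hs
    exact hsat.not_cd_of_infinite_gaps ha (infinite_gaps_of_not_isSlow ha hs) hb' h1 h2
  · obtain ⟨l, hl⟩ := hsat.exists_finiteRep hUc hs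
    obtain ⟨C, hC⟩ := (Set.ne_univ_iff_exists_notMem V).1 hVuniv
    exact ⟨_, isCD_graph_finiteRep l C, fun x y => (hl x y).trans
      (hdist_mul_mem_iff hV.1 ⟨_, hVc.one_mem⟩ hC).symm⟩

theorem CountablySaturated.smooth_iff (hsat : 𝔘.CountablySaturated) {U : Set 𝔘.HN}
    (hU : IsProperAdditiveCDCut U) (h0 : U ≠ {𝔘.std 0}) :
    ¬ BSmooth (monadic U) ∧ (CDSmooth (monadic U) ↔ IsCountablyCofinal U ∧ IsSlow U) := by
  obtain ⟨hU, hCD, hne, huniv⟩ := hU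
  have h1U : 𝔘.std 1 ∈ U := by
    obtain ⟨u, hu⟩ := Set.nonempty_iff_ne_empty.2 hne
    have : ∃ u ∈ U, u ≠ 𝔘.std 0 := by
      by_contra! h
      exact h0 (Set.Subset.antisymm h (Set.singleton_subset_iff.2 (hU.1 _ _ (zero_le_hn u) hu)))
    obtain ⟨u, hu, hu0⟩ := this
    refine hU.1 _ _ ?_ hu
    have := add_one_le_iff.2 ((zero_le_hn u).lt_of_ne' hu0)
    rwa [std_add_std] at this
  -- Equality is distance less than `1`. With this constant threshold it is both an intersection and
  -- a union of distance conditions, so the non-reducibility results for either form apply.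
  have hc1 : Antitone fun _ : ℕ => 𝔘.std 1 := fun _ _ _ => le_rfl
  have hd1 : Monotone fun _ : ℕ => 𝔘.std 1 := fun _ _ _ => le_rfl
  rcases hsat.cofinal_or_coinitial hU hCD h1U huniv with hc | hc
  · obtain ⟨a, ha, haU⟩ := hU.exists_increasing hc
    refine ⟨?_, fun h => ⟨hc, ?_⟩, fun h => ?_⟩
    · rintro ⟨ϑ, h1, h2⟩
      refine hsat.not_borel_of_cofinal ha hc1 h1 fun x y => ?_
      rw [← monadic_iUnion, ← haU, h2, diag_iff, forall_const]
    · by_contra hs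
      obtain ⟨ϑ, h1, h2⟩ := h
      rw [haU] at hs
      refine hsat.not_cd_of_infinite_gaps ha (infinite_gaps_of_not_isSlow ha hs) hc1 h1
        fun x y => ?_
      rw [← monadic_iUnion, ← haU, h2, diag_iff, forall_const]
    · obtain ⟨l, hl⟩ := hsat.exists_finiteRep hc h.2
      refine ⟨_, isCD_graph_finiteRep l (𝔘.std 1), fun x y => ?_⟩
      simp only [mul_std_one]
      exact hl x y
  · obtain ⟨b, hb, hbU⟩ := hU.exists_decreasing hc
    have hn : ¬ CDSmooth (monadic U) := by
      rintro ⟨ϑ, h1, h2⟩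
      refine hsat.not_cd_of_coinitial hb hd1 h1 fun x y => ?_
      rw [← monadic_iInter, ← hbU, h2, diag_iff, exists_const]
    exact ⟨fun h => hn (BorelRed.cdRed h), fun h => absurd h hn,
      fun h => (hsat.not_cofinal_and_coinitial h.1 hc).elim⟩

/-! ### Fast cuts below and above countably many fast cuts -/

/-- For finitely many conditions a standard `N` serves as `g`, since every `h j` exceeds `N * N`;
saturation does the rest. -/
theorem CountablySaturated.exists_infinite_mul_le (hsat : 𝔘.CountablySaturated) {h : ℕ → 𝔘.HN}
    (hh : ∀ j m, 𝔘.std m ≤ h j) : ∃ g : 𝔘.HN, (∀ m, 𝔘.std m ≤ g) ∧ ∀ j m, g * 𝔘.std m ≤ h j := by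
  obtain ⟨ω, hω⟩ := hsat.exists_seq h
  have hh' : ∀ j m, ∀ᶠ s in (filt ω : Filter (ℕ → ℕ)), m ≤ s j := by
    intro j m
    have := hh j m
    rwa [← hω, std_eq ω, map_le_map] at this
  obtain ⟨ω', rfl, h'⟩ := hsat.exists_ext (ω := ω)
    (fun n s g => n ≤ g ∧ ∀ j ≤ n, g * n ≤ s j) (fun N => by
      have : ∀ᶠ s in (filt ω : Filter (ℕ → ℕ)), ∀ j ∈ Set.Iic N, N * N ≤ s j :=
        (eventually_all_finite (Set.finite_Iic N)).2 fun j _ => hh' j _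
      filter_upwards [this] with s hs
      exact ⟨N, fun n hn => ⟨hn, fun j hj =>
        (Nat.mul_le_mul_left _ hn).trans (hs j (hj.trans hn))⟩⟩)
  refine ⟨𝔘.map Prod.snd ω', fun m => ?_, fun j m => ?_⟩
  · rw [std_eq ω', map_le_map]
    exact (h' m).mono fun p hp => hp.1
  · rw [← hω, std_eq ω', map_mul_map, map_map, map_le_map]
    exact (h' (max j m)).mono fun p hp =>
      (Nat.mul_le_mul_left _ (le_max_right j m)).trans (hp.2 j (le_max_left j m))

theorem mul_std_sub_mul_std (g : 𝔘.HN) (m n : ℕ) :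
    g * 𝔘.std m - g * 𝔘.std n = g * 𝔘.std (m - n) := by
  rw [← rep₁ g, std_eq g, std_eq g, std_eq g]
  simp [Nat.mul_sub]

theorem sub_mul_std_sub {g : 𝔘.HN} (hg : ∀ m, 𝔘.std m ≤ g) (m n : ℕ) :
    (g * g - g * 𝔘.std m) - (g * g - g * 𝔘.std n) = g * 𝔘.std (n - m) := by
  have h1 := hg m
  have h2 := hg n
  clear hg
  obtain ⟨Ω, ω, g, rfl⟩ : ∃ (Ω : Type) (ω : 𝔘.Star Ω) (f : Ω → ℕ), 𝔘.map f ω = g :=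
    ⟨ℕ, g, _, rep₁ g⟩
  simp only [std_eq ω, map_mul_map, map_sub_map, map_le_map, map_eq_map_iff] at *
  filter_upwards [h1, h2] with w h1 h2
  rw [← Nat.mul_sub, ← Nat.mul_sub, ← Nat.mul_sub]
  congr 1
  omega

theorem mul_std_lt_mul_std {g : 𝔘.HN} (hg : 𝔘.std 1 ≤ g) {m n : ℕ} (h : m < n) :
    g * 𝔘.std m < g * 𝔘.std n := by
  obtain ⟨Ω, ω, g, rfl⟩ : ∃ (Ω : Type) (ω : 𝔘.Star Ω) (f : Ω → ℕ), 𝔘.map f ω = g :=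
    ⟨ℕ, g, _, rep₁ g⟩
  simp only [std_eq ω, map_mul_map, map_le_map, map_lt_map] at *
  filter_upwards [hg] with w hw
  exact Nat.mul_lt_mul_of_pos_left h hw

theorem isIncreasing_mul_std {g : 𝔘.HN} (hg : 𝔘.std 1 ≤ g) : IsIncreasing fun n => g * 𝔘.std n :=
  fun _ _ h => mul_std_lt_mul_std hg h

theorem isDecreasing_sub_mul_std {g : 𝔘.HN} (hg : ∀ m, 𝔘.std m ≤ g) :
    IsDecreasing fun n => g * g - g * 𝔘.std n := by
  intro m n hmn
  have h1 := hg n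
  have h2 := hg 1
  clear hg
  dsimp only
  obtain ⟨Ω, ω, g, rfl⟩ : ∃ (Ω : Type) (ω : 𝔘.Star Ω) (f : Ω → ℕ), 𝔘.map f ω = g :=
    ⟨ℕ, g, _, rep₁ g⟩
  simp only [std_eq ω, map_mul_map, map_sub_map, map_le_map, map_lt_map] at *
  filter_upwards [h1, h2] with w h1 h2
  rw [← Nat.mul_sub, ← Nat.mul_sub]
  exact Nat.mul_lt_mul_of_pos_left (by omega) h2

theorem le_sub_of_add_le {x y z : 𝔘.HN} (h : x + y ≤ z) : y ≤ z - x := by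
  obtain ⟨Ω, ω, x, y, z, rfl, rfl, rfl⟩ := rep₃ x y z
  simp only [map_add_map, map_sub_map, map_le_map] at *
  filter_upwards [h] with w h
  omega

theorem sub_le_self_hn (x y : 𝔘.HN) : x - y ≤ x := by
  obtain ⟨Ω, ω, x, y, rfl, rfl⟩ := rep₂ x y
  simp

theorem CountablySaturated.isFast_mul_std (hsat : 𝔘.CountablySaturated) {g : 𝔘.HN}
    (hg : ∀ m, 𝔘.std m ≤ g) : IsFast (⋃ n, below (twoPow (g * 𝔘.std n))) := by
  have ha := isIncreasing_mul_std (hg 1)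
  refine ⟨isAdditiveCut_iUnion ha, Or.inl (isCountablyCofinal_iUnion ha),
    hsat.not_isSlow ha fun n => ⟨n + 1, fun m => ?_⟩⟩
  have h := hg m
  clear hg ha
  obtain ⟨Ω, ω, g, rfl⟩ : ∃ (Ω : Type) (ω : 𝔘.Star Ω) (f : Ω → ℕ), 𝔘.map f ω = g :=
    ⟨ℕ, g, _, rep₁ g⟩
  simp only [std_eq ω, map_mul_map, map_add_map, map_le_map] at *
  filter_upwards [h] with w h
  rw [Nat.mul_succ]
  omega

/-- Starting from `g * g` leaves room to subtract every standard multiple of `g`, and consecutive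
exponents differ by the infinite `g`. -/
theorem CountablySaturated.isFast_sub_mul_std (hsat : 𝔘.CountablySaturated) {g : 𝔘.HN}
    (hg : ∀ m, 𝔘.std m ≤ g) : IsFast (⋂ n, below (twoPow (g * g - g * 𝔘.std n))) := by
  have ha := isDecreasing_sub_mul_std hg
  refine ⟨isAdditiveCut_iInter ha, Or.inr (isCountablyCoinitial_iInter ha),
    hsat.not_isSlow_decreasing ha fun n => ⟨n + 1, fun m => ?_⟩⟩
  have h := hg m
  have h' := hg (n + 1)
  clear hg ha
  obtain ⟨Ω, ω, g, rfl⟩ : ∃ (Ω : Type) (ω : 𝔘.Star Ω) (f : Ω → ℕ), 𝔘.map f ω = g :=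
    ⟨ℕ, g, _, rep₁ g⟩
  simp only [std_eq ω, map_mul_map, map_add_map, map_sub_map, map_le_map] at *
  filter_upwards [h, h'] with w h h'
  have := Nat.mul_le_mul_left (g w) h'
  rw [Nat.mul_succ] at *
  omega

/-- The lower cut has exponents `g * n` with every finite multiple of `g` below every chosen gap `b
i (κ i n) - b i n`, so its whole growth fits into one such gap. The upper cut has exponents `G * n`
with `G` above all `b i n`, so one of its steps exceeds the whole growth of each given cut. -/
theorem CountablySaturated.exists_fast_cofinal_bounds (hsat : 𝔘.CountablySaturated)
    {W : ℕ → Set 𝔘.HN} (hW : ∀ n, IsCountablyCofinal (W n) ∧ IsFast (W n)) :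
    ∃ U V : Set 𝔘.HN, IsCountablyCofinal U ∧ IsFast U ∧ IsCountablyCofinal V ∧ IsFast V ∧
      ∀ n, StrictBorelRed (monadic U) (monadic (W n)) ∧
        StrictBorelRed (monadic (W n)) (monadic V) := by
  choose b hb hbW using fun i => (hW i).2.1.exists_increasing (hW i).1
  have hgap : ∀ i n, ∃ n', ∀ m : ℕ, b i n + 𝔘.std m ≤ b i n' := fun i =>
    infinite_gaps_of_not_isSlow (hb i) (hbW i ▸ (hW i).2.2.2)
  choose κ hκ using hgap
  have hκlt : ∀ i n, n < κ i n := by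
    intro i n
    by_contra hn
    exact absurd (add_one_le_iff.1 (hκ i n 1)) (not_lt.2 ((hb i).monotone (not_lt.1 hn)))
  obtain ⟨g, hg, hgb⟩ := hsat.exists_infinite_mul_le
    (h := fun j => b j.unpair.1 (κ j.unpair.1 j.unpair.2) - b j.unpair.1 j.unpair.2)
    (fun j m => le_sub_of_add_le (hκ _ _ m))
  replace hgb : ∀ i n m, g * 𝔘.std m ≤ b i (κ i n) - b i n := by
    intro i n m
    have := hgb (Nat.pair i n) m
    simpa using this
  obtain ⟨G, hG⟩ := hsat.exists_gt fun j => b j.unpair.1 j.unpair.2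
  replace hG : ∀ i n, b i n < G := by
    intro i n
    have := hG (Nat.pair i n)
    simpa using this
  have hGinf : ∀ m, 𝔘.std m ≤ G := fun m =>
    (le_trans (by
      have := (hb 0).add_le 0 m
      generalize b 0 0 = x at this
      refine le_trans ?_ this
      rw [← rep₁ x, std_eq x]
      simp) (hG 0 (0 + m)).le)
  have hgi := isIncreasing_mul_std (hg 1)
  have hGi := isIncreasing_mul_std (hGinf 1)
  refine ⟨_, _, isCountablyCofinal_iUnion hgi, hsat.isFast_mul_std hg,
    isCountablyCofinal_iUnion hGi, hsat.isFast_mul_std hGinf, fun i => ?_⟩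
  rw [hbW i]
  refine ⟨⟨?_, ?_⟩, ?_, ?_⟩
  · rw [hsat.borelRed_iUnion_iff hgi (hb i)]
    refine fun k => ⟨0, fun n' _ => ⟨κ i k, hκlt i k, ?_⟩⟩
    rw [mul_std_sub_mul_std]
    exact hgb i k _
  · rw [hsat.borelRed_iUnion_iff (hb i) hgi]
    intro h
    obtain ⟨n, hn⟩ := h 0
    obtain ⟨k', -, hk'⟩ := hn _ (hκlt i n)
    rw [mul_std_sub_mul_std] at hk'
    exact absurd ((hgb i n (k' + 1)).trans hk') (not_le.2 (mul_std_lt_mul_std (hg 1) (by omega)))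
  · rw [hsat.borelRed_iUnion_iff (hb i) hGi]
    refine fun k => ⟨0, fun n' _ => ⟨k + 1, by omega, ?_⟩⟩
    rw [mul_std_sub_mul_std, Nat.add_sub_cancel_left, mul_std_one]
    exact (sub_le_self_hn _ _).trans (hG i n').le
  · rw [hsat.borelRed_iUnion_iff hGi (hb i)]
    intro h
    obtain ⟨n, hn⟩ := h 0
    obtain ⟨k', -, hk'⟩ := hn (n + 1) (by omega)
    rw [mul_std_sub_mul_std, Nat.add_sub_cancel_left, mul_std_one] at hk'
    exact absurd (hk'.trans (sub_le_self_hn _ _)) (not_le.2 (hG i k'))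

/-- As in the cofinal case, with exponents `g * g - g * n` and `G * G - G * n`; a `G` above the
initial terms `b i 0` suffices because the sequences decrease. -/
theorem CountablySaturated.exists_fast_coinitial_bounds (hsat : 𝔘.CountablySaturated)
    {W : ℕ → Set 𝔘.HN} (hW : ∀ n, IsCountablyCoinitial (W n) ∧ IsFast (W n)) :
    ∃ U V : Set 𝔘.HN, IsCountablyCoinitial U ∧ IsFast U ∧ IsCountablyCoinitial V ∧ IsFast V ∧
      ∀ n, StrictBorelRed (monadic U) (monadic (W n)) ∧
        StrictBorelRed (monadic (W n)) (monadic V) := by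
  choose b hb hbW using fun i => (hW i).2.1.exists_decreasing (hW i).1
  have hgap : ∀ i n, ∃ n', ∀ m : ℕ, b i n' + 𝔘.std m ≤ b i n := fun i =>
    infinite_gaps_of_not_isSlow_decreasing (hb i) (hbW i ▸ (hW i).2.2.2)
  choose κ hκ using hgap
  have hκlt : ∀ i n, n < κ i n := by
    intro i n
    by_contra hn
    exact absurd (add_one_le_iff.1 (hκ i n 1)) (not_lt.2 ((hb i).antitone (not_lt.1 hn)))
  obtain ⟨g, hg, hgb⟩ := hsat.exists_infinite_mul_le
    (h := fun j => b j.unpair.1 j.unpair.2 - b j.unpair.1 (κ j.unpair.1 j.unpair.2))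
    (fun j m => le_sub_of_add_le (hκ _ _ m))
  replace hgb : ∀ i n m, g * 𝔘.std m ≤ b i n - b i (κ i n) := by
    intro i n m
    have := hgb (Nat.pair i n) m
    simpa using this
  obtain ⟨G, hG⟩ := hsat.exists_gt fun i => b i 0
  have hGinf : ∀ m, 𝔘.std m ≤ G := fun m => ((hb 0).std_le 0 m).trans (hG 0).le
  have hgi := isDecreasing_sub_mul_std hg
  have hGi := isDecreasing_sub_mul_std hGinf
  refine ⟨_, _, isCountablyCoinitial_iInter hgi, hsat.isFast_sub_mul_std hg,
    isCountablyCoinitial_iInter hGi, hsat.isFast_sub_mul_std hGinf, fun i => ?_⟩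
  rw [hbW i]
  refine ⟨⟨?_, ?_⟩, ?_, ?_⟩
  · rw [hsat.borelRed_iInter_iff hgi (hb i)]
    refine fun k => ⟨0, fun n' _ => ⟨κ i k, hκlt i k, ?_⟩⟩
    rw [sub_mul_std_sub hg]
    exact hgb i k _
  · rw [hsat.borelRed_iInter_iff (hb i) hgi]
    intro h
    obtain ⟨n, hn⟩ := h 0
    obtain ⟨k', -, hk'⟩ := hn _ (hκlt i n)
    rw [sub_mul_std_sub hg] at hk'
    exact absurd ((hgb i n (k' + 1)).trans hk') (not_le.2 (mul_std_lt_mul_std (hg 1) (by omega)))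
  · rw [hsat.borelRed_iInter_iff (hb i) hGi]
    refine fun k => ⟨0, fun n' _ => ⟨k + 1, by omega, ?_⟩⟩
    rw [sub_mul_std_sub hGinf, Nat.add_sub_cancel_left, mul_std_one]
    exact (sub_le_self_hn _ _).trans (hG i).le
  · rw [hsat.borelRed_iInter_iff hGi (hb i)]
    intro h
    obtain ⟨n, hn⟩ := h 0
    obtain ⟨k', -, hk'⟩ := hn (n + 1) (by omega)
    rw [sub_mul_std_sub hGinf, Nat.add_sub_cancel_left, mul_std_one] at hk'
    exact absurd (hk'.trans (sub_le_self_hn _ _)) (not_le.2 (hG i))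

end NonstandardUniverse

theorem theoremT (𝔘 : NonstandardUniverse.{u}) (hsat : 𝔘.CountablySaturated) :
    (∀ U V : Set 𝔘.HN, IsProperAdditiveCDCut U → IsProperAdditiveCDCut V →
      BorelRed 𝔘.diag (monadic U) ∧
      -- (i), countably cofinal cuts
      (IsCountablyCofinal U → IsCountablyCofinal V →
        (BorelRed (monadic U) (monadic V) ∨ BorelRed (monadic V) (monadic U)) ∧
        (BorelRed (monadic U) (monadic V) ↔ CDRed (monadic U) (monadic V)) ∧
        (CDRed (monadic U) (monadic V) ↔ CofinalLE U V) ∧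
        (IsSlow U → CDRed (monadic U) (monadic V))) ∧
      -- (i), countably coinitial cuts
      (IsCountablyCoinitial U → IsCountablyCoinitial V →
        (BorelRed (monadic U) (monadic V) ∨ BorelRed (monadic V) (monadic U)) ∧
        (BorelRed (monadic U) (monadic V) ↔ CDRed (monadic U) (monadic V)) ∧
        (CDRed (monadic U) (monadic V) ↔ CoinitialLE U V) ∧
        (IsSlow U → CDRed (monadic U) (monadic V))) ∧
      -- (ii)
      (IsCountablyCofinal U → IsCountablyCoinitial V →
        ¬ CDRed (monadic V) (monadic U) ∧
        ¬ BorelRed (monadic U) (monadic V) ∧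
        (CDRed (monadic U) (monadic V) ↔ IsSlow U)) ∧
      -- (iii)
      (U ≠ {𝔘.std 0} →
        ¬ BSmooth (monadic U) ∧
        (CDSmooth (monadic U) ↔ IsCountablyCofinal U ∧ IsSlow U))) ∧
    -- (iv), countably cofinal cuts
    (∀ W : ℕ → Set 𝔘.HN, (∀ n, IsCountablyCofinal (W n) ∧ IsFast (W n)) →
      ∃ U V : Set 𝔘.HN,
        IsCountablyCofinal U ∧ IsFast U ∧ IsCountablyCofinal V ∧ IsFast V ∧
        ∀ n, StrictBorelRed (monadic U) (monadic (W n)) ∧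
          StrictBorelRed (monadic (W n)) (monadic V)) ∧
    -- (iv), countably coinitial cuts
    (∀ W : ℕ → Set 𝔘.HN, (∀ n, IsCountablyCoinitial (W n) ∧ IsFast (W n)) →
      ∃ U V : Set 𝔘.HN,
        IsCountablyCoinitial U ∧ IsFast U ∧ IsCountablyCoinitial V ∧ IsFast V ∧
        ∀ n, StrictBorelRed (monadic U) (monadic (W n)) ∧
          StrictBorelRed (monadic (W n)) (monadic V)) := by
  refine ⟨fun U V hU hV => ⟨NonstandardUniverse.borelRed_diag_monadic hU,
    hsat.monadic_cofinal hU.1 hV.1, hsat.monadic_coinitial hU.1 hV.1, hsat.monadic_cofinal_coinitial hU.1 hV.1 hV.2.2.2,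
    hsat.smooth_iff hU⟩, fun W hW => hsat.exists_fast_cofinal_bounds hW,
    fun W hW => hsat.exists_fast_coinitial_bounds hW⟩
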